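/- Let $\Gamma$ be a finite group, $(\rho,E)$ a finite-dimensional real representation of $\Gamma$, and $X\subset E$ a $\Gamma$-stable (full rank) lattice. The semidirect product $\Gamma\ltimes X$ has elements $x\gamma$ $(x\in X,\ \gamma\in\Gamma)$ with $(x\gamma)(y\delta)=(x+\rho(\gamma)y)\,\gamma\delta$, and it acts on $E$ by $\rho(x\gamma)e=x+\rho(\gamma)e$. An element of $\Gamma\ltimes X$ is called elliptic if it has an isolated fixpoint in $E$. For $w\in\Gamma\ltimes X$ let $L_w=\{x\,w\,(-x): x\in X\}$, and endow $\Gamma\ltimes X$ with the $\sigma$-algebra $\mathcal L$ generated by the sets $L_w$. For finite-dimensional complex representations $U,V$ of $\Gamma\ltimes X$ with characters $\chi_U,\chi_V$ put $$EP_{\Gamma\ltimes X}(U,V)=\sum_{n=0}^\infty(-1)^n\dim_{\mathbb C}\mathrm{Ext}^n_{\Gamma\ltimes X}(U,V),$$ where all the spaces $\mathrm{Ext}^n_{\Gamma\ltimes X}(U,V)$ are finite-dimensional and only finitely many of them are non-zero. Then: a) There exists a unique conjugation-invariant (positive) measure $\mu_{ell}$ on $(\Gamma\ltimes X,\mathcal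 L)$ such that, for all finite-dimensional complex representations $U,V$ of $\Gamma\ltimes X$, the function $\overline{\chi_U}\,\chi_V$ is $\mu_{ell}$-integrable and $$EP_{\Gamma\ltimes X}(U,V)=\int_{\Gamma\ltimes X}\overline{\chi_U}\,\chi_V\,d\mu_{ell}.$$ b) The support of $\mu_{ell}$, i.e. the smallest set in $\mathcal L$ whose complement has measure $0$, is the set of elliptic elements. c) Let $e\in E$ be an isolated fixpoint of an elliptic element $c\in\Gamma\ltimes X$, and let $C\subset\Gamma\ltimes X$ be the conjugacy class of $c$. Then the stabilizer $\{w\in\Gamma\ltimes X:\rho(w)e=e\}$ is finite and $$\mu_{ell}(L_c)=|\Gamma|^{-1},\qquad \mu_{ell}(C)=\frac{\#\{w\in C:\rho(w)e=e\}}{\#\{w\in\Gamma\ltimes X:\rho(w)e=e\}}.$$ Moreover the total mass is finite and equals $$\mu_{ell}(\Gamma\ltimes X)=\sum_{n=0}^\infty(-1)^n\dim_{\mathbb R}\big(\textstyle\bigwedge^nE\big)^\Gamma.$$ -/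

import Mathlib

open MeasureTheory CategoryTheory
open scoped ENNReal Topology ComplexConjugate

noncomputable section

namespace EllipticMeasure

/-- The action of `Γ` on a `Γ`-stable lattice `X` by group automorphisms. -/
def latticeAction {Γ : Type} [Group Γ] {E : Type} [AddCommGroup E] [Module ℝ E]
    (ρ : Representation ℝ Γ E) (X : Submodule ℤ E) (hX : ∀ γ, ∀ x ∈ X, ρ γ x ∈ X) :
    Γ →* MulAut (Multiplicative X) where
  toFun γ := AddEquiv.toMultiplicative
    { toFun := fun x => ⟨ρ γ x, hX γ x x.2⟩
      invFun := fun x => ⟨ρ γ⁻¹ x, hX γ⁻¹ x x.2⟩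
      left_inv := fun x => Subtype.ext (ρ.inv_self_apply γ x)
      right_inv := fun x => Subtype.ext (ρ.self_inv_apply γ x)
      map_add' := fun x y => Subtype.ext (by simp) }
  map_one' := by
    refine MulEquiv.ext fun x => Subtype.ext ?_
    change ρ 1 ((Multiplicative.toAdd x : X) : E) = ((Multiplicative.toAdd x : X) : E)
    rw [map_one, Module.End.one_apply]
  map_mul' γ δ := by
    refine MulEquiv.ext fun x => Subtype.ext ?_
    change ρ (γ * δ) ((Multiplicative.toAdd x : X) : E) =
      ρ γ (ρ δ ((Multiplicative.toAdd x : X) : E))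
    rw [map_mul, Module.End.mul_apply]

/-- The semidirect product `Γ ⋉ X`. The element `⟨x, γ⟩` is the product `x γ`, so that
`(x γ) (y δ) = (x + ρ γ y) (γ δ)`. -/
abbrev LatticeGroup {Γ : Type} [Group Γ] {E : Type} [AddCommGroup E] [Module ℝ E]
    (ρ : Representation ℝ Γ E) (X : Submodule ℤ E) (hX : ∀ γ, ∀ x ∈ X, ρ γ x ∈ X) :
    Type :=
  SemidirectProduct (Multiplicative X) Γ (latticeAction ρ X hX)

section Geometry

variable {Γ : Type} [Group Γ] {E : Type} [AddCommGroup E] [Module ℝ E]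
  {ρ : Representation ℝ Γ E} {X : Submodule ℤ E} {hX : ∀ γ, ∀ x ∈ X, ρ γ x ∈ X}

/-- The affine action of `Γ ⋉ X` on `E`: the element `x γ` sends `e` to `x + ρ γ e`. -/
def affineAct (w : LatticeGroup ρ X hX) (e : E) : E :=
  ((Multiplicative.toAdd w.left : X) : E) + ρ w.right e

/-- The `X`-conjugacy class `L_w = {x w (-x) : x ∈ X}`. -/
def latticeClass (w : LatticeGroup ρ X hX) : Set (LatticeGroup ρ X hX) :=
  Set.range fun x : Multiplicative X =>
    SemidirectProduct.inl x * w * (SemidirectProduct.inl x)⁻¹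

/-- `Γ ⋉ X` carries the σ-algebra generated by the sets `L_w`. -/
instance instMeasurableSpace : MeasurableSpace (LatticeGroup ρ X hX) :=
  MeasurableSpace.generateFrom (Set.range latticeClass)

/-- `e` is an isolated point of the set of points of `E` fixed by `w`. -/
def IsIsolatedFixpoint [TopologicalSpace E] (w : LatticeGroup ρ X hX) (e : E) : Prop :=
  affineAct w e = e ∧ ∃ N ∈ 𝓝 e, ∀ e' ∈ N, affineAct w e' = e' → e' = e

/-- `w` is elliptic if it has an isolated fixpoint in `E`. -/
def IsElliptic [TopologicalSpace E] (w : LatticeGroup ρ X hX) : Prop :=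
  ∃ e : E, IsIsolatedFixpoint w e

end Geometry

/-- `Ext^n_G(U, V)`, in the category of complex representations of `G`. -/
abbrev ExtGroup {G : Type} [Group G] (n : ℕ) (U V : Rep.{0} ℂ G) : ModuleCat ℂ :=
  ((Ext ℂ (Rep.{0} ℂ G) n).obj (Opposite.op U)).obj V

/-- The Euler-Poincaré characteristic `∑_n (-1)^n dim Ext^n_G(U, V)`. -/
def eulerPoincare {G : Type} [Group G] (U V : Rep.{0} ℂ G) : ℤ :=
  ∑ᶠ n : ℕ, (-1) ^ n * (Module.finrank ℂ (ExtGroup n U V) : ℤ)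

/-- A conjugation-invariant measure on `Γ ⋉ X` (for the σ-algebra generated by the `L_w`)
that represents the Euler-Poincaré characteristic on finite dimensional modules. -/
structure IsEllipticMeasure {Γ : Type} [Group Γ] {E : Type} [AddCommGroup E] [Module ℝ E]
    {ρ : Representation ℝ Γ E} {X : Submodule ℤ E} {hX : ∀ γ, ∀ x ∈ X, ρ γ x ∈ X}
    (μ : Measure (LatticeGroup ρ X hX)) : Prop where
  conj_invariant : ∀ g : LatticeGroup ρ X hX, MeasurePreserving (fun w => g * w * g⁻¹) μ μ
  integrable : ∀ U V : Rep.{0} ℂ (LatticeGroup ρ X hX),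
    FiniteDimensional ℂ U → FiniteDimensional ℂ V →
      Integrable (fun w => conj (U.ρ.character w) * V.ρ.character w) μ
  integral_eq : ∀ U V : Rep.{0} ℂ (LatticeGroup ρ X hX),
    FiniteDimensional ℂ U → FiniteDimensional ℂ V →
      (eulerPoincare U V : ℂ) = ∫ w, conj (U.ρ.character w) * V.ρ.character w ∂μ

/-- `S` is the support of `μ`: the smallest measurable set with `μ`-null complement. -/
def IsSupport {α : Type} [MeasurableSpace α] (μ : Measure α) (S : Set α) : Prop :=
  MeasurableSet S ∧ μ Sᶜ = 0 ∧ ∀ A : Set α, MeasurableSet A → μ Aᶜ = 0 → S ⊆ A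

/-- The representation of `Γ` on the exterior power `⋀^n E`. -/
def exteriorRep {Γ : Type} [Group Γ] {E : Type} [AddCommGroup E] [Module ℝ E]
    (ρ : Representation ℝ Γ E) (n : ℕ) : Representation ℝ Γ (⋀[ℝ]^n E) where
  toFun γ := exteriorPower.map n (ρ γ)
  map_one' := by
    rw [map_one]
    exact exteriorPower.map_id
  map_mul' γ δ := by
    rw [map_mul]
    exact exteriorPower.map_comp (n := n) (ρ δ) (ρ γ)

end EllipticMeasure

end

/-! Write G for Γ ⋉ X. The functor Hom(U, ·) is exact and preserves injectives, so Ext(U, V) =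
Ext(1, Hom(U, V)) (`nonempty_ext_equiv_ext_ihom`). Everything therefore rests on EP(1, M) for
finite-dimensional M. The central claim, `extFinite_and_extChar_unit`, is that EP(1, M) is |Γ|⁻¹
times the sum of the character of M over the elliptic X-conjugacy classes. Both sides are additive
in short exact sequences, and the quotient of M by the span of all vectors xv - v is a module on
which X acts trivially. By induction on the dimension, two extreme cases suffice.

If X acts trivially on M, the M-valued polynomial differential forms on X give an exact coresolution
of M (Poincaré lemma, `exact_deRham`). Its terms are injective: for the lattice this is Baer's
criterion together with Artin-Rees (`baer_translationRep`), and averaging over Γ does the rest.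
Hence EP(1, M) is an alternating sum of dimensions of Γ-invariants of exterior powers tensored with
M. By the identity ∑ (-1)ⁿ tr ⋀ⁿf = det(1 - f) it is the average over γ of det(1 - γ⁻¹) times the
character of M. This number is also the sum over elliptic classes, because the classes in Xγ
correspond to X/(1 - γ)X, which has |det(1 - γ)| elements when the determinant is nonzero; the
determinant is never negative, and xγ is elliptic exactly when it does not vanish.

If the vectors xv - v span M, Nakayama's lemma gives an element z of ℂ[X] of augmentation 1 that
kills M. Averaged over Γ it becomes central, acts as 1 on the trivial module and as 0 on M, so all
Ext groups vanish. Multiplication by a lattice element permutes the elliptic classes, so ∑ tr(zw) is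
the augmentation of z times ∑ tr(w); hence the character sum vanishes as well.

Elliptic elements have finite order, so there the character of Hom(U, V) is the conjugate of that of
U times that of V. Thus the measure with mass |Γ|⁻¹ on each elliptic class represents EP. Its value
on a conjugacy class follows from two orbit-stabilizer counts, compared by means of the unique
fixpoint.

For uniqueness, integrals of characters of a finite quotient H of G determine the measures of
preimages of conjugacy classes of H. Each conjugacy class of G is the intersection of such preimages
for the quotients by k!X (`mem_conjugatesOf_of_forall`), and it is a finite union of sets L_w of
equal measure. -/

noncomputable section

namespace EllipticMeasure

/-! ### Two definitions of Ext agree. -/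

section ExtComparison

variable {G : Type} [Group G]

instance instHasExtRep : HasExt.{0} (Rep.{0} ℂ G) := hasExt_of_enoughProjectives _

instance instEnoughInjectivesRep : EnoughInjectives (Rep.{0} ℂ G) :=
  EnoughInjectives.of_equivalence (Rep.equivalenceModuleMonoidAlgebra (k := ℂ) (G := G)).functor

lemma smul_extMk {U V : Rep.{0} ℂ G} (P : ProjectiveResolution U) {n : ℕ}
    (f : P.complex.X n ⟶ V) (m : ℕ) (hm : n + 1 = m) (hf : P.complex.d m n ≫ f = 0) (r : ℂ) :
    r • P.extMk f m hm hf = P.extMk (r • f) m hm (by rw [Linear.comp_smul, hf, smul_zero]) := by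
  rw [Abelian.Ext.smul_eq_comp_mk₀, ProjectiveResolution.extMk_comp_mk₀]
  simp only [Linear.comp_smul, Category.comp_id]

/-- A coboundary in degree zero factors through the term of the resolution in cochain degree 1,
which is zero. -/
lemma extMk_zero_eq_zero_iff {U V : Rep.{0} ℂ G} (P : ProjectiveResolution U)
    (f : P.complex.X 0 ⟶ V) (m : ℕ) (hm : 0 + 1 = m) (hf : P.complex.d m 0 ≫ f = 0) :
    P.extMk f m hm hf = 0 ↔ f = 0 := by
  refine ⟨fun h => ?_, fun h => by subst h; simp⟩
  rw [← P.extEquivCohomologyClass.apply_eq_iff_eq,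
    P.extEquivCohomologyClass_extMk, P.extEquivCohomologyClass_zero,
    CochainComplex.HomComplex.CohomologyClass.mk_eq_zero_iff,
    CochainComplex.HomComplex.Cocycle.toSingleMk_mem_coboundaries_iff _ _ _ _ _ 1 (by lia)] at h
  obtain ⟨g, hg⟩ := h
  have hz : Limits.IsZero (P.cochainComplex.X 1) :=
    P.cochainComplex.isZero_of_isStrictlyLE 0 1 (by simp)
  rw [hz.eq_of_src g 0, Limits.comp_zero] at hg
  rw [← cancel_epi (P.cochainComplexXIso (-(0 : ℕ)) 0 rfl).hom, ← hg, Limits.comp_zero]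

/-- The part of `Hom(P, V)` around degree `n`. -/
abbrev homComplexAt {U : Rep.{0} ℂ G} (P : ProjectiveResolution U) (V : Rep.{0} ℂ G) (n : ℕ) :
    ShortComplex (ModuleCat ℂ) :=
  (ChainComplex.linearYonedaObj P.complex ℂ V).sc' ((ComplexShape.up ℕ).prev n) n (n + 1)

/-- The cocycles of `Hom(P, V)` in degree `n`, sent to the `Ext` classes they represent. -/
def extMkLinear {U : Rep.{0} ℂ G} (P : ProjectiveResolution U) (V : Rep.{0} ℂ G) (n : ℕ) :
    LinearMap.ker (homComplexAt P V n).g.hom →ₗ[ℂ] Abelian.Ext U V n where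
  toFun f := P.extMk f.1 (n + 1) rfl f.2
  map_add' _ _ := (P.add_extMk _ _ _ _ _ _).symm
  map_smul' r _ := (smul_extMk P _ _ _ _ r).symm

lemma extMkLinear_surjective {U : Rep.{0} ℂ G} (P : ProjectiveResolution U) (V : Rep.{0} ℂ G)
    (n : ℕ) : Function.Surjective (extMkLinear P V n) := fun α => by
  obtain ⟨f, hf, h⟩ := P.extMk_surjective α (n + 1) rfl
  exact ⟨⟨f, hf⟩, h⟩

lemma ker_extMkLinear {U : Rep.{0} ℂ G} (P : ProjectiveResolution U) (V : Rep.{0} ℂ G) (n : ℕ) :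
    LinearMap.ker (extMkLinear P V n) = LinearMap.range
      (homComplexAt P V n).moduleCatToCycles := by
  ext ⟨f, hf⟩
  cases n with
  | zero =>
    refine (extMk_zero_eq_zero_iff P f _ rfl hf).trans ⟨fun h => ⟨0, ?_⟩, fun ⟨g, hg⟩ => ?_⟩
    · rw [map_zero]
      exact Subtype.ext h.symm
    -- No degree precedes 0, so `prev 0` is a default value and the differential out of it is zero
    -- by the shape of the complex.
    · have h2 : (ChainComplex.linearYonedaObj P.complex ℂ V).d ((ComplexShape.up ℕ).prev 0) 0 = 0 :=
        HomologicalComplex.shape _ _ _ (by simp)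
      have h3 := congrArg Subtype.val hg
      refine h3.symm.trans ?_
      change ((ChainComplex.linearYonedaObj P.complex ℂ V).d ((ComplexShape.up ℕ).prev 0) 0).hom g
        = 0
      rw [h2]
      rfl
  | succ n =>
    have hp : (ComplexShape.up ℕ).prev (n + 1) = n := by simp
    refine (P.extMk_eq_zero_iff f _ rfl hf n rfl).trans ?_
    rw [LinearMap.mem_range]
    -- The equality `prev (n + 1) = n` is only propositional; the degree is generalized so that it
    -- can be substituted.
    have key : ∀ (i : ℕ), i = n → ((∃ g : P.complex.X n ⟶ V, P.complex.d (n + 1) n ≫ g = f) ↔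
        ∃ g, ((ChainComplex.linearYonedaObj P.complex ℂ V).d i (n + 1)).hom g = f) := by
      rintro i rfl
      exact Iff.rfl
    exact (key _ hp).trans ⟨fun ⟨g, hg⟩ => ⟨g, Subtype.ext hg⟩,
      fun ⟨g, hg⟩ => ⟨g, congrArg Subtype.val hg⟩⟩

/-- `Ext` computed by deriving in the first variable is `Ext` of the derived category. -/
theorem nonempty_extGroup_equiv (U V : Rep.{0} ℂ G) (n : ℕ) :
    Nonempty (ExtGroup n U V ≃ₗ[ℂ] Abelian.Ext U V n) := by
  let P : ProjectiveResolution U := ProjectiveResolution.of U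
  have e1 := (P.isoExt (R := ℂ) n V).toLinearEquiv
  have e2 := ((ChainComplex.linearYonedaObj P.complex ℂ V).homologyIsoSc'
    ((ComplexShape.up ℕ).prev n) n (n + 1) rfl (by simp)).toLinearEquiv
  have e3 := (ShortComplex.moduleCatHomologyIso (homComplexAt P V n)).toLinearEquiv
  have e4 := (Submodule.quotEquivOfEq _ _ (ker_extMkLinear P V n).symm).trans
    ((extMkLinear P V n).quotKerEquivOfSurjective (extMkLinear_surjective P V n))
  exact ⟨e1.trans (e2.trans (e3.trans e4))⟩

end ExtComparison

/-! ### Euler characteristics in long exact sequences. -/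

section LongExact

/-- A sequence of vector spaces is finite if all members are finite-dimensional and almost all
vanish. -/
def IsFiniteSeq (A : ℕ → Type) [∀ n, AddCommGroup (A n)] [∀ n, Module ℂ (A n)] : Prop :=
  (∀ n, FiniteDimensional ℂ (A n)) ∧ ∃ N, ∀ n, N ≤ n → Subsingleton (A n)

/-- The Euler characteristic of a sequence of vector spaces. -/
def eulerChar (A : ℕ → Type) [∀ n, AddCommGroup (A n)] [∀ n, Module ℂ (A n)] : ℤ :=
  ∑ᶠ n : ℕ, (-1) ^ n * (Module.finrank ℂ (A n) : ℤ)

lemma eulerChar_eq_sum {A : ℕ → Type} [∀ n, AddCommGroup (A n)] [∀ n, Module ℂ (A n)] {N : ℕ}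
    (h : ∀ n, N ≤ n → Subsingleton (A n)) :
    eulerChar A = ∑ n ∈ Finset.range N, (-1) ^ n * (Module.finrank ℂ (A n) : ℤ) := by
  refine finsum_eq_sum_of_support_subset _ fun n hn => ?_
  by_contra hlt
  simp only [Finset.coe_range, Set.mem_Iio, not_lt] at hlt
  have := h n hlt
  exact hn (by simp [Module.finrank_zero_of_subsingleton])

lemma eulerChar_congr {A B : ℕ → Type} [∀ n, AddCommGroup (A n)] [∀ n, Module ℂ (A n)]
    [∀ n, AddCommGroup (B n)] [∀ n, Module ℂ (B n)] (e : ∀ n, Nonempty (A n ≃ₗ[ℂ] B n)) :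
    eulerChar A = eulerChar B :=
  finsum_congr fun n => by rw [(e n).some.finrank_eq]

lemma IsFiniteSeq.congr {A B : ℕ → Type} [∀ n, AddCommGroup (A n)] [∀ n, Module ℂ (A n)]
    [∀ n, AddCommGroup (B n)] [∀ n, Module ℂ (B n)] (e : ∀ n, Nonempty (A n ≃ₗ[ℂ] B n))
    (h : IsFiniteSeq A) : IsFiniteSeq B := by
  obtain ⟨h1, N, h2⟩ := h
  refine ⟨fun n => ?_, N, fun n hn => ?_⟩
  · have := h1 n
    exact Module.Finite.equiv (e n).some
  · have := h2 n hn
    exact (e n).some.symm.toEquiv.subsingleton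

lemma finiteDimensional_of_exact {A B C : Type} [AddCommGroup A] [AddCommGroup B] [AddCommGroup C]
    [Module ℂ A] [Module ℂ B] [Module ℂ C] (f : A →ₗ[ℂ] B) (g : B →ₗ[ℂ] C)
    (h : Function.Exact f g) [FiniteDimensional ℂ A] [FiniteDimensional ℂ C] :
    FiniteDimensional ℂ B := by
  have h1 : (LinearMap.ker g).FG := by
    rw [h.linearMap_ker_eq, ← Submodule.map_top]
    exact Submodule.FG.map f Module.Finite.fg_top
  refine ⟨Submodule.fg_of_fg_map_of_fg_inf_ker g ?_ (by simpa using h1)⟩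
  exact IsNoetherian.noetherian _

lemma subsingleton_of_exact {A B C : Type} [AddCommGroup A] [AddCommGroup B] [AddCommGroup C]
    [Module ℂ A] [Module ℂ B] [Module ℂ C] (f : A →ₗ[ℂ] B) (g : B →ₗ[ℂ] C)
    (h : Function.Exact f g) [Subsingleton A] [Subsingleton C] : Subsingleton B := by
  refine subsingleton_of_forall_eq 0 fun b => ?_
  obtain ⟨a, rfl⟩ := (h b).1 (Subsingleton.elim _ _)
  rw [Subsingleton.elim a 0, map_zero]

lemma finrank_eq_of_exact {A B C : Type} [AddCommGroup A] [AddCommGroup B] [AddCommGroup C]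
    [Module ℂ A] [Module ℂ B] [Module ℂ C] (f : A →ₗ[ℂ] B) (g : B →ₗ[ℂ] C)
    (h : Function.Exact f g) [FiniteDimensional ℂ B] :
    (Module.finrank ℂ B : ℤ) =
      Module.finrank ℂ (LinearMap.range f) + Module.finrank ℂ (LinearMap.range g) := by
  have := LinearMap.finrank_range_add_finrank_ker g
  rw [h.linearMap_ker_eq] at this
  omega

variable {A B C : ℕ → Type} [∀ n, AddCommGroup (A n)] [∀ n, Module ℂ (A n)]
    [∀ n, AddCommGroup (B n)] [∀ n, Module ℂ (B n)] [∀ n, AddCommGroup (C n)]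
    [∀ n, Module ℂ (C n)] (f : ∀ n, A n →ₗ[ℂ] B n) (g : ∀ n, B n →ₗ[ℂ] C n)
    (δ : ∀ n, C n →ₗ[ℂ] A (n + 1)) (hf : Function.Injective (f 0))
    (hfg : ∀ n, Function.Exact (f n) (g n)) (hgδ : ∀ n, Function.Exact (g n) (δ n))
    (hδf : ∀ n, Function.Exact (δ n) (f (n + 1)))

include hf hδf in
lemma IsFiniteSeq.left_of_exact (hB : IsFiniteSeq B) (hC : IsFiniteSeq C) : IsFiniteSeq A := by
  obtain ⟨hB, N, hB'⟩ := hB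
  obtain ⟨hC, M, hC'⟩ := hC
  refine ⟨fun n => ?_, max N M + 1, fun n hn => ?_⟩
  · cases n with
    | zero =>
      have := hB 0
      exact FiniteDimensional.of_injective (f 0) hf
    | succ n =>
      have := hC n
      have := hB (n + 1)
      exact finiteDimensional_of_exact _ _ (hδf n)
  · obtain ⟨n, rfl⟩ : ∃ m, n = m + 1 := ⟨n - 1, by omega⟩
    have := hC' n (by omega)
    have := hB' (n + 1) (by omega)
    exact subsingleton_of_exact _ _ (hδf n)

include hfg in
lemma IsFiniteSeq.middle_of_exact (hA : IsFiniteSeq A) (hC : IsFiniteSeq C) : IsFiniteSeq B := by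
  obtain ⟨hA, N, hA'⟩ := hA
  obtain ⟨hC, M, hC'⟩ := hC
  refine ⟨fun n => ?_, max N M, fun n hn => ?_⟩
  · have := hA n
    have := hC n
    exact finiteDimensional_of_exact _ _ (hfg n)
  · have := hA' n (by omega)
    have := hC' n (by omega)
    exact subsingleton_of_exact _ _ (hfg n)

include hf hfg hgδ hδf in
lemma eulerChar_of_exact (hA : IsFiniteSeq A) (hB : IsFiniteSeq B) (hC : IsFiniteSeq C) :
    eulerChar B = eulerChar A + eulerChar C := by
  obtain ⟨hA, N₁, hA'⟩ := hA
  obtain ⟨hB, N₂, hB'⟩ := hB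
  obtain ⟨hC, N₃, hC'⟩ := hC
  set N := max N₁ (max N₂ N₃) + 1 with hN
  rw [eulerChar_eq_sum (N := N) fun n hn => hA' n (by omega),
    eulerChar_eq_sum (N := N) fun n hn => hB' n (by omega),
    eulerChar_eq_sum (N := N) fun n hn => hC' n (by omega)]
  have hb (n : ℕ) := finrank_eq_of_exact _ _ (hfg n)
  have hc (n : ℕ) := finrank_eq_of_exact _ _ (hgδ n)
  have ha (n : ℕ) := finrank_eq_of_exact _ _ (hδf n)
  have ha0 : (Module.finrank ℂ (A 0) : ℤ) = Module.finrank ℂ (LinearMap.range (f 0)) := by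
    rw [LinearMap.finrank_range_of_inj hf]
  -- The truncated alternating sum telescopes to the rank of the last connecting map, which vanishes
  -- once `C m` does.
  have key : ∀ m, ∑ n ∈ Finset.range (m + 1), (-1) ^ n * (Module.finrank ℂ (A n) : ℤ) +
      ∑ n ∈ Finset.range (m + 1), (-1) ^ n * (Module.finrank ℂ (C n) : ℤ) -
      ∑ n ∈ Finset.range (m + 1), (-1) ^ n * (Module.finrank ℂ (B n) : ℤ) =
      (-1) ^ m * Module.finrank ℂ (LinearMap.range (δ m)) := by
    intro m
    induction m with
    | zero =>
      simp only [zero_add, Finset.sum_range_one, pow_zero, one_mul]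
      rw [ha0, hb 0, hc 0]
      ring
    | succ m ih =>
      rw [Finset.sum_range_succ, Finset.sum_range_succ _ (m + 1),
        Finset.sum_range_succ _ (m + 1), ha m, hb (m + 1), hc (m + 1)]
      rw [pow_succ]
      linear_combination ih
  have h0 : Module.finrank ℂ (LinearMap.range (δ (max N₁ (max N₂ N₃)))) = 0 := by
    have := hC' (max N₁ (max N₂ N₃)) (by omega)
    have : Subsingleton (LinearMap.range (δ (max N₁ (max N₂ N₃)))) := by
      refine subsingleton_of_forall_eq 0 ?_
      rintro ⟨_, c, rfl⟩
      exact Subtype.ext (by simp [Subsingleton.elim c 0])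
    exact Module.finrank_zero_of_subsingleton
  have := key (max N₁ (max N₂ N₃))
  rw [h0, Nat.cast_zero, mul_zero, ← hN] at this
  linarith

end LongExact

/-! ### The covariant long exact sequence of Ext. -/

section ExtSequence

variable {G : Type} [Group G] (U : Rep.{0} ℂ G)

/-- The map on `Ext` induced by a morphism in the second variable. -/
abbrev extMap {V W : Rep.{0} ℂ G} (f : V ⟶ W) (n : ℕ) :
    Abelian.Ext U V n →ₗ[ℂ] Abelian.Ext U W n :=
  (Abelian.Ext.mk₀ f).postcompOfLinear ℂ U (add_zero n)

/-- The connecting map on `Ext`. -/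
abbrev extDelta {S : ShortComplex (Rep.{0} ℂ G)} (hS : S.ShortExact) (n : ℕ) :
    Abelian.Ext U S.X₃ n →ₗ[ℂ] Abelian.Ext U S.X₁ (n + 1) :=
  hS.extClass.postcompOfLinear ℂ U rfl

variable {S : ShortComplex (Rep.{0} ℂ G)} (hS : S.ShortExact)
include hS

lemma extMap_injective : Function.Injective (extMap U S.f 0) := by
  have := hS.mono_f
  exact Abelian.Ext.postcomp_mk₀_injective_of_mono U S.f

lemma exact_extMap (n : ℕ) : Function.Exact (extMap U S.f n) (extMap U S.g n) := fun x => by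
  refine ⟨fun h => Abelian.Ext.covariant_sequence_exact₂ U hS x h, ?_⟩
  rintro ⟨y, rfl⟩
  change (y.comp (Abelian.Ext.mk₀ S.f) (add_zero n)).comp (Abelian.Ext.mk₀ S.g) (add_zero n) = 0
  rw [Abelian.Ext.comp_assoc_of_second_deg_zero, Abelian.Ext.mk₀_comp_mk₀, S.zero]
  simp

lemma exact_extMap_extDelta (n : ℕ) : Function.Exact (extMap U S.g n) (extDelta U hS n) :=
  fun x => by
  refine ⟨fun h => Abelian.Ext.covariant_sequence_exact₃ U hS x rfl h, ?_⟩
  rintro ⟨y, rfl⟩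
  change (y.comp (Abelian.Ext.mk₀ S.g) (add_zero n)).comp hS.extClass rfl = 0
  rw [Abelian.Ext.comp_assoc_of_second_deg_zero, hS.comp_extClass]
  simp

lemma exact_extDelta_extMap (n : ℕ) : Function.Exact (extDelta U hS n) (extMap U S.f (n + 1)) :=
  fun x => by
  refine ⟨fun h => Abelian.Ext.covariant_sequence_exact₁ U hS x h rfl, ?_⟩
  rintro ⟨y, rfl⟩
  change (y.comp hS.extClass rfl).comp (Abelian.Ext.mk₀ S.f) (add_zero (n + 1)) = 0
  rw [Abelian.Ext.comp_assoc_of_third_deg_zero, hS.extClass_comp]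
  simp

omit hS

/-- All `Ext^n(U, V)` are finite-dimensional and almost all vanish. -/
def ExtFinite (U V : Rep.{0} ℂ G) : Prop := IsFiniteSeq fun n => Abelian.Ext U V n

/-- The Euler characteristic of `Ext(U, V)`. -/
def extChar (U V : Rep.{0} ℂ G) : ℤ := eulerChar fun n => Abelian.Ext U V n

include hS in
lemma ExtFinite.left (h2 : ExtFinite U S.X₂) (h3 : ExtFinite U S.X₃) : ExtFinite U S.X₁ :=
  IsFiniteSeq.left_of_exact _ _ (extMap_injective U hS) (exact_extDelta_extMap U hS) h2 h3

include hS in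
lemma ExtFinite.middle (h1 : ExtFinite U S.X₁) (h3 : ExtFinite U S.X₃) : ExtFinite U S.X₂ :=
  IsFiniteSeq.middle_of_exact _ _ (exact_extMap U hS) h1 h3

include hS in
lemma extChar_add (h1 : ExtFinite U S.X₁) (h2 : ExtFinite U S.X₂) (h3 : ExtFinite U S.X₃) :
    extChar U S.X₂ = extChar U S.X₁ + extChar U S.X₃ :=
  eulerChar_of_exact _ _ _ (extMap_injective U hS) (exact_extMap U hS)
    (exact_extMap_extDelta U hS) (exact_extDelta_extMap U hS) h1 h2 h3

/-- Dimension shifting along an embedding into an injective object. -/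
def extSuccEquiv (hS : S.ShortExact) [Injective S.X₂] (n : ℕ) :
    (Abelian.Ext U S.X₃ n ⧸ LinearMap.range (extMap U S.g n)) ≃ₗ[ℂ] Abelian.Ext U S.X₁ (n + 1) :=
  (Submodule.quotEquivOfEq _ _ (exact_extMap_extDelta U hS n).linearMap_ker_eq.symm).trans
    ((extDelta U hS n).quotKerEquivOfSurjective fun x =>
      (exact_extDelta_extMap U hS n x).1 (Abelian.Ext.eq_zero_of_injective _))

lemma extFinite_of_injective {J : Rep.{0} ℂ G} [Injective J] (h : FiniteDimensional ℂ (U ⟶ J)) :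
    ExtFinite U J := by
  refine ⟨fun n => ?_, 1, fun n hn => ?_⟩
  · cases n with
    | zero => exact Module.Finite.equiv (Abelian.Ext.linearEquiv₀ (R := ℂ) (X := U) (Y := J)).symm
    | succ n =>
      have : Subsingleton (Abelian.Ext U J (n + 1)) :=
        subsingleton_of_forall_eq 0 fun x => Abelian.Ext.eq_zero_of_injective x
      infer_instance
  · obtain ⟨m, rfl⟩ : ∃ m, n = m + 1 := ⟨n - 1, by omega⟩
    exact subsingleton_of_forall_eq 0 fun x => Abelian.Ext.eq_zero_of_injective x

lemma extChar_of_injective (J : Rep.{0} ℂ G) [Injective J] :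
    extChar U J = Module.finrank ℂ (U ⟶ J) := by
  rw [extChar, eulerChar_eq_sum (N := 1) fun n hn => ?_]
  · rw [Finset.sum_range_one, pow_zero, one_mul,
      (Abelian.Ext.linearEquiv₀ (R := ℂ) (X := U) (Y := J)).finrank_eq]
  · obtain ⟨m, rfl⟩ : ∃ m, n = m + 1 := ⟨n - 1, by omega⟩
    exact subsingleton_of_forall_eq 0 fun x => Abelian.Ext.eq_zero_of_injective x

end ExtSequence

/-! ### Reduction to the trivial first argument by the internal Hom. -/

section InternalHom

open MonoidalCategory

variable {G : Type} [Group G] (U : Rep.{0} ℂ G)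

lemma shortExact_iff {S : ShortComplex (Rep.{0} ℂ G)} : S.ShortExact ↔
    Function.Injective S.f.hom ∧ Function.Exact S.f.hom S.g.hom ∧
      Function.Surjective S.g.hom := by
  have key : S.Exact ↔ Function.Exact S.f.hom S.g.hom := by
    rw [← ShortComplex.exact_map_iff_of_faithful S (forget₂ (Rep.{0} ℂ G) (ModuleCat ℂ)),
      ShortComplex.ShortExact.moduleCat_exact_iff_function_exact]
    rfl
  refine ⟨fun h => ⟨(Rep.mono_iff_injective _).1 h.mono_f, key.1 h.exact,
    (Rep.epi_iff_surjective _).1 h.epi_g⟩, fun ⟨h1, h2, h3⟩ => ?_⟩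
  exact { exact := key.2 h2
          mono_f := (Rep.mono_iff_injective _).2 h1
          epi_g := (Rep.epi_iff_surjective _).2 h3 }

instance : (Rep.ihom U).Additive where
  map_add := Rep.hom_ext (Representation.IntertwiningMap.ext
    (LinearMap.ext fun _ => LinearMap.ext fun _ => rfl))

/-- Exactness concerns only the underlying vector spaces, where linear one-sided inverses of the two
maps exist. -/
lemma shortExact_map_ihom {S : ShortComplex (Rep.{0} ℂ G)} (hS : S.ShortExact) :
    (S.map (Rep.ihom U)).ShortExact := by
  obtain ⟨h1, h2, h3⟩ := shortExact_iff.1 hS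
  obtain ⟨l, hl⟩ := LinearMap.exists_leftInverse_of_injective S.f.hom.toLinearMap
    (LinearMap.ker_eq_bot.2 h1)
  obtain ⟨r, hr⟩ := LinearMap.exists_rightInverse_of_surjective S.g.hom.toLinearMap
    (LinearMap.range_eq_top.2 h3)
  refine shortExact_iff.2 ⟨fun (φ : U →ₗ[ℂ] S.X₁) (ψ : U →ₗ[ℂ] S.X₁) h => ?_,
    fun (φ : U →ₗ[ℂ] S.X₂) => ⟨fun h => ⟨(l ∘ₗ φ : U →ₗ[ℂ] S.X₁), ?_⟩, ?_⟩,
    fun (φ : U →ₗ[ℂ] S.X₃) => ⟨(r ∘ₗ φ : U →ₗ[ℂ] S.X₂), ?_⟩⟩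
  · exact LinearMap.ext fun u => h1 (LinearMap.congr_fun h u)
  · refine LinearMap.ext fun u => ?_
    obtain ⟨a, ha⟩ := (h2 (φ u)).1 (LinearMap.congr_fun h u)
    change S.f.hom (l (φ u)) = φ u
    rw [← ha]
    exact congrArg _ (LinearMap.congr_fun hl a)
  · rintro ⟨ψ, rfl⟩
    exact LinearMap.ext fun u => (h2 _).2 ⟨_, rfl⟩
  · exact LinearMap.ext fun u => LinearMap.congr_fun hr (φ u)

instance : (tensorLeft U).PreservesMonomorphisms where
  preserves {V W} f hf := by
    rw [Rep.mono_iff_injective] at hf ⊢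
    exact Module.Flat.lTensor_preserves_injective_linearMap (M := U) f.hom.toLinearMap hf

/-- The left adjoint, tensoring with `U`, preserves monomorphisms because vector spaces are flat;
hence the right adjoint preserves injectives. -/
lemma injective_ihom (J : Rep.{0} ℂ G) [Injective J] : Injective ((Rep.ihom U).obj J) :=
  (ihom.adjunction U).map_injective J inferInstance

/-- Morphisms `U ⟶ V` are invariants of `Hom(U, V)`. -/
def homEquivIhom (V : Rep.{0} ℂ G) : (U ⟶ V) ≃ₗ[ℂ] (𝟙_ (Rep.{0} ℂ G) ⟶ (Rep.ihom U).obj V) :=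
  (Linear.homCongr ℂ (ρ_ U).symm (Iso.refl V)).trans
    (Rep.MonoidalClosed.linearHomEquiv U (𝟙_ (Rep.{0} ℂ G)) V)

lemma homEquivIhom_naturality {V W : Rep.{0} ℂ G} (f : U ⟶ V) (g : V ⟶ W) :
    homEquivIhom U W (f ≫ g) = homEquivIhom U V f ≫ (Rep.ihom U).map g := by
  have h (X : Rep.{0} ℂ G) (k : U ⟶ X) : homEquivIhom U X k =
      (ihom.adjunction U).homEquiv (𝟙_ (Rep.{0} ℂ G)) X ((ρ_ U).hom ≫ k) := by
    change (ihom.adjunction U).homEquiv (𝟙_ (Rep.{0} ℂ G)) X (((ρ_ U).hom ≫ k) ≫ 𝟙 X) = _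
    rw [Category.comp_id]
  rw [h, h, ← Category.assoc]
  exact (ihom.adjunction U).homEquiv_naturality_right _ _

/-- Dimension shifting: the internal Hom carries an embedding of `V` into an injective to another
such embedding, so each Ext of degree n + 1 is a cokernel between Ext groups of degree n. For n > 0
the injective contributes nothing and the induction hypothesis applies; for n = 0 the naturality of
the adjunction matches the two cokernels. -/
theorem nonempty_ext_equiv_ext_ihom (n : ℕ) (V : Rep.{0} ℂ G) :
    Nonempty (Abelian.Ext U V n ≃ₗ[ℂ]
      Abelian.Ext (𝟙_ (Rep.{0} ℂ G)) ((Rep.ihom U).obj V) n) := by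
  induction n generalizing V with
  | zero => exact ⟨Abelian.Ext.linearEquiv₀.trans
      ((homEquivIhom U V).trans Abelian.Ext.linearEquiv₀.symm)⟩
  | succ n ih =>
    let S : ShortComplex (Rep.{0} ℂ G) := ShortComplex.mk (Injective.ι V)
      (Limits.cokernel.π (Injective.ι V)) (Limits.cokernel.condition _)
    have hS : S.ShortExact := { exact := ShortComplex.exact_of_g_is_cokernel _
                                  (Limits.cokernelIsCokernel (Injective.ι V)) }
    have : Injective S.X₂ := inferInstanceAs (Injective (Injective.under V))
    have : Injective (S.map (Rep.ihom U)).X₂ := injective_ihom U S.X₂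
    have e1 := extSuccEquiv U hS n
    have e2 := extSuccEquiv (𝟙_ (Rep.{0} ℂ G)) (shortExact_map_ihom U hS) n
    suffices h : Nonempty ((Abelian.Ext U S.X₃ n ⧸ LinearMap.range (extMap U S.g n)) ≃ₗ[ℂ]
        (Abelian.Ext (𝟙_ (Rep.{0} ℂ G)) (S.map (Rep.ihom U)).X₃ n ⧸ LinearMap.range
          (extMap (𝟙_ (Rep.{0} ℂ G)) (S.map (Rep.ihom U)).g n))) from
      ⟨e1.symm.trans (h.some.trans e2)⟩
    cases n with
    | zero =>
      let φ (W : Rep.{0} ℂ G) : Abelian.Ext U W 0 ≃ₗ[ℂ]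
          Abelian.Ext (𝟙_ (Rep.{0} ℂ G)) ((Rep.ihom U).obj W) 0 :=
        Abelian.Ext.linearEquiv₀.trans ((homEquivIhom U W).trans Abelian.Ext.linearEquiv₀.symm)
      have hφ (W : Rep.{0} ℂ G) (f : U ⟶ W) :
          φ W (Abelian.Ext.mk₀ f) = Abelian.Ext.mk₀ (homEquivIhom U W f) := by
        have : Abelian.Ext.mk₀ f = (Abelian.Ext.linearEquiv₀ (R := ℂ)).symm f := rfl
        rw [this, LinearEquiv.trans_apply, LinearEquiv.apply_symm_apply]
        rfl
      refine ⟨Submodule.Quotient.equiv _ _ (φ S.X₃) ?_⟩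
      have key (x : Abelian.Ext U S.X₂ 0) : φ S.X₃ (extMap U S.g 0 x) =
          extMap (𝟙_ (Rep.{0} ℂ G)) (S.map (Rep.ihom U)).g 0 (φ S.X₂ x) := by
        obtain ⟨f, rfl⟩ := (Abelian.Ext.mk₀_bijective U S.X₂).2 x
        have h1 : extMap U S.g 0 (Abelian.Ext.mk₀ f) = Abelian.Ext.mk₀ (f ≫ S.g) :=
          Abelian.Ext.mk₀_comp_mk₀ _ _
        rw [h1, hφ, hφ, homEquivIhom_naturality]
        exact (Abelian.Ext.mk₀_comp_mk₀ _ _).symm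
      ext y
      constructor
      · rintro ⟨_, ⟨x, rfl⟩, rfl⟩
        exact ⟨φ S.X₂ x, (key x).symm⟩
      · rintro ⟨x, rfl⟩
        exact ⟨extMap U S.g 0 ((φ S.X₂).symm x), ⟨_, rfl⟩,
          (key _).trans (congrArg _ ((φ S.X₂).apply_symm_apply x))⟩
    | succ n =>
      have h1 : LinearMap.range (extMap U S.g (n + 1)) = ⊥ := by
        rw [LinearMap.range_eq_bot]
        refine LinearMap.ext fun x => ?_
        rw [Abelian.Ext.eq_zero_of_injective x, map_zero, LinearMap.zero_apply]
      have h2 : LinearMap.range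
          (extMap (𝟙_ (Rep.{0} ℂ G)) (S.map (Rep.ihom U)).g (n + 1)) = ⊥ := by
        rw [LinearMap.range_eq_bot]
        refine LinearMap.ext fun x => ?_
        rw [Abelian.Ext.eq_zero_of_injective x, map_zero, LinearMap.zero_apply]
      exact ⟨(Submodule.quotEquivOfEqBot _ h1).trans ((ih S.X₃).some.trans
        (Submodule.quotEquivOfEqBot _ h2).symm)⟩

end InternalHom

/-! ### Central elements of the group algebra and vanishing of Ext. -/

section NaturalEndomorphism

variable {G : Type} [Group G] (U : Rep.{0} ℂ G)

/-- In degree zero, naturality moves the endomorphism from `V` to `U`, where it is scalar. In higher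
degrees every class comes from a connecting map, which is natural too. -/
lemma ext_comp_natural_endomorphism (ζ : 𝟭 (Rep.{0} ℂ G) ⟶ 𝟭 (Rep.{0} ℂ G)) (c : ℂ)
    (hU : ζ.app U = c • 𝟙 U) (n : ℕ) (V : Rep.{0} ℂ G) (x : Abelian.Ext U V n) :
    x.comp (Abelian.Ext.mk₀ (ζ.app V)) (add_zero n) = c • x := by
  induction n generalizing V with
  | zero =>
    obtain ⟨f, rfl⟩ := (Abelian.Ext.mk₀_bijective U V).2 x
    have h : f ≫ ζ.app V = ζ.app U ≫ f := ζ.naturality f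
    rw [Abelian.Ext.mk₀_comp_mk₀, h, hU, Linear.smul_comp, Abelian.Ext.mk₀_smul]
    exact congrArg (fun k => c • Abelian.Ext.mk₀ k) (Category.id_comp f)
  | succ n ih =>
    let S : ShortComplex (Rep.{0} ℂ G) := ShortComplex.mk (Injective.ι V)
      (Limits.cokernel.π (Injective.ι V)) (Limits.cokernel.condition _)
    have hS : S.ShortExact := { exact := ShortComplex.exact_of_g_is_cokernel _
                                  (Limits.cokernelIsCokernel (Injective.ι V)) }
    have : Injective S.X₂ := inferInstanceAs (Injective (Injective.under V))
    obtain ⟨y, rfl⟩ := (exact_extDelta_extMap U hS n x).1 (Abelian.Ext.eq_zero_of_injective _)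
    let F : S ⟶ S := { τ₁ := ζ.app S.X₁, τ₂ := ζ.app S.X₂, τ₃ := ζ.app S.X₃
                       comm₁₂ := (ζ.naturality S.f).symm, comm₂₃ := (ζ.naturality S.g).symm }
    have h1 := ShortComplex.ShortExact.extClass_naturality hS hS F
    change (y.comp hS.extClass rfl).comp (Abelian.Ext.mk₀ F.τ₁) (add_zero (n + 1)) =
      c • (y.comp hS.extClass rfl)
    rw [Abelian.Ext.comp_assoc_of_third_deg_zero, h1,
      ← Abelian.Ext.comp_assoc_of_second_deg_zero]
    change (y.comp (Abelian.Ext.mk₀ (ζ.app S.X₃)) (add_zero n)).comp _ _ = _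
    rw [ih, Abelian.Ext.smul_comp]

/-- The same endomorphism acts on Ext as 1, seen from `U`, and as 0, seen from `V`. -/
lemma subsingleton_ext_of_natural_endomorphism (ζ : 𝟭 (Rep.{0} ℂ G) ⟶ 𝟭 (Rep.{0} ℂ G))
    (hU : ζ.app U = 𝟙 U) (n : ℕ) (V : Rep.{0} ℂ G) (hV : ζ.app V = 0) :
    Subsingleton (Abelian.Ext U V n) := by
  refine subsingleton_of_forall_eq 0 fun x => ?_
  have h := ext_comp_natural_endomorphism U ζ 1 (by rw [hU, one_smul]) n V x
  rw [one_smul, hV, Abelian.Ext.mk₀_zero, Abelian.Ext.comp_zero] at h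
  exact h.symm

lemma hom_asAlgebraHom {V W : Rep.{0} ℂ G} (f : V ⟶ W) (z : MonoidAlgebra ℂ G) (v : V) :
    f.hom (V.ρ.asAlgebraHom z v) = W.ρ.asAlgebraHom z (f.hom v) := by
  induction z using MonoidAlgebra.induction_linear with
  | zero => simp
  | add a b ha hb => rw [map_add, map_add, LinearMap.add_apply, LinearMap.add_apply, map_add, ha, hb]
  | single g r =>
    rw [Representation.asAlgebraHom_single, Representation.asAlgebraHom_single,
      LinearMap.smul_apply, LinearMap.smul_apply, map_smul, Rep.hom_comm_apply]

/-- A central element of the group algebra acts by endomorphisms on all representations. -/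
def centralEndomorphism (z : MonoidAlgebra ℂ G)
    (hz : ∀ g : G, MonoidAlgebra.of ℂ G g * z = z * MonoidAlgebra.of ℂ G g) :
    𝟭 (Rep.{0} ℂ G) ⟶ 𝟭 (Rep.{0} ℂ G) where
  app V := Rep.ofHom ⟨V.ρ.asAlgebraHom z, fun g => by
    have := congrArg V.ρ.asAlgebraHom (hz g)
    simp only [map_mul, Representation.asAlgebraHom_of] at this
    exact this.symm⟩
  naturality V W f := by
    refine Rep.hom_ext (Representation.IntertwiningMap.ext (LinearMap.ext fun v => ?_))
    exact (hom_asAlgebraHom f z v).symm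

end NaturalEndomorphism

/-! ### Euler characteristics from finite coresolutions. -/

section ExactComplex

variable {G : Type} [Group G] (U : Rep.{0} ℂ G)

lemma subsingleton_ext_of_subsingleton (V : Rep.{0} ℂ G) [Subsingleton V] (n : ℕ) :
    Subsingleton (Abelian.Ext U V n) := by
  have h : 𝟙 V = 0 := Rep.hom_ext (Representation.IntertwiningMap.ext
    (LinearMap.ext fun v => Subsingleton.elim _ _))
  refine subsingleton_of_forall_eq 0 fun x => ?_
  rw [← Abelian.Ext.comp_mk₀_id x, h, Abelian.Ext.mk₀_zero, Abelian.Ext.comp_zero]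

/-- A finite exact coresolution computes the Euler characteristic of `Ext`. -/
lemma extFinite_and_extChar_of_resolution (N : ℕ) : ∀ (V : Rep.{0} ℂ G) (Ω : ℕ → Rep.{0} ℂ G)
    (d : ∀ n, Ω n ⟶ Ω (n + 1)) (ι : V ⟶ Ω 0) (_ : Function.Injective ι.hom)
    (_ : Function.Exact ι.hom (d 0).hom)
    (_ : ∀ n, Function.Exact (d n).hom (d (n + 1)).hom)
    (_ : ∀ n, ExtFinite U (Ω n)) (_ : ∀ n, N ≤ n → Subsingleton (Ω n)),
    ExtFinite U V ∧ extChar U V = ∑ n ∈ Finset.range N, (-1) ^ n * extChar U (Ω n) := by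
  induction N with
  | zero =>
    intro V Ω d ι hι _ _ _ hΩ
    have := hΩ 0 le_rfl
    have : Subsingleton V := hι.subsingleton
    have h := subsingleton_ext_of_subsingleton U V
    exact ⟨⟨fun n => inferInstance, 0, fun n _ => h n⟩, (eulerChar_eq_sum (N := 0) fun n _ => h n).trans (by simp)⟩
  | succ N ih =>
    intro V Ω d ι hι hιd hd hfin hΩ
    have hmono : Mono ι := (Rep.mono_iff_injective ι).2 hι
    let S : ShortComplex (Rep.{0} ℂ G) := ShortComplex.mk ι
      (Limits.cokernel.π ι) (Limits.cokernel.condition _)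
    have hS : S.ShortExact := { exact := ShortComplex.exact_of_g_is_cokernel _
                                  (Limits.cokernelIsCokernel ι) }
    obtain ⟨-, hS2, hS3⟩ := shortExact_iff.1 hS
    have hιd0 : ι ≫ d 0 = 0 := Rep.hom_ext (Representation.IntertwiningMap.ext
      (LinearMap.ext fun v => hιd.apply_apply_eq_zero v))
    -- By exactness the cokernel of `ι` embeds into `Ω 1`, so the shifted complex is a shorter
    -- coresolution of it.
    let j : S.X₃ ⟶ Ω 1 := Limits.cokernel.desc ι (d 0) hιd0
    have hj (w : Ω 0) : j.hom (S.g.hom w) = (d 0).hom w := by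
      have : S.g ≫ j = d 0 := Limits.cokernel.π_desc ι (d 0) hιd0
      rw [← this]
      rfl
    obtain ⟨h1, h2⟩ := ih S.X₃ (fun n => Ω (n + 1)) (fun n => d (n + 1)) j
      (by
        rw [injective_iff_map_eq_zero]
        intro q hq
        obtain ⟨w, rfl⟩ := hS3 q
        rw [hj] at hq
        obtain ⟨v, rfl⟩ := (hιd w).1 hq
        exact hS2.apply_apply_eq_zero v)
      (fun x => by
        refine ⟨fun hx => ?_, ?_⟩
        · obtain ⟨w, rfl⟩ := (hd 0 x).1 hx
          exact ⟨S.g.hom w, hj w⟩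
        · rintro ⟨q, rfl⟩
          obtain ⟨w, rfl⟩ := hS3 q
          rw [hj]
          exact (hd 0).apply_apply_eq_zero w)
      (fun n => hd (n + 1)) (fun n => hfin (n + 1)) (fun n hn => hΩ (n + 1) (by omega))
    have h3 : ExtFinite U S.X₁ := ExtFinite.left U hS (hfin 0) h1
    refine ⟨h3, ?_⟩
    have h4 := extChar_add U hS h3 (hfin 0) h1
    rw [Finset.sum_range_succ', pow_zero, one_mul]
    rw [h2] at h4
    change extChar U S.X₁ = _ + extChar U S.X₂
    rw [h4]
    have : ∀ n, (-1 : ℤ) ^ (n + 1) * extChar U (Ω (n + 1)) =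
        -((-1) ^ n * extChar U (Ω (n + 1))) := fun n => by ring
    simp only [this, Finset.sum_neg_distrib]
    ring

end ExactComplex

/-! ### Integral powers of unipotent units. -/

section Binomial

/-- The binomial series terminates because v - 1 is nilpotent. By Pascal's rule the right side is
multiplied by v when n grows by one; since v is a unit, this recursion also runs downwards to
negative exponents. -/
lemma zpow_eq_sum_choose {B : Type*} [CommRing B] (v : Bˣ) {m : ℕ} (hm : ((v : B) - 1) ^ m = 0)
    (n : ℤ) : ((v ^ n : Bˣ) : B) =
      ∑ k ∈ Finset.range m, (Ring.choose n k : ℤ) • ((v : B) - 1) ^ k := by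
  set u : B := (v : B) - 1 with hu
  have hv : (v : B) = 1 + u := by rw [hu]; ring
  have step (n : ℤ) : ∑ k ∈ Finset.range m, (Ring.choose (n + 1) k : ℤ) • u ^ k =
      v * ∑ k ∈ Finset.range m, (Ring.choose n k : ℤ) • u ^ k := by
    cases m with
    | zero => simp
    | succ m =>
      rw [hv, add_mul, one_mul, Finset.sum_range_succ', Finset.mul_sum,
        Finset.sum_range_succ' (fun k => (Ring.choose n k : ℤ) • u ^ k),
        Finset.sum_range_succ (fun i => u * ((Ring.choose n i : ℤ) • u ^ i))]
      have h0 : u * ((Ring.choose n m : ℤ) • u ^ m) = 0 := by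
        rw [mul_smul_comm, ← pow_succ', hm, smul_zero]
      rw [h0, add_zero]
      have : ∀ k, (Ring.choose (n + 1) (k + 1) : ℤ) • u ^ (k + 1) =
          (Ring.choose n (k + 1) : ℤ) • u ^ (k + 1) + u * ((Ring.choose n k : ℤ) • u ^ k) := by
        intro k
        rw [Ring.choose_succ_succ, add_smul, mul_smul_comm, ← pow_succ', add_comm]
      simp only [this, Finset.sum_add_distrib, Ring.choose_zero_right, pow_zero]
      ring
  induction n using Int.induction_on with
  | zero =>
    cases m with
    | zero =>
      have : Subsingleton B := subsingleton_of_zero_eq_one (by simpa using hm.symm)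
      exact Subsingleton.elim _ _
    | succ m =>
      rw [Finset.sum_range_succ']
      simp [Ring.choose_zero_succ]
  | succ n ih =>
    rw [step, ← ih, zpow_add_one, Units.val_mul, mul_comm]
  | pred n ih =>
    have h := step (-(n : ℤ) - 1)
    rw [sub_add_cancel, ← ih] at h
    rw [zpow_sub_one, Units.val_mul, h, mul_comm, Units.inv_mul_cancel_left]

lemma exists_polynomial_eval_eq_choose (k : ℕ) :
    ∃ q : Polynomial ℂ, ∀ n : ℤ, q.eval (n : ℂ) = ((Ring.choose n k : ℤ) : ℂ) := by
  refine ⟨Polynomial.C ((k.factorial : ℂ)⁻¹) * descPochhammer ℂ k, fun n => ?_⟩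
  have h := Ring.descPochhammer_eq_factorial_smul_choose n k
  rw [← Polynomial.eval_eq_smeval] at h
  rw [Polynomial.eval_mul, Polynomial.eval_C, ← descPochhammer_eval_cast (R := ℂ), h]
  have : (k.factorial : ℂ) ≠ 0 := by exact_mod_cast k.factorial_ne_zero
  rw [nsmul_eq_mul]
  push_cast
  field_simp

end Binomial

/-! ### Polynomial functions on a lattice. -/

section LatticePolynomials

variable {X : Type} [AddCommGroup X] {σ : Type} (b : Module.Basis σ ℤ X)

/-- Evaluation of a polynomial at a lattice point. -/
def latticeEval (y : X) : MvPolynomial σ ℂ →ₐ[ℂ] ℂ :=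
  MvPolynomial.aeval fun i => ((b.repr y i : ℤ) : ℂ)

@[simp] lemma latticeEval_X (y : X) (i : σ) :
    latticeEval b y (MvPolynomial.X i) = ((b.repr y i : ℤ) : ℂ) := by
  simp [latticeEval]

/-- The integers are infinite, so ℤ^σ is Zariski dense in ℂ^σ. Identities of polynomials below are
checked pointwise on the lattice by means of this. -/
lemma latticeEval_ext [Fintype σ] {p q : MvPolynomial σ ℂ} (h : ∀ y, latticeEval b y p = latticeEval b y q) :
    p = q := by
  refine MvPolynomial.funext_set (fun _ => Set.range ((↑) : ℤ → ℂ))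
    (fun _ => Set.infinite_range_of_injective Int.cast_injective) fun x hx => ?_
  choose n hn using fun i => hx i (Set.mem_univ i)
  have := h (∑ i, n i • b i)
  simp only [latticeEval, MvPolynomial.aeval_def] at this
  have hx' : (fun i => ((b.repr (∑ i, n i • b i) i : ℤ) : ℂ)) = x := by
    ext i
    rw [b.repr_sum_self, hn]
  rw [hx'] at this
  exact this

/-- Functionals that are unipotent in the lattice variable are polynomials. -/
lemma exists_latticeEval_eq_prod {B : Type*} [CommRing B] [Algebra ℂ B] (v : σ → Bˣ) {m : ℕ}
    (hm : ∀ i, ((v i : B) - 1) ^ m = 0) (s : Finset σ) : ∀ Φ : B →ₗ[ℂ] ℂ,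
    ∃ r : MvPolynomial σ ℂ, ∀ y, latticeEval b y r =
      Φ (∏ i ∈ s, ((v i ^ (b.repr y i : ℤ) : Bˣ) : B)) := by
  classical
  induction s using Finset.induction_on with
  | empty => exact fun Φ => ⟨MvPolynomial.C (Φ 1), fun y => by simp [latticeEval]⟩
  | insert i s hi ih =>
    intro Φ
    -- One coordinate is split off: its power is expanded in powers of `v i - 1`, and each of these
    -- is absorbed into the functional.
    choose r hr using fun k : ℕ => ih (Φ ∘ₗ LinearMap.mulLeft ℂ (((v i : B) - 1) ^ k))
    choose q hq using exists_polynomial_eval_eq_choose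
    refine ⟨∑ k ∈ Finset.range m, Polynomial.aeval (MvPolynomial.X i) (q k) * r k, fun y => ?_⟩
    rw [Finset.prod_insert hi, zpow_eq_sum_choose (v i) (hm i), map_sum, Finset.sum_mul, map_sum]
    refine Finset.sum_congr rfl fun k _ => ?_
    rw [map_mul, hr, ← Polynomial.aeval_algHom_apply, latticeEval_X, Polynomial.aeval_def,
      Algebra.algebraMap_self, Polynomial.eval₂_id, hq]
    simp only [LinearMap.comp_apply, LinearMap.mulLeft_apply, smul_mul_assoc]
    rw [map_zsmul, zsmul_eq_mul]

end LatticePolynomials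

/-! ### Affine substitutions, translations and the augmentation ideal. -/

section AffineSubstitution

variable {X : Type} [AddCommGroup X] {σ : Type} [Fintype σ] (b : Module.Basis σ ℤ X)

/-- Substitution of the affine map `y ↦ g y + t` in polynomials on a lattice. -/
def affineSubst (g : X →ₗ[ℤ] X) (t : X) : MvPolynomial σ ℂ →ₐ[ℂ] MvPolynomial σ ℂ :=
  MvPolynomial.aeval fun i => ∑ j, MvPolynomial.C ((b.repr (g (b j)) i : ℤ) : ℂ) *
    MvPolynomial.X j + MvPolynomial.C ((b.repr t i : ℤ) : ℂ)

lemma affineSubst_X (g : X →ₗ[ℤ] X) (t : X) (i : σ) : affineSubst b g t (MvPolynomial.X i) =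
    ∑ j, MvPolynomial.C ((b.repr (g (b j)) i : ℤ) : ℂ) *
    MvPolynomial.X j + MvPolynomial.C ((b.repr t i : ℤ) : ℂ) := by
  rw [affineSubst, MvPolynomial.aeval_X]

lemma latticeEval_affineSubst (g : X →ₗ[ℤ] X) (t y : X) (p : MvPolynomial σ ℂ) :
    latticeEval b y (affineSubst b g t p) = latticeEval b (g y + t) p := by
  suffices h : (latticeEval b y).comp (affineSubst b g t) = latticeEval b (g y + t) from
    DFunLike.congr_fun h p
  ext i
  have h1 (c : ℂ) : latticeEval b y (MvPolynomial.C c) = c := by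
    rw [← MvPolynomial.algebraMap_eq, AlgHom.commutes]
    rfl
  have h2 : b.repr (g y) i = ∑ j, b.repr y j * b.repr (g (b j)) i := by
    conv_lhs => rw [← b.sum_repr y, map_sum, map_sum, Finsupp.finsetSum_apply]
    exact Finset.sum_congr rfl fun j _ => by simp
  rw [AlgHom.comp_apply, affineSubst_X, latticeEval_X, map_add, map_sum, h1, map_add,
    Finsupp.add_apply, h2]
  push_cast
  congr 1
  refine Finset.sum_congr rfl fun j _ => ?_
  rw [map_mul, h1, latticeEval_X, mul_comm]

/-- The chain rule; the Jacobian of the substitution is the matrix of `g`. -/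
lemma pderiv_affineSubst (g : X →ₗ[ℤ] X) (t : X) (j : σ) (p : MvPolynomial σ ℂ) :
    MvPolynomial.pderiv j (affineSubst b g t p) =
      ∑ i, ((b.repr (g (b j)) i : ℤ) : ℂ) • affineSubst b g t (MvPolynomial.pderiv i p) := by
  classical
  induction p using MvPolynomial.induction_on with
  | C a => simp [affineSubst]
  | add p q hp hq => simp only [map_add, hp, hq, smul_add, Finset.sum_add_distrib]
  | mul_X p k hp =>
    rw [map_mul, Derivation.leibniz, hp, affineSubst_X]
    have h1 : MvPolynomial.pderiv j (∑ j, MvPolynomial.C ((b.repr (g (b j)) k : ℤ) : ℂ) *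
        MvPolynomial.X j + MvPolynomial.C ((b.repr t k : ℤ) : ℂ)) =
        MvPolynomial.C ((b.repr (g (b j)) k : ℤ) : ℂ) := by
      rw [map_add, map_sum, MvPolynomial.pderiv_C, add_zero]
      simp [MvPolynomial.pderiv_X, Pi.single_apply]
    rw [h1, ← affineSubst_X]
    simp only [Derivation.leibniz, map_add, MvPolynomial.pderiv_X, smul_eq_mul, map_mul, smul_add,
      Finset.sum_add_distrib]
    congr 1
    · rw [Finset.sum_eq_single k (fun i _ hi => by simp [hi.symm]) (by simp)]
      simp [MvPolynomial.smul_eq_C_mul, mul_comm]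
    · rw [Finset.mul_sum]
      exact Finset.sum_congr rfl fun i _ => by rw [mul_smul_comm]

/-- The translation action of a lattice on the polynomials. -/
def translationRep : Representation ℂ (Multiplicative X) (MvPolynomial σ ℂ) where
  toFun x := (affineSubst b LinearMap.id (-x.toAdd)).toLinearMap
  map_one' := LinearMap.ext fun p => latticeEval_ext b fun y => by
    simp [latticeEval_affineSubst]
  map_mul' x z := LinearMap.ext fun p => latticeEval_ext b fun y => by
    simp [latticeEval_affineSubst]
    congr 2
    abel

lemma latticeEval_translationRep (x : Multiplicative X) (y : X) (p : MvPolynomial σ ℂ) :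
    latticeEval b y (translationRep b x p) = latticeEval b (y - x.toAdd) p := by
  change latticeEval b y (affineSubst b LinearMap.id (-x.toAdd) p) = _
  rw [latticeEval_affineSubst, LinearMap.id_apply, sub_eq_add_neg]

variable (X) in
/-- The augmentation ideal of the group algebra of a lattice. -/
def augIdeal : Ideal (MonoidAlgebra ℂ (Multiplicative X)) :=
  Ideal.span (Set.range fun x => MonoidAlgebra.of ℂ (Multiplicative X) x - 1)

lemma of_sub_one_mem_augIdeal (x : Multiplicative X) :
    MonoidAlgebra.of ℂ (Multiplicative X) x - 1 ∈ augIdeal X :=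
  Ideal.subset_span ⟨x, rfl⟩

/-- The twisted Leibniz rule (x - 1)(p Xᵢ) = ((x - 1)p) Xᵢ - xᵢ · (x p) shows that multiplication by
a coordinate costs one more factor of the augmentation ideal. -/
lemma augIdeal_pow_X_mul (i : σ) (k : ℕ) : ∀ (p : MvPolynomial σ ℂ),
    (∀ a ∈ augIdeal X ^ k, (translationRep b).asAlgebraHom a p = 0) →
    ∀ a ∈ augIdeal X ^ (k + 1),
      (translationRep b).asAlgebraHom a (p * MvPolynomial.X i) = 0 := by
  induction k with
  | zero =>
    intro p hp a _
    have h1 := hp 1 (by simp)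
    rw [map_one, Module.End.one_apply] at h1
    rw [h1, zero_mul, map_zero]
  | succ k ih =>
    intro p hp a ha
    rw [pow_succ] at ha
    refine Submodule.mul_induction_on ha (fun a ha c hc => ?_) fun a c ha hc => by
      rw [map_add, LinearMap.add_apply, ha, hc, add_zero]
    rw [map_mul (translationRep b).asAlgebraHom, Module.End.mul_apply]
    induction hc using Submodule.span_induction with
    | mem c hc =>
      obtain ⟨x, rfl⟩ := hc
      have h1 : (translationRep b).asAlgebraHom (MonoidAlgebra.of ℂ (Multiplicative X) x - 1)
          (p * MvPolynomial.X i) = ((translationRep b).asAlgebraHom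
            (MonoidAlgebra.of ℂ (Multiplicative X) x - 1) p) * MvPolynomial.X i -
            ((b.repr x.toAdd i : ℤ) : ℂ) • (translationRep b).asAlgebraHom
              (MonoidAlgebra.of ℂ (Multiplicative X) x) p := by
        rw [map_sub, map_one, Representation.asAlgebraHom_of]
        refine latticeEval_ext b fun y => ?_
        simp only [LinearMap.sub_apply, Module.End.one_apply, map_sub, map_mul,
          latticeEval_translationRep, latticeEval_X, map_smul, Finsupp.sub_apply, smul_eq_mul]
        push_cast
        ring
      rw [h1, map_sub, map_smul]
      have h2 := ih ((translationRep b).asAlgebraHom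
            (MonoidAlgebra.of ℂ (Multiplicative X) x - 1) p) (fun a' ha' => by
          rw [← Module.End.mul_apply, ← map_mul]
          exact hp _ (by rw [pow_succ]; exact Ideal.mul_mem_mul ha' (of_sub_one_mem_augIdeal x)))
          a ha
      rw [h2, ← Module.End.mul_apply, ← map_mul, hp _ (Ideal.mul_mem_right _ _ ha), smul_zero,
        sub_zero]
    | zero => simp
    | add c d _ _ hc hd => rw [map_add, LinearMap.add_apply, map_add, hc, hd, add_zero]
    | smul r c _ hc =>
      rw [← Module.End.mul_apply, ← map_mul, smul_eq_mul, mul_left_comm,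
        map_mul (translationRep b).asAlgebraHom, Module.End.mul_apply,
        map_mul (translationRep b).asAlgebraHom, Module.End.mul_apply, hc, map_zero]

/-- Polynomials are killed by a power of the augmentation ideal. -/
lemma exists_augIdeal_pow_eq_zero (p : MvPolynomial σ ℂ) : ∃ k, ∀ a ∈ augIdeal X ^ k,
    (translationRep b).asAlgebraHom a p = 0 := by
  induction p using MvPolynomial.induction_on with
  | C c =>
    refine ⟨1, fun a ha => ?_⟩
    rw [pow_one] at ha
    induction ha using Submodule.span_induction with
    | mem c hc =>
      obtain ⟨x, rfl⟩ := hc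
      rw [map_sub, map_one, Representation.asAlgebraHom_of]
      refine latticeEval_ext b fun y => ?_
      rw [LinearMap.sub_apply, map_sub, latticeEval_translationRep]
      simp [latticeEval]
    | zero => simp
    | add c d _ _ hc hd => rw [map_add, LinearMap.add_apply, hc, hd, add_zero]
    | smul r c _ hc => rw [smul_eq_mul, map_mul, Module.End.mul_apply, hc, map_zero]
  | add p q hp hq =>
    obtain ⟨k, hk⟩ := hp
    obtain ⟨l, hl⟩ := hq
    refine ⟨max k l, fun a ha => ?_⟩
    rw [map_add, hk a (Ideal.pow_le_pow_right (le_max_left k l) ha),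
      hl a (Ideal.pow_le_pow_right (le_max_right k l) ha), add_zero]
  | mul_X p i hp =>
    obtain ⟨k, hk⟩ := hp
    exact ⟨k + 1, augIdeal_pow_X_mul b i k p hk⟩

end AffineSubstitution

/-! ### Injectivity of the polynomials over the group algebra of the lattice. -/

section Baer

variable {X : Type} [AddCommGroup X] {σ : Type} [Fintype σ] (b : Module.Basis σ ℤ X)

include b in
-- The ring is a finitely generated commutative algebra. Noetherianity makes ideals finitely
-- generated and permits the use of Artin-Rees.
lemma isNoetherianRing_monoidAlgebra :
    IsNoetherianRing (MonoidAlgebra ℂ (Multiplicative X)) := by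
  have : Module.Finite ℤ X := Module.Finite.of_basis b
  have : AddGroup.FG X := Module.Finite.iff_addGroup_fg.1 this
  have : Monoid.FG (Multiplicative X) := inferInstance
  have : Algebra.FiniteType ℂ (MonoidAlgebra ℂ (Multiplicative X)) := inferInstance
  exact Algebra.FiniteType.isNoetherianRing ℂ _

/-- A functional killing a power of the augmentation ideal is given by a polynomial. -/
lemma exists_latticeEval_eq_functional (m : ℕ)
    (Φ : (MonoidAlgebra ℂ (Multiplicative X) ⧸ augIdeal X ^ m) →ₗ[ℂ] ℂ) :
    ∃ r : MvPolynomial σ ℂ, ∀ a, latticeEval b 0 ((translationRep b).asAlgebraHom a r) =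
      Φ (Ideal.Quotient.mk _ a) := by
  let θ : Multiplicative X →* (MonoidAlgebra ℂ (Multiplicative X) ⧸ augIdeal X ^ m)ˣ :=
    (Units.map ((Ideal.Quotient.mk (augIdeal X ^ m) : _ →+* _) : _ →* _)).comp
      ((Units.map (MonoidAlgebra.of ℂ (Multiplicative X))).comp
        (toUnits : Multiplicative X ≃* _).toMonoidHom)
  have hθ (x : Multiplicative X) : (θ x : MonoidAlgebra ℂ (Multiplicative X) ⧸ augIdeal X ^ m) =
    Ideal.Quotient.mk _ (MonoidAlgebra.of ℂ (Multiplicative X) x) := rfl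
  -- Modulo the m-th power of the augmentation ideal, group elements become unipotent units. The
  -- sign in `-b i` appears because translating by x and evaluating at 0 gives the value at -x.
  obtain ⟨r, hr⟩ := exists_latticeEval_eq_prod b (fun i => θ (Multiplicative.ofAdd (-b i)))
    (m := m) (fun i => by
      rw [hθ, ← map_one (Ideal.Quotient.mk _), ← map_sub, ← map_pow, Ideal.Quotient.eq_zero_iff_mem]
      exact Ideal.pow_mem_pow (of_sub_one_mem_augIdeal _) m) Finset.univ Φ
  refine ⟨r, fun a => ?_⟩
  induction a using MonoidAlgebra.induction_linear with
  | zero => simp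
  | add a c ha hc => simp only [map_add, LinearMap.add_apply, ha, hc]
  | single x c =>
    have h1 : MonoidAlgebra.single x c = c • MonoidAlgebra.of ℂ (Multiplicative X) x := by
      simp [MonoidAlgebra.of_apply]
    have h2 : (Ideal.Quotient.mk (augIdeal X ^ m)) (c • MonoidAlgebra.of ℂ (Multiplicative X) x) =
        c • Ideal.Quotient.mk (augIdeal X ^ m) (MonoidAlgebra.of ℂ (Multiplicative X) x) := rfl
    rw [h1, map_smul, LinearMap.smul_apply, map_smul, Representation.asAlgebraHom_of,
      latticeEval_translationRep, hr, h2, map_smul, ← hθ]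
    congr 2
    rw [← Units.coe_prod]
    simp only [← map_zpow]
    rw [← map_prod]
    congr 2
    rw [← ofAdd_toAdd x]
    simp only [← ofAdd_zsmul, ← ofAdd_sum]
    congr 1
    simp only [zero_sub, toAdd_ofAdd, map_neg, Finsupp.neg_apply, smul_neg, neg_smul, neg_neg]
    exact b.sum_repr _

lemma map_eq_zero_of_mem_smul {A M : Type*} [CommRing A] [AddCommGroup M] [Module A M]
    {J 𝔞 : Ideal A} (g : 𝔞 →ₗ[A] M) (h : ∀ c, ∀ a ∈ J, a • g c = 0) (c : 𝔞)
    (hc : (c : A) ∈ J • 𝔞) : g c = 0 := by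
  have h1 : J • (⊤ : Submodule A 𝔞) ≤ LinearMap.ker g := Submodule.smul_le.2 fun a ha d _ => by
    rw [LinearMap.mem_ker, map_smul, h d a ha]
  have h2 : J • 𝔞 = (J • (⊤ : Submodule A 𝔞)).map 𝔞.subtype := by
    rw [Submodule.map_smul'', Submodule.map_top, Submodule.range_subtype]
  rw [h2] at hc
  obtain ⟨d, hd, hdc⟩ := hc
  rw [← Subtype.ext (a1 := d) (a2 := c) hdc]
  exact h1 hd

/-- The polynomials on a lattice form an injective module under translation. -/
theorem baer_translationRep :
    Module.Baer (MonoidAlgebra ℂ (Multiplicative X)) (translationRep b).asModule := by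
  have := isNoetherianRing_monoidAlgebra b
  intro 𝔞 g
  have hsmul (a : MonoidAlgebra ℂ (Multiplicative X)) (p : (translationRep b).asModule) :
    (translationRep b).asModuleEquiv (a • p) = (translationRep b).asAlgebraHom a
      ((translationRep b).asModuleEquiv p) := Representation.asModuleEquiv_map_smul _ a p
  -- Each polynomial is killed by some power of the augmentation ideal; as `𝔞` is finitely
  -- generated, one power kills the whole image of `g`.
  obtain ⟨k, hk⟩ : ∃ k, ∀ c : 𝔞, ∀ a ∈ augIdeal X ^ k, a • g c = 0 := by
    obtain ⟨S, hS⟩ : (⊤ : Submodule (MonoidAlgebra ℂ (Multiplicative X)) 𝔞).FG :=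
      Module.Finite.fg_top
    choose k hk using exists_augIdeal_pow_eq_zero (X := X) b
    refine ⟨S.sup fun c => k ((translationRep b).asModuleEquiv (g c)), fun c => ?_⟩
    have hc : c ∈ Submodule.span (MonoidAlgebra ℂ (Multiplicative X)) (S : Set 𝔞) := by
      rw [hS]; trivial
    induction hc using Submodule.span_induction with
    | mem c hc =>
      intro a ha
      apply (translationRep b).asModuleEquiv.injective
      rw [hsmul, map_zero]
      exact hk _ a (Ideal.pow_le_pow_right
        (Finset.le_sup (f := fun c => k ((translationRep b).asModuleEquiv (g c))) hc) ha)
    | zero => intro a _; rw [map_zero, smul_zero]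
    | add c d _ _ hc hd => intro a ha; rw [map_add, smul_add, hc a ha, hd a ha, add_zero]
    | smul r c _ hc => intro a ha; rw [map_smul, smul_comm, hc a ha, smul_zero]
  -- Artin-Rees: with I the augmentation ideal and m = k + l, the intersection of I^m with `𝔞` lies
  -- in I^k `𝔞`, on which `g` vanishes. So evaluation of `g` at 0 factors through the image of `𝔞`
  -- modulo I^m and extends to a functional on the quotient.
  obtain ⟨l, hl⟩ := Ideal.exists_pow_inf_eq_pow_smul (augIdeal X) 𝔞
  set m := k + l with hm
  let φ : 𝔞 →ₗ[ℂ] ℂ :=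
    { toFun := fun c => latticeEval b 0 ((translationRep b).asModuleEquiv (g c))
      map_add' := fun c d => by simp
      map_smul' := fun r c => by
        have h1 : r • c = (algebraMap ℂ (MonoidAlgebra ℂ (Multiplicative X)) r) • c :=
          (algebraMap_smul _ r c).symm
        rw [h1, map_smul, hsmul, AlgHom.commutes]
        simp [Algebra.algebraMap_eq_smul_one] }
  let π : 𝔞 →ₗ[ℂ] (MonoidAlgebra ℂ (Multiplicative X) ⧸ augIdeal X ^ m) :=
    (Ideal.Quotient.mkₐ ℂ (augIdeal X ^ m)).toLinearMap ∘ₗ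
      (𝔞.subtype.restrictScalars ℂ)
  obtain ⟨Φ, hΦ⟩ : ∃ Φ : (MonoidAlgebra ℂ (Multiplicative X) ⧸ augIdeal X ^ m) →ₗ[ℂ] ℂ,
      Φ ∘ₗ π = φ := by
    have h1 : φ ∈ LinearMap.range π.dualMap := by
      rw [LinearMap.range_dualMap_eq_dualAnnihilator_ker, Submodule.mem_dualAnnihilator]
      intro c hc
      have hc1 : (c : MonoidAlgebra ℂ (Multiplicative X)) ∈ augIdeal X ^ m :=
        Ideal.Quotient.eq_zero_iff_mem.1 hc
      have hc2 : (c : MonoidAlgebra ℂ (Multiplicative X)) ∈ augIdeal X ^ k • 𝔞 := by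
        have h2 := hl m (by omega)
        have h3 : (c : MonoidAlgebra ℂ (Multiplicative X)) ∈ augIdeal X ^ m • ⊤ ⊓ 𝔞 :=
          ⟨by rw [smul_eq_mul, Ideal.mul_top]; exact hc1, c.2⟩
        rw [h2, hm, Nat.add_sub_cancel] at h3
        exact Submodule.smul_mono le_rfl inf_le_right h3
      change latticeEval b 0 ((translationRep b).asModuleEquiv (g c)) = 0
      rw [map_eq_zero_of_mem_smul g hk c hc2, map_zero, map_zero]
    obtain ⟨Φ, hΦ⟩ := h1
    exact ⟨Φ, hΦ⟩
  obtain ⟨r, hr⟩ := exists_latticeEval_eq_functional b m Φ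
  refine ⟨LinearMap.toSpanSingleton _ _ ((translationRep b).asModuleEquiv.symm r), fun c hc => ?_⟩
  apply (translationRep b).asModuleEquiv.injective
  refine latticeEval_ext b fun y => ?_
  -- The value at any lattice point is the value at 0 of a translate, and `𝔞` is stable under
  -- translation. Agreement at 0 therefore suffices.
  have hy (p : MvPolynomial σ ℂ) : latticeEval b y p = latticeEval b 0
      ((translationRep b).asAlgebraHom
        (MonoidAlgebra.of ℂ (Multiplicative X) (Multiplicative.ofAdd (-y))) p) := by
    rw [Representation.asAlgebraHom_of, latticeEval_translationRep]
    simp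
  rw [LinearMap.toSpanSingleton_apply, hsmul, LinearEquiv.apply_symm_apply, hy, hy,
    ← Module.End.mul_apply, ← map_mul, hr, ← hsmul, ← map_smul]
  exact LinearMap.congr_fun hΦ
    (MonoidAlgebra.of ℂ (Multiplicative X) (Multiplicative.ofAdd (-y)) • (⟨c, hc⟩ : 𝔞))

end Baer

section

open scoped MonoidalCategory

/-! ### Extension of lattice-equivariant maps. -/

section TranslationExtension

variable {X : Type} [AddCommGroup X] {σ : Type} [Fintype σ] (b : Module.Basis σ ℤ X)

/-- An equivariant map, as a map of modules over the group algebra. -/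
def asModuleMap {H : Type} [Monoid H] {V W : Type} [AddCommGroup V] [Module ℂ V] [AddCommGroup W]
    [Module ℂ W] (τ : Representation ℂ H V) (υ : Representation ℂ H W) (f : V →ₗ[ℂ] W)
    (hf : ∀ h v, f (τ h v) = υ h (f v)) : τ.asModule →ₗ[MonoidAlgebra ℂ H] υ.asModule where
  toFun v := υ.asModuleEquiv.symm (f (τ.asModuleEquiv v))
  map_add' v w := by simp
  map_smul' a v := by
    apply υ.asModuleEquiv.injective
    rw [RingHom.id_apply, Representation.asModuleEquiv_map_smul,
      LinearEquiv.apply_symm_apply, Representation.asModuleEquiv_map_smul,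
      LinearEquiv.apply_symm_apply]
    induction a using MonoidAlgebra.induction_linear with
    | zero => simp
    | add a c ha hc => simp only [map_add, LinearMap.add_apply, ha, hc]
    | single g r => simp only [Representation.asAlgebraHom_single, LinearMap.smul_apply, map_smul, hf]

lemma exists_extension_translationRep {V W : Type} [AddCommGroup V] [Module ℂ V] [AddCommGroup W]
    [Module ℂ W] (τ : Representation ℂ (Multiplicative X) V)
    (υ : Representation ℂ (Multiplicative X) W) (f : V →ₗ[ℂ] W) (hf : ∀ h v, f (τ h v) = υ h (f v))
    (hinj : Function.Injective f) (g : V →ₗ[ℂ] MvPolynomial σ ℂ)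
    (hg : ∀ h v, g (τ h v) = translationRep b h (g v)) :
    ∃ k : W →ₗ[ℂ] MvPolynomial σ ℂ, (∀ h w, k (υ h w) = translationRep b h (k w)) ∧
      ∀ v, k (f v) = g v := by
  obtain ⟨K, hK⟩ := (baer_translationRep b).injective.out (asModuleMap τ υ f hf) (fun _ _ h => by
    apply τ.asModuleEquiv.injective
    exact hinj (υ.asModuleEquiv.symm.injective h)) (asModuleMap τ (translationRep b) g hg)
  refine ⟨{ toFun := fun w => (translationRep b).asModuleEquiv (K (υ.asModuleEquiv.symm w))
            map_add' := fun v w => by simp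
            map_smul' := fun r w => ?_ }, fun h w => ?_, fun v => ?_⟩
  · have h1 : υ.asModuleEquiv.symm (r • w) =
        (algebraMap ℂ (MonoidAlgebra ℂ (Multiplicative X)) r) • υ.asModuleEquiv.symm w := by
      apply υ.asModuleEquiv.injective
      rw [Representation.asModuleEquiv_map_smul, AlgHom.commutes]
      simp [Algebra.algebraMap_eq_smul_one]
    rw [h1, map_smul, Representation.asModuleEquiv_map_smul, AlgHom.commutes]
    simp [Algebra.algebraMap_eq_smul_one]
  · have h1 : υ.asModuleEquiv.symm (υ h w) =
        MonoidAlgebra.of ℂ (Multiplicative X) h • υ.asModuleEquiv.symm w := by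
      apply υ.asModuleEquiv.injective
      rw [Representation.asModuleEquiv_map_smul, Representation.asAlgebraHom_of,
        LinearEquiv.apply_symm_apply]
      exact (LinearEquiv.apply_symm_apply υ.asModuleEquiv (υ h w))
    change (translationRep b).asModuleEquiv (K (υ.asModuleEquiv.symm (υ h w))) = translationRep b h
      ((translationRep b).asModuleEquiv (K (υ.asModuleEquiv.symm w)))
    rw [h1, map_smul, Representation.asModuleEquiv_map_smul, Representation.asAlgebraHom_of]
  · change (translationRep b).asModuleEquiv (K (υ.asModuleEquiv.symm (f v))) = g v
    exact congrArg (translationRep b).asModuleEquiv (hK (τ.asModuleEquiv.symm v))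

/-- The coordinates of a tensor with respect to a basis of the right factor. -/
def tensorCoord {N : Type} [AddCommGroup N] [Module ℂ N] {κ : Type} (n : Module.Basis κ ℂ N)
    (R : Type) [AddCommGroup R] [Module ℂ R] (j : κ) : TensorProduct ℂ R N →ₗ[ℂ] R :=
  (TensorProduct.rid ℂ R).toLinearMap ∘ₗ (n.coord j).lTensor R

lemma tensorCoord_tmul {N : Type} [AddCommGroup N] [Module ℂ N] {κ : Type} (n : Module.Basis κ ℂ N)
    (R : Type) [AddCommGroup R] [Module ℂ R] (j : κ) (r : R) (v : N) :
    tensorCoord n R j (r ⊗ₜ v) = n.repr v j • r := by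
  simp [tensorCoord]

lemma sum_tensorCoord {N : Type} [AddCommGroup N] [Module ℂ N] {κ : Type} [Fintype κ]
    (n : Module.Basis κ ℂ N) (R : Type) [AddCommGroup R] [Module ℂ R] (t : TensorProduct ℂ R N) :
    ∑ j, tensorCoord n R j t ⊗ₜ[ℂ] n j = t := by
  induction t using TensorProduct.induction_on with
  | zero => simp
  | tmul r v =>
    simp only [tensorCoord_tmul, TensorProduct.smul_tmul]
    rw [← TensorProduct.tmul_sum, n.sum_repr]
  | add s t hs ht => simp only [map_add, TensorProduct.add_tmul, Finset.sum_add_distrib, hs, ht]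

/-- Translation by y carries the value at 0 to the value at y. -/
lemma eq_C_of_translationRep {p : MvPolynomial σ ℂ} (hp : ∀ x, translationRep b x p = p) :
    p = MvPolynomial.C (latticeEval b 0 p) :=
  latticeEval_ext b fun y => by
    have h := latticeEval_translationRep b (Multiplicative.ofAdd y) y p
    rw [hp, toAdd_ofAdd, sub_self] at h
    rw [h]
    exact ((latticeEval b y).commutes _).symm

end TranslationExtension

lemma one_tmul_injective {σ : Type} (N : Type) [AddCommGroup N] [Module ℂ N] [FiniteDimensional ℂ N] :
    Function.Injective fun v : N => (1 : MvPolynomial σ ℂ) ⊗ₜ[ℂ] v := fun v w h => by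
  refine (Module.finBasis ℂ N).ext_elem fun j => ?_
  have := congrArg (tensorCoord (Module.finBasis ℂ N) (MvPolynomial σ ℂ) j) h
  simp only [tensorCoord_tmul] at this
  exact smul_left_injective ℂ (one_ne_zero (α := MvPolynomial σ ℂ)) this


/-! ### Injective modules of vector-valued polynomials for Γ ⋉ X. -/

section PolynomialModules

variable {Γ : Type} [Group Γ] {E : Type} [AddCommGroup E] [Module ℝ E]
  {ρ : Representation ℝ Γ E} {X : Submodule ℤ E} {hX : ∀ γ, ∀ x ∈ X, ρ γ x ∈ X}

variable (ρ X hX) in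
/-- The action of `Γ` on the lattice by linear maps. -/
def latticeLin (γ : Γ) : X →ₗ[ℤ] X where
  toFun x := ⟨ρ γ x, hX γ x x.2⟩
  map_add' _ _ := Subtype.ext (map_add (ρ γ) _ _)
  map_smul' n _ := Subtype.ext (map_zsmul (ρ γ) n _)

/-- The affine action of `Γ ⋉ X` on the lattice. -/
def latticeAct (w : LatticeGroup ρ X hX) (y : X) : X :=
  latticeLin ρ X hX w.right y + w.left.toAdd

lemma latticeAct_mul (w z : LatticeGroup ρ X hX) (y : X) :
    latticeAct (w * z) y = latticeAct w (latticeAct z y) := by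
  apply Subtype.ext
  change ρ (w.right * z.right) y + (((w.left * latticeAction ρ X hX w.right z.left).toAdd : X) : E)
    = ρ w.right (ρ z.right y + ((z.left.toAdd : X) : E)) + ((w.left.toAdd : X) : E)
  rw [map_add, map_mul, Module.End.mul_apply, toAdd_mul, Submodule.coe_add, add_assoc]
  congr 1
  rw [add_comm]
  rfl

lemma latticeAct_one (y : X) : latticeAct (1 : LatticeGroup ρ X hX) y = y := by
  apply Subtype.ext
  change ρ 1 y + 0 = (y : E)
  simp

lemma latticeAct_inl (x : Multiplicative X) (y : X) :
    latticeAct (SemidirectProduct.inl x : LatticeGroup ρ X hX) y = y + x.toAdd := by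
  apply Subtype.ext
  change ρ 1 y + (x.toAdd : E) = (y : E) + (x.toAdd : E)
  simp

variable {σ : Type} [Fintype σ] (b : Module.Basis σ ℤ X)

/-- The action of `Γ ⋉ X` on the polynomials on the lattice. -/
def polyRep : Representation ℂ (LatticeGroup ρ X hX) (MvPolynomial σ ℂ) where
  toFun w := (affineSubst b (latticeLin ρ X hX w⁻¹.right) w⁻¹.left.toAdd).toLinearMap
  map_one' := LinearMap.ext fun p => latticeEval_ext b fun y => by
    rw [AlgHom.toLinearMap_apply, latticeEval_affineSubst]
    exact congrArg (latticeEval b · p) ((congrArg (latticeAct · y) inv_one).trans (latticeAct_one y))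
  map_mul' w z := LinearMap.ext fun p => latticeEval_ext b fun y => by
    rw [Module.End.mul_apply, AlgHom.toLinearMap_apply, AlgHom.toLinearMap_apply,
      AlgHom.toLinearMap_apply, latticeEval_affineSubst, latticeEval_affineSubst,
      latticeEval_affineSubst]
    exact congrArg (latticeEval b · p)
      ((congrArg (latticeAct · y) (mul_inv_rev w z)).trans (latticeAct_mul _ _ y))

lemma latticeEval_polyRep (w : LatticeGroup ρ X hX) (y : X) (p : MvPolynomial σ ℂ) :
    latticeEval b y (polyRep b w p) = latticeEval b (latticeAct w⁻¹ y) p :=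
  latticeEval_affineSubst b _ _ y p

lemma polyRep_inl (x : Multiplicative X) (p : MvPolynomial σ ℂ) :
    polyRep b (SemidirectProduct.inl x : LatticeGroup ρ X hX) p = translationRep b x p :=
  latticeEval_ext b fun y => by
    rw [latticeEval_polyRep, latticeEval_translationRep, ← map_inv, latticeAct_inl, toAdd_inv,
      sub_eq_add_neg]

/-- The polynomial functions on the lattice with values in `N`. -/
def polyModule (N : Rep.{0} ℂ (LatticeGroup ρ X hX)) : Rep.{0} ℂ (LatticeGroup ρ X hX) :=
  Rep.of ((polyRep b).tprod N.ρ)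

/-- The lattice acts trivially on `N`. -/
def IsLatticeTrivial (N : Rep.{0} ℂ (LatticeGroup ρ X hX)) : Prop :=
  ∀ (x : Multiplicative X) (v : N), N.ρ (SemidirectProduct.inl x) v = v

/-- Because the lattice does not move `N`, the polynomial module is, for the lattice alone, a finite
sum of copies of the scalar polynomials when `N` is finite-dimensional. -/
lemma tensorCoord_polyModule {N : Rep.{0} ℂ (LatticeGroup ρ X hX)} (hN : IsLatticeTrivial N)
    {κ : Type} (n : Module.Basis κ ℂ N) (j : κ) (x : Multiplicative X) (t : polyModule b N) :
    tensorCoord n _ j ((polyModule b N).ρ (SemidirectProduct.inl x) t) =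
      translationRep b x (tensorCoord n _ j t) := by
  induction t using TensorProduct.induction_on with
  | zero =>
    exact (congrArg (tensorCoord n _ j) (map_zero
      ((polyModule b N).ρ (SemidirectProduct.inl x)))).trans ((map_zero _).trans (map_zero (translationRep b x)).symm)
  | tmul r v =>
    change tensorCoord n _ j (polyRep b (SemidirectProduct.inl x) r ⊗ₜ
      N.ρ (SemidirectProduct.inl x) v) = _
    rw [tensorCoord_tmul, tensorCoord_tmul, hN, polyRep_inl, map_smul]
  | add s t hs ht =>
    have h1 := map_add ((polyModule b N).ρ (SemidirectProduct.inl x)) s t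
    exact ((congrArg _ h1).trans (map_add _ _ _)).trans
      ((congrArg₂ (· + ·) hs ht).trans ((map_add _ _ _).symm.trans
        (congrArg _ (map_add (tensorCoord n _ j) s t).symm)))

lemma tmul_polyModule (N : Rep.{0} ℂ (LatticeGroup ρ X hX)) (w : LatticeGroup ρ X hX)
    (r : MvPolynomial σ ℂ) (v : N) :
    (polyModule b N).ρ w (r ⊗ₜ[ℂ] v) = polyRep b w r ⊗ₜ[ℂ] N.ρ w v := rfl

/-- An extension of an equivariant map to a lattice-equivariant one. -/
lemma exists_extension_polyModule {N : Rep.{0} ℂ (LatticeGroup ρ X hX)} (hN : IsLatticeTrivial N)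
    [FiniteDimensional ℂ N] {V W : Rep.{0} ℂ (LatticeGroup ρ X hX)} (f : V ⟶ W)
    (hf : Function.Injective f.hom) (g : V ⟶ polyModule b N) :
    ∃ k : W →ₗ[ℂ] polyModule b N, (∀ (x : Multiplicative X) w,
      k (W.ρ (SemidirectProduct.inl x) w) =
        (polyModule b N).ρ (SemidirectProduct.inl x) (k w)) ∧ ∀ v, k (f.hom v) = g.hom v := by
  let n := Module.finBasis ℂ N
  have h (j) := exists_extension_translationRep b (V.ρ.comp SemidirectProduct.inl)
    (W.ρ.comp SemidirectProduct.inl) f.hom.toLinearMap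
    (fun x v => Rep.hom_comm_apply f (SemidirectProduct.inl x) v) hf
    (tensorCoord n (MvPolynomial σ ℂ) j ∘ₗ g.hom.toLinearMap) (fun x v => by
      have h1 := Rep.hom_comm_apply g (SemidirectProduct.inl x) v
      exact (congrArg (tensorCoord n (MvPolynomial σ ℂ) j) h1).trans
        (tensorCoord_polyModule b hN n j x (g.hom v)))
  choose k hk1 hk2 using h
  let K : W →ₗ[ℂ] TensorProduct ℂ (MvPolynomial σ ℂ) N :=
    ∑ j, (TensorProduct.mk ℂ (MvPolynomial σ ℂ) N).flip (n j) ∘ₗ k j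
  have hK (w) : K w = ∑ j, k j w ⊗ₜ[ℂ] n j := by simp [K]
  refine ⟨K, fun x w => ?_, fun v => ?_⟩
  · refine (hK _).trans (Eq.trans ?_
      (congrArg ((polyModule b N).ρ (SemidirectProduct.inl x)) (hK w)).symm)
    refine Eq.trans ?_ (map_sum ((polyModule b N).ρ (SemidirectProduct.inl x)) _ _).symm
    refine Finset.sum_congr rfl fun j _ => ?_
    refine Eq.trans ?_ (tmul_polyModule b N _ _ _).symm
    rw [hN, polyRep_inl, ← hk1]
    rfl
  · refine (hK _).trans
      (Eq.trans (Finset.sum_congr rfl fun j _ => ?_) (sum_tensorCoord n _ (g.hom v)))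
    exact congrArg (· ⊗ₜ[ℂ] n j) (hk2 j v)

/-- Averaging over `Γ` makes a lattice-equivariant extension equivariant. -/
lemma exists_extension_of_lattice [Finite Γ] {J V W : Rep.{0} ℂ (LatticeGroup ρ X hX)} (f : V ⟶ W)
    (g : V ⟶ J) (k : W →ₗ[ℂ] J) (hk1 : ∀ (x : Multiplicative X) w,
      k (W.ρ (SemidirectProduct.inl x) w) = J.ρ (SemidirectProduct.inl x) (k w))
    (hk2 : ∀ v, k (f.hom v) = g.hom v) : ∃ K : W ⟶ J, f ≫ K = g := by
  have := Fintype.ofFinite Γ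
  have hcard : (Fintype.card Γ : ℂ) ≠ 0 := by exact_mod_cast Fintype.card_ne_zero
  let K : W →ₗ[ℂ] J := (Fintype.card Γ : ℂ)⁻¹ • ∑ γ : Γ,
    J.ρ (SemidirectProduct.inr γ) ∘ₗ k ∘ₗ W.ρ (SemidirectProduct.inr γ⁻¹)
  have hK (w) : K w = (Fintype.card Γ : ℂ)⁻¹ • ∑ γ : Γ,
      J.ρ (SemidirectProduct.inr γ) (k (W.ρ (SemidirectProduct.inr γ⁻¹) w)) := by
    simp [K]
  have hmul (V : Rep.{0} ℂ (LatticeGroup ρ X hX)) (g h : LatticeGroup ρ X hX) (v : V) :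
    V.ρ g (V.ρ h v) = V.ρ (g * h) v := by rw [map_mul, Module.End.mul_apply]
  have hinr (δ : Γ) (w) : K (W.ρ (SemidirectProduct.inr δ) w) =
      J.ρ (SemidirectProduct.inr δ) (K w) := by
    rw [hK, hK, map_smul, map_sum]
    congr 1
    refine Fintype.sum_equiv (Equiv.mulLeft δ⁻¹) _ _ fun γ => ?_
    rw [hmul, hmul, ← map_mul, ← map_mul, Equiv.coe_mulLeft]
    simp
  have hinl (x : Multiplicative X) (w) : K (W.ρ (SemidirectProduct.inl x) w) =
      J.ρ (SemidirectProduct.inl x) (K w) := by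
    rw [hK, hK, map_smul, map_sum]
    congr 1
    refine Finset.sum_congr rfl fun γ _ => ?_
    -- Each conjugate of `k` by Γ is again lattice-equivariant, since Γ normalizes the lattice: `e1`
    -- and `e2` move x past γ⁻¹ and back past γ.
    have e1 : (SemidirectProduct.inr γ⁻¹ * SemidirectProduct.inl x : LatticeGroup ρ X hX) =
        SemidirectProduct.inl (latticeAction ρ X hX γ⁻¹ x) * SemidirectProduct.inr γ⁻¹ := by
      rw [SemidirectProduct.inl_aut]; simp
    have e2 : (SemidirectProduct.inr γ * SemidirectProduct.inl (latticeAction ρ X hX γ⁻¹ x) :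
        LatticeGroup ρ X hX) = SemidirectProduct.inl x * SemidirectProduct.inr γ := by
      rw [SemidirectProduct.inl_aut]; simp [← mul_assoc]
    rw [hmul, e1, ← hmul, hk1, hmul, e2, hmul]
  refine ⟨Rep.ofHom ⟨K, fun w => LinearMap.ext fun v => ?_⟩, ?_⟩
  · change K (W.ρ w v) = J.ρ w (K v)
    rw [← SemidirectProduct.inl_left_mul_inr_right w, ← hmul, hinl, hinr, hmul]
  · refine Rep.hom_ext (Representation.IntertwiningMap.ext (LinearMap.ext fun v => ?_))
    change K (f.hom v) = g.hom v
    rw [hK]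
    have : ∀ γ : Γ, J.ρ (SemidirectProduct.inr γ) (k (W.ρ (SemidirectProduct.inr γ⁻¹) (f.hom v)))
        = g.hom v := fun γ => by
      rw [← Rep.hom_comm_apply, hk2, Rep.hom_comm_apply, hmul, ← map_mul]
      simp
    simp only [this, Finset.sum_const, Finset.card_univ]
    rw [← Nat.cast_smul_eq_nsmul ℂ, smul_smul, inv_mul_cancel₀ hcard, one_smul]

/-- A lattice-equivariant extension exists coordinatewise, by Baer's criterion, and averaging over
the finite group Γ makes it fully equivariant. -/
theorem injective_polyModule [Finite Γ] {N : Rep.{0} ℂ (LatticeGroup ρ X hX)}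
    (hN : IsLatticeTrivial N) [FiniteDimensional ℂ N] : Injective (polyModule b N) where
  factors {V W} g f hf := by
    obtain ⟨k, hk1, hk2⟩ := exists_extension_polyModule b hN f ((Rep.mono_iff_injective f).1 hf) g
    exact exists_extension_of_lattice f g k hk1 hk2

lemma polyRep_one (w : LatticeGroup ρ X hX) : polyRep b w (1 : MvPolynomial σ ℂ) = 1 :=
  map_one (affineSubst b (latticeLin ρ X hX w⁻¹.right) w⁻¹.left.toAdd)

lemma exists_eq_one_tmul {N : Rep.{0} ℂ (LatticeGroup ρ X hX)} (hN : IsLatticeTrivial N)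
    [FiniteDimensional ℂ N] (t : polyModule b N)
    (ht : ∀ x, (polyModule b N).ρ (SemidirectProduct.inl x) t = t) :
    ∃ v : N, t = (1 : MvPolynomial σ ℂ) ⊗ₜ[ℂ] v := by
  let n := Module.finBasis ℂ N
  have h (j) := eq_C_of_translationRep b (p := tensorCoord n _ j t) fun x =>
    (tensorCoord_polyModule b hN n j x t).symm.trans (congrArg (tensorCoord n _ j) (ht x))
  refine ⟨∑ j, latticeEval b 0 (tensorCoord n _ j t) • n j, (sum_tensorCoord n _ t).symm.trans ?_⟩
  rw [TensorProduct.tmul_sum]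
  refine Finset.sum_congr rfl fun j _ => ?_
  rw [h j, ← TensorProduct.smul_tmul, Algebra.smul_def, mul_one]
  congr 2
  simp

/-- Invariance under the lattice alone already forces constant polynomials, so v ↦ 1 ⊗ v identifies
the invariants. -/
lemma nonempty_invariants_polyModule {N : Rep.{0} ℂ (LatticeGroup ρ X hX)}
    (hN : IsLatticeTrivial N) [FiniteDimensional ℂ N] :
    Nonempty (N.ρ.invariants ≃ₗ[ℂ] (polyModule b N).ρ.invariants) := by
  have hmem (v : N) (hv : v ∈ N.ρ.invariants) :
      (1 : MvPolynomial σ ℂ) ⊗ₜ[ℂ] v ∈ (polyModule b N).ρ.invariants := fun w =>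
    (tmul_polyModule b N w 1 v).trans (by rw [polyRep_one, hv w])
  let F : N →ₗ[ℂ] polyModule b N := TensorProduct.mk ℂ (MvPolynomial σ ℂ) N 1
  refine ⟨LinearEquiv.ofBijective (F.restrict hmem) ⟨fun v w h => ?_, fun t => ?_⟩⟩
  · exact Subtype.ext (one_tmul_injective N (congrArg Subtype.val h))
  · obtain ⟨v, hv⟩ := exists_eq_one_tmul b hN t.1 fun x => t.2 _
    refine ⟨⟨v, fun w => one_tmul_injective (σ := σ) N ?_⟩, Subtype.ext hv.symm⟩
    have h := t.2 w
    rw [hv] at h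
    refine Eq.trans ?_ h
    refine Eq.trans ?_ (tmul_polyModule b N w 1 v).symm
    rw [polyRep_one]

end PolynomialModules

/-- The morphisms from the trivial representation are the invariant vectors. -/
def homUnitEquivInvariants {G : Type} [Group G] (V : Rep.{0} ℂ G) :
    (𝟙_ (Rep.{0} ℂ G) ⟶ V) ≃ₗ[ℂ] V.ρ.invariants where
  toFun f := ⟨f.hom (1 : ℂ), fun g => (Rep.hom_comm_apply f g (1 : ℂ)).symm⟩
  map_add' _ _ := rfl
  map_smul' _ _ := rfl
  invFun v := Rep.ofHom ⟨LinearMap.toSpanSingleton ℂ V v.1, fun g => LinearMap.ext fun (r : ℂ) => by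
    change r • v.1 = V.ρ g (r • v.1)
    rw [map_smul, v.2 g]⟩
  left_inv f := Rep.hom_ext (Representation.IntertwiningMap.ext (LinearMap.ext fun (r : ℂ) => by
    change r • f.hom (1 : ℂ) = f.hom r
    rw [← map_smul]
    exact congrArg f.hom (mul_one r)))
  right_inv v := Subtype.ext (one_smul ℂ v.1)

section PolynomialModules

variable {Γ : Type} [Group Γ] [Finite Γ] {E : Type} [AddCommGroup E] [Module ℝ E]
  {ρ : Representation ℝ Γ E} {X : Submodule ℤ E} {hX : ∀ γ, ∀ x ∈ X, ρ γ x ∈ X}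
  {σ : Type} [Fintype σ] (b : Module.Basis σ ℤ X)

theorem extFinite_polyModule {N : Rep.{0} ℂ (LatticeGroup ρ X hX)} (hN : IsLatticeTrivial N)
    [FiniteDimensional ℂ N] : ExtFinite (𝟙_ (Rep.{0} ℂ (LatticeGroup ρ X hX))) (polyModule b N) ∧
      extChar (𝟙_ (Rep.{0} ℂ (LatticeGroup ρ X hX))) (polyModule b N) =
        Module.finrank ℂ N.ρ.invariants := by
  have := injective_polyModule b hN
  obtain ⟨e⟩ := nonempty_invariants_polyModule b hN
  let e' := e.trans (homUnitEquivInvariants (polyModule b N)).symm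
  have : FiniteDimensional ℂ N.ρ.invariants := inferInstance
  refine ⟨extFinite_of_injective _ e'.finiteDimensional, ?_⟩
  rw [extChar_of_injective, e'.finrank_eq]

end PolynomialModules

end

/-! ### The algebraic Poincaré lemma. -/

section PolynomialDeRham

variable {σ : Type} [Fintype σ] [DecidableEq σ] {W : ℕ → Type} [∀ n, AddCommGroup (W n)]
  [∀ n, Module ℂ (W n)] (ε : ∀ n, σ → W n →ₗ[ℂ] W (n + 1)) (c : ∀ n, σ → W (n + 1) →ₗ[ℂ] W n)

/-- Creation operators `ε` and annihilation operators `c` on a graded space. -/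
structure IsExteriorData : Prop where
  anticomm : ∀ n i j w, ε (n + 1) i (ε n j w) = -ε (n + 1) j (ε n i w)
  contract_zero : ∀ i j w, c 0 j (ε 0 i w) = if i = j then w else 0
  contract_succ : ∀ n i j w, c (n + 1) j (ε (n + 1) i w) = (if i = j then w else 0) - ε n i (c n j w)
  number : ∀ n w, ∑ i, ε n i (c n i w) = ((n + 1 : ℕ) : ℂ) • w

/-- The differential of the polynomial de Rham complex. -/
def deRham (n : ℕ) : TensorProduct ℂ (MvPolynomial σ ℂ) (W n) →ₗ[ℂ]
    TensorProduct ℂ (MvPolynomial σ ℂ) (W (n + 1)) :=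
  ∑ i, TensorProduct.map (MvPolynomial.pderiv i).toLinearMap (ε n i)

/-- Contraction with the Euler vector field. -/
def eulerContract (n : ℕ) : TensorProduct ℂ (MvPolynomial σ ℂ) (W (n + 1)) →ₗ[ℂ]
    TensorProduct ℂ (MvPolynomial σ ℂ) (W n) :=
  ∑ i, TensorProduct.map (LinearMap.mulLeft ℂ (MvPolynomial.X i)) (c n i)

omit [DecidableEq σ] in
lemma deRham_tmul (n : ℕ) (p : MvPolynomial σ ℂ) (w : W n) :
    deRham ε n (p ⊗ₜ w) = ∑ i, MvPolynomial.pderiv i p ⊗ₜ ε n i w := by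
  simp [deRham]

omit [DecidableEq σ] in
lemma eulerContract_tmul (n : ℕ) (p : MvPolynomial σ ℂ) (w : W (n + 1)) :
    eulerContract c n (p ⊗ₜ w) = ∑ i, (MvPolynomial.X i * p) ⊗ₜ c n i w := by
  simp [eulerContract]

/-- The Euler operator. -/
def eulerOp (σ : Type) [Fintype σ] : MvPolynomial σ ℂ →ₗ[ℂ] MvPolynomial σ ℂ :=
  ∑ i, LinearMap.mulLeft ℂ (MvPolynomial.X i) ∘ₗ (MvPolynomial.pderiv i).toLinearMap

omit [DecidableEq σ] in
lemma eulerOp_apply (p : MvPolynomial σ ℂ) :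
    eulerOp σ p = ∑ i, MvPolynomial.X i * MvPolynomial.pderiv i p := by
  simp [eulerOp]

omit [DecidableEq σ] in
lemma eulerOp_monomial (m : σ →₀ ℕ) (r : ℂ) :
    eulerOp σ (MvPolynomial.monomial m r) = (m.degree : ℂ) • MvPolynomial.monomial m r := by
  rw [eulerOp_apply]
  simp only [MvPolynomial.X_mul_pderiv_monomial]
  rw [← Finset.sum_smul, Finsupp.degree_eq_sum, Nat.cast_smul_eq_nsmul]

/-- Division of a monomial of degree `k` by `k + n`. -/
def shiftedDegreeInv (σ : Type) (n : ℕ) : MvPolynomial σ ℂ →ₗ[ℂ] MvPolynomial σ ℂ :=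
  (MvPolynomial.basisMonomials σ ℂ).constr ℂ fun m =>
    ((m.degree + n : ℂ)⁻¹) • MvPolynomial.monomial m (1 : ℂ)

omit [Fintype σ] [DecidableEq σ] in
lemma shiftedDegreeInv_monomial (n : ℕ) (m : σ →₀ ℕ) (r : ℂ) :
    shiftedDegreeInv σ n (MvPolynomial.monomial m r) =
      ((m.degree + n : ℂ)⁻¹) • MvPolynomial.monomial m r := by
  have h : MvPolynomial.monomial m r = r • MvPolynomial.basisMonomials σ ℂ m := by
    simp [MvPolynomial.smul_monomial]
  rw [h, map_smul, shiftedDegreeInv, Module.Basis.constr_basis, MvPolynomial.coe_basisMonomials,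
    smul_comm]

omit [Fintype σ] [DecidableEq σ] in
-- Differentiation lowers the degree by one while the shift rises by one, so the divisor is
-- unchanged.
lemma shiftedDegreeInv_pderiv (n : ℕ) (i : σ) (p : MvPolynomial σ ℂ) :
    shiftedDegreeInv σ (n + 1) (MvPolynomial.pderiv i p) =
      MvPolynomial.pderiv i (shiftedDegreeInv σ n p) := by
  induction p using MvPolynomial.induction_on' with
  | monomial m r =>
    rw [MvPolynomial.pderiv_monomial, shiftedDegreeInv_monomial, shiftedDegreeInv_monomial,
      Derivation.map_smul, MvPolynomial.pderiv_monomial]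
    by_cases h : m i = 0
    · simp [h]
    · congr 2
      have h1 : m = (m - Finsupp.single i 1) + Finsupp.single i 1 :=
        (tsub_add_cancel_of_le (Finsupp.single_le_iff.2 (Nat.one_le_iff_ne_zero.2 h))).symm
      have h2 : m.degree = (m - Finsupp.single i 1).degree + 1 := by
        conv_lhs => rw [h1]
        rw [map_add, Finsupp.degree_single]
      rw [h2]
      push_cast
      ring
  | add p q hp hq => simp only [map_add, hp, hq]

omit [DecidableEq σ] in
lemma shiftedDegreeInv_euler (n : ℕ) (p : MvPolynomial σ ℂ) :
    shiftedDegreeInv σ (n + 1) (eulerOp σ p + ((n + 1 : ℕ) : ℂ) • p) = p := by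
  induction p using MvPolynomial.induction_on' with
  | monomial m r =>
    rw [eulerOp_monomial, ← add_smul, map_smul, shiftedDegreeInv_monomial, smul_smul,
      mul_inv_cancel₀, one_smul]
    rw [← Nat.cast_add]
    exact Nat.cast_ne_zero.2 (Nat.succ_ne_zero _)
  | add p q hp hq =>
    rw [map_add (eulerOp σ), smul_add, add_add_add_comm, map_add, hp, hq]

omit [DecidableEq σ] in
-- The Euler operator multiplies a monomial by its degree, which is invertible except on constants;
-- only the constant term is lost.
lemma shiftedDegreeInv_zero_euler (p : MvPolynomial σ ℂ) :
    shiftedDegreeInv σ 0 (eulerOp σ p) = p - MvPolynomial.constantCoeff p • 1 := by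
  classical
  induction p using MvPolynomial.induction_on' with
  | monomial m r =>
    rw [eulerOp_monomial, map_smul, shiftedDegreeInv_monomial, smul_smul]
    by_cases h : m = 0
    · subst h
      simp [MvPolynomial.smul_eq_C_mul]
    · rw [Nat.cast_zero, add_zero, mul_inv_cancel₀, one_smul]
      · simp [MvPolynomial.constantCoeff_monomial, h]
      · simpa [Finsupp.degree_eq_zero_iff] using h
  | add p q hp hq =>
    rw [map_add, map_add, hp, hq, map_add, add_smul]
    abel

omit [Fintype σ] [DecidableEq σ] in
lemma pderiv_pderiv_comm (i j : σ) (p : MvPolynomial σ ℂ) :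
    MvPolynomial.pderiv i (MvPolynomial.pderiv j p) =
      MvPolynomial.pderiv j (MvPolynomial.pderiv i p) := by
  classical
  have h : ⁅MvPolynomial.pderiv (R := ℂ) i, MvPolynomial.pderiv (R := ℂ) j⁆ = 0 :=
    MvPolynomial.derivation_ext fun k => by
      rw [Derivation.commutator_apply, MvPolynomial.pderiv_X, MvPolynomial.pderiv_X]
      simp only [Pi.single_apply]
      split_ifs <;> simp
  have h1 := congrArg (fun D => D p) h
  exact sub_eq_zero.1 ((Derivation.commutator_apply (D1 := MvPolynomial.pderiv i)
    (D2 := MvPolynomial.pderiv j) (a := p)).symm.trans h1)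

variable {ε c}

/-- Partial derivatives commute and creation operators anticommute, so the double sum equals its own
negative. -/
lemma deRham_deRham (h : IsExteriorData ε c) (n : ℕ) (t) : deRham ε (n + 1) (deRham ε n t) = 0 := by
  induction t using TensorProduct.induction_on with
  | zero => simp
  | tmul p w =>
    have h1 : deRham ε (n + 1) (deRham ε n (p ⊗ₜ w)) = ∑ i, ∑ j,
        MvPolynomial.pderiv j (MvPolynomial.pderiv i p) ⊗ₜ ε (n + 1) j (ε n i w) := by
      simp only [deRham_tmul, map_sum]
    have h2 : deRham ε (n + 1) (deRham ε n (p ⊗ₜ w)) = -deRham ε (n + 1) (deRham ε n (p ⊗ₜ w)) := by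
      conv_lhs => rw [h1, Finset.sum_comm]
      rw [h1, ← Finset.sum_neg_distrib]
      refine Finset.sum_congr rfl fun i _ => ?_
      rw [← Finset.sum_neg_distrib]
      refine Finset.sum_congr rfl fun j _ => ?_
      rw [h.anticomm, TensorProduct.tmul_neg, pderiv_pderiv_comm]
    rw [eq_neg_iff_add_eq_zero, ← two_smul ℂ] at h2
    exact (smul_eq_zero.1 h2).resolve_left two_ne_zero
  | add s t hs ht => simp only [map_add, hs, ht, add_zero]

omit [DecidableEq σ] in
lemma deRham_shiftedDegreeInv (n : ℕ) (t) :
    (shiftedDegreeInv σ (n + 1)).rTensor (W (n + 1)) (deRham ε n t) =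
      deRham ε n ((shiftedDegreeInv σ n).rTensor (W n) t) := by
  induction t using TensorProduct.induction_on with
  | zero => simp
  | tmul p w =>
    rw [deRham_tmul, map_sum, LinearMap.rTensor_tmul, deRham_tmul]
    exact Finset.sum_congr rfl fun i _ => by rw [LinearMap.rTensor_tmul, shiftedDegreeInv_pderiv]
  | add s t hs ht => simp only [map_add, hs, ht]

/-- Cartan's formula for the Euler vector field: the Lie derivative multiplies a form by the degree
of its coefficient plus the degree of the form. -/
lemma deRham_homotopy (h : IsExteriorData ε c) (n : ℕ) (t) :
    eulerContract c (n + 1) (deRham ε (n + 1) t) + deRham ε n (eulerContract c n t) =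
      (eulerOp σ + ((n + 1 : ℕ) : ℂ) • LinearMap.id).rTensor (W (n + 1)) t := by
  induction t using TensorProduct.induction_on with
  | zero => simp
  | tmul p w =>
    have h1 : eulerContract c (n + 1) (deRham ε (n + 1) (p ⊗ₜ w)) =
        eulerOp σ p ⊗ₜ w - ∑ i, ∑ j,
          (MvPolynomial.X j * MvPolynomial.pderiv i p) ⊗ₜ ε n i (c n j w) := by
      simp only [deRham_tmul, map_sum, eulerContract_tmul, h.contract_succ, TensorProduct.tmul_sub,
        Finset.sum_sub_distrib, eulerOp_apply, TensorProduct.sum_tmul]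
      congr 1
      refine Finset.sum_congr rfl fun i _ => ?_
      rw [Finset.sum_eq_single i (fun j _ hj => by rw [if_neg hj.symm, TensorProduct.tmul_zero])
        (by simp), if_pos rfl]
    have h2 : deRham ε n (eulerContract c n (p ⊗ₜ w)) =
        (∑ i, ∑ j, (MvPolynomial.X j * MvPolynomial.pderiv i p) ⊗ₜ ε n i (c n j w)) +
          p ⊗ₜ (((n + 1 : ℕ) : ℂ) • w) := by
      have h3 (j : σ) : deRham ε n ((MvPolynomial.X j * p) ⊗ₜ c n j w) =
          (∑ i, (MvPolynomial.X j * MvPolynomial.pderiv i p) ⊗ₜ ε n i (c n j w)) +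
            p ⊗ₜ ε n j (c n j w) := by
        rw [deRham_tmul, ← Finset.sum_add_sum_compl {j}, add_comm (Finset.sum _ _),
          ← Finset.sum_add_sum_compl {j} fun i =>
            (MvPolynomial.X j * MvPolynomial.pderiv i p) ⊗ₜ[ℂ] ε n i (c n j w),
          Finset.sum_singleton, Finset.sum_singleton, add_comm (_ ⊗ₜ[ℂ] _) (Finset.sum _ _),
          add_assoc, ← TensorProduct.add_tmul, Derivation.leibniz, MvPolynomial.pderiv_X_self]
        congr 1
        · refine Finset.sum_congr rfl fun i hi => ?_
          rw [Derivation.leibniz, MvPolynomial.pderiv_X_of_ne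
            (Ne.symm (by simpa using hi)), smul_zero, add_zero, smul_eq_mul]
        · rw [smul_eq_mul, smul_eq_mul, mul_one]
      rw [eulerContract_tmul, map_sum, Finset.sum_congr rfl fun j _ => h3 j,
        Finset.sum_add_distrib, Finset.sum_comm, ← TensorProduct.tmul_sum, h.number]
    rw [h1, h2, LinearMap.rTensor_tmul, LinearMap.add_apply, TensorProduct.add_tmul,
      LinearMap.smul_apply, LinearMap.id_apply, TensorProduct.tmul_smul, TensorProduct.smul_tmul']
    abel
  | add s t hs ht =>
    rw [map_add, map_add, map_add, map_add, map_add, ← hs, ← ht]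
    abel

/-- The Euler contraction is a homotopy from zero to multiplication by the total degree. In positive
form degree this is nonzero, and its inverse commutes with the differential. -/
theorem exact_deRham (h : IsExteriorData ε c) (n : ℕ) :
    Function.Exact (deRham ε n) (deRham ε (n + 1)) := fun t => by
  refine ⟨fun ht => ?_, ?_⟩
  · have h1 := deRham_homotopy h n t
    rw [ht, map_zero, zero_add] at h1
    refine ⟨(shiftedDegreeInv σ n).rTensor (W n) (eulerContract c n t), ?_⟩
    rw [← deRham_shiftedDegreeInv, h1, ← LinearMap.comp_apply, ← LinearMap.rTensor_comp]
    have h2 : shiftedDegreeInv σ (n + 1) ∘ₗ (eulerOp σ + ((n + 1 : ℕ) : ℂ) • LinearMap.id) =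
      LinearMap.id := LinearMap.ext fun p => shiftedDegreeInv_euler n p
    rw [h2, LinearMap.rTensor_id, LinearMap.id_apply]
  · rintro ⟨s, rfl⟩
    exact deRham_deRham h n s

omit [DecidableEq σ] in
lemma deRham_one_tmul (w : W 0) : deRham ε 0 (1 ⊗ₜ w) = 0 := by
  simp [deRham_tmul]

/-- The homotopy in form degree zero has only the contraction term, which is the Euler operator; its
kernel consists of the constants. -/
theorem exists_of_deRham_eq_zero (h : IsExteriorData ε c) (t) (ht : deRham ε 0 t = 0) :
    ∃ w : W 0, 1 ⊗ₜ w = t := by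
  have h1 (t) : eulerContract c 0 (deRham ε 0 t) = (eulerOp σ).rTensor (W 0) t := by
    induction t using TensorProduct.induction_on with
    | zero => simp
    | tmul p w =>
      simp only [deRham_tmul, map_sum, eulerContract_tmul, h.contract_zero, eulerOp_apply,
        TensorProduct.sum_tmul, LinearMap.rTensor_tmul]
      refine Finset.sum_congr rfl fun i _ => ?_
      rw [Finset.sum_eq_single i (fun j _ hj => by rw [if_neg hj.symm, TensorProduct.tmul_zero])
        (by simp), if_pos rfl]
    | add s t hs ht => simp only [map_add, hs, ht]
  have h2 (t) : ∃ w : W 0, 1 ⊗ₜ w = t -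
      (shiftedDegreeInv σ 0).rTensor (W 0) ((eulerOp σ).rTensor (W 0) t) := by
    induction t using TensorProduct.induction_on with
    | zero => exact ⟨0, by simp⟩
    | tmul p w =>
      refine ⟨MvPolynomial.constantCoeff p • w, ?_⟩
      rw [LinearMap.rTensor_tmul, LinearMap.rTensor_tmul, shiftedDegreeInv_zero_euler,
        TensorProduct.sub_tmul, sub_sub_cancel, TensorProduct.smul_tmul]
    | add s t hs ht =>
      obtain ⟨v, hv⟩ := hs
      obtain ⟨w, hw⟩ := ht
      refine ⟨v + w, ?_⟩
      rw [TensorProduct.tmul_add, hv, hw, map_add, map_add]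
      abel
  obtain ⟨w, hw⟩ := h2 t
  refine ⟨w, ?_⟩
  rw [hw, ← h1, ht, map_zero, map_zero, sub_zero]

end PolynomialDeRham

/-! ### Exterior and interior multiplication. -/

section ExteriorOperators

variable {V : Type} [AddCommGroup V] [Module ℂ V]

/-- Left exterior multiplication by `v`. -/
def wedge (n : ℕ) (v : V) : ⋀[ℂ]^n V →ₗ[ℂ] ⋀[ℂ]^(n + 1) V :=
  (LinearMap.mulLeft ℂ (ExteriorAlgebra.ι ℂ v)).restrict fun x hx => by
    change _ ∈ LinearMap.range (ExteriorAlgebra.ι ℂ) ^ (n + 1)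
    rw [pow_succ']
    exact Submodule.mul_mem_mul ⟨v, rfl⟩ hx

/-- The exterior algebra is the Clifford algebra of the zero form, whose contraction is an
antiderivation; the degree drops by induction on products v ∧ y. -/
lemma contractLeft_mem (φ : Module.Dual ℂ V) (n : ℕ) : ∀ x ∈ ⋀[ℂ]^(n + 1) V,
    CliffordAlgebra.contractLeft (Q := (0 : QuadraticForm ℂ V)) φ x ∈ ⋀[ℂ]^n V := by
  induction n with
  | zero =>
    intro x hx
    change x ∈ LinearMap.range (ExteriorAlgebra.ι ℂ) ^ (0 + 1) at hx
    rw [zero_add, pow_one] at hx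
    obtain ⟨v, rfl⟩ := hx
    rw [show CliffordAlgebra.contractLeft (Q := (0 : QuadraticForm ℂ V)) φ (ExteriorAlgebra.ι ℂ v)
      = _ from CliffordAlgebra.contractLeft_ι _ _ _]
    change _ ∈ LinearMap.range (ExteriorAlgebra.ι ℂ) ^ 0
    rw [pow_zero]
    exact Submodule.mem_one.2 ⟨_, rfl⟩
  | succ n ih =>
    intro x hx
    change x ∈ LinearMap.range (ExteriorAlgebra.ι ℂ) ^ (n + 1 + 1) at hx
    rw [pow_succ'] at hx
    induction hx using Submodule.mul_induction_on' with
    | mem_mul_mem a ha y hy =>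
      obtain ⟨v, rfl⟩ := ha
      rw [show CliffordAlgebra.contractLeft (Q := (0 : QuadraticForm ℂ V)) φ
        (ExteriorAlgebra.ι ℂ v * y) = _ from CliffordAlgebra.contractLeft_ι_mul _ _ _]
      exact Submodule.sub_mem _ (Submodule.smul_mem _ _ hy) (wedge n v ⟨_, ih y hy⟩).2
    | add x _ y _ hx hy =>
      rw [map_add]
      exact Submodule.add_mem _ hx hy

/-- Interior multiplication by a linear form. -/
def contract (n : ℕ) (φ : Module.Dual ℂ V) : ⋀[ℂ]^(n + 1) V →ₗ[ℂ] ⋀[ℂ]^n V :=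
  (CliffordAlgebra.contractLeft (Q := (0 : QuadraticForm ℂ V)) φ).restrict (contractLeft_mem φ n)

lemma contract_wedge (n : ℕ) (φ : Module.Dual ℂ V) (v : V) (x : ⋀[ℂ]^(n + 1) V) :
    contract (n + 1) φ (wedge (n + 1) v x) = φ v • x - wedge n v (contract n φ x) :=
  Subtype.ext (CliffordAlgebra.contractLeft_ι_mul _ _ _)

lemma contract_wedge_zero (φ : Module.Dual ℂ V) (v : V) (x : ⋀[ℂ]^0 V) :
    contract 0 φ (wedge 0 v x) = φ v • x := by
  obtain ⟨x, hx⟩ := x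
  apply Subtype.ext
  have hx' : x ∈ LinearMap.range (ExteriorAlgebra.ι ℂ) ^ 0 := hx
  rw [pow_zero] at hx'
  obtain ⟨r, rfl⟩ := Submodule.mem_one.1 hx'
  have h : CliffordAlgebra.contractLeft (Q := (0 : QuadraticForm ℂ V)) φ
    (ExteriorAlgebra.ι ℂ v * algebraMap ℂ (ExteriorAlgebra ℂ V) r) = _ :=
    CliffordAlgebra.contractLeft_ι_mul _ _ _
  refine h.trans ?_
  rw [show CliffordAlgebra.contractLeft (Q := (0 : QuadraticForm ℂ V)) φ
    (algebraMap ℂ (ExteriorAlgebra ℂ V) r) = 0 from CliffordAlgebra.contractLeft_algebraMap _ _ _,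
    mul_zero, sub_zero]
  rfl

lemma wedge_wedge (n : ℕ) (v w : V) (x : ⋀[ℂ]^n V) :
    wedge (n + 1) v (wedge n w x) = - wedge (n + 1) w (wedge n v x) := by
  apply Subtype.ext
  change ExteriorAlgebra.ι ℂ v * (ExteriorAlgebra.ι ℂ w * (x : ExteriorAlgebra ℂ V)) =
    -(ExteriorAlgebra.ι ℂ w * (ExteriorAlgebra.ι ℂ v * (x : ExteriorAlgebra ℂ V)))
  rw [← mul_assoc, ← mul_assoc, ← neg_mul,
    eq_neg_of_add_eq_zero_left (ExteriorAlgebra.ι_add_mul_swap v w)]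

lemma wedge_smul (n : ℕ) (c : ℂ) (v : V) (x : ⋀[ℂ]^n V) : wedge n (c • v) x = c • wedge n v x :=
  Subtype.ext <| by
    change ExteriorAlgebra.ι ℂ (c • v) * (x : ExteriorAlgebra ℂ V) =
      c • (ExteriorAlgebra.ι ℂ v * (x : ExteriorAlgebra ℂ V))
    rw [map_smul, smul_mul_assoc]

lemma wedge_sum {κ : Type} (s : Finset κ) (n : ℕ) (v : κ → V) (x : ⋀[ℂ]^n V) :
    wedge n (∑ k ∈ s, v k) x = ∑ k ∈ s, wedge n (v k) x :=
  Subtype.ext <| by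
    rw [AddSubmonoidClass.coe_finsetSum]
    change ExteriorAlgebra.ι ℂ (∑ k ∈ s, v k) * (x : ExteriorAlgebra ℂ V) =
      ∑ k ∈ s, (ExteriorAlgebra.ι ℂ (v k) * (x : ExteriorAlgebra ℂ V))
    rw [map_sum, Finset.sum_mul]

lemma exteriorPower_induction {n : ℕ} {p : ⋀[ℂ]^(n + 1) V → Prop}
    (h : ∀ v x, p (wedge n v x)) (hadd : ∀ x y, p x → p y → p (x + y)) (x) : p x := by
  obtain ⟨x, hx⟩ := x
  have hx' : x ∈ LinearMap.range (ExteriorAlgebra.ι ℂ) *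
      LinearMap.range (ExteriorAlgebra.ι ℂ : V →ₗ[ℂ] _) ^ n := by
    rw [← pow_succ']
    exact hx
  induction hx' using Submodule.mul_induction_on' with
  | mem_mul_mem a ha y hy =>
    obtain ⟨v, rfl⟩ := ha
    exact h v ⟨y, hy⟩
  | add x hx1 y hy1 hx2 hy2 =>
    rw [← pow_succ'] at hx1 hy1
    exact hadd ⟨x, hx1⟩ ⟨y, hy1⟩ (hx2 hx1) (hy2 hy1)

/-- The number operator. On v ∧ x the contraction of v restores v ∧ x once, and the two sign changes
in the remaining terms leave v ∧ (number operator on x). -/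
lemma sum_wedge_contract {σ : Type} [Fintype σ] (e : Module.Basis σ ℂ V) (n : ℕ) :
    ∀ x : ⋀[ℂ]^(n + 1) V, ∑ i, wedge n (e i) (contract n (e.coord i) x) = ((n + 1 : ℕ) : ℂ) • x := by
  induction n with
  | zero =>
    refine exteriorPower_induction (fun v x => ?_) fun x y hx hy => ?_
    · simp only [contract_wedge_zero, map_smul, ← wedge_smul]
      rw [← wedge_sum]
      simp [e.sum_repr]
    · simp only [map_add, Finset.sum_add_distrib, hx, hy, smul_add]
  | succ n ih =>
    refine exteriorPower_induction (fun v x => ?_) fun x y hx hy => ?_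
    · simp only [contract_wedge, map_smul, map_sub, Finset.sum_sub_distrib, ← wedge_smul]
      rw [← wedge_sum, show ∑ i, e.coord i v • e i = v from e.sum_repr v]
      simp only [wedge_wedge n (e _) v, Finset.sum_neg_distrib, ← map_sum]
      rw [ih x, sub_neg_eq_add, map_smul]
      rw [wedge_smul]
      push_cast
      module
    · simp only [map_add, Finset.sum_add_distrib, hx, hy, smul_add]

lemma coe_exteriorPower_map (n : ℕ) (f : V →ₗ[ℂ] V) (x : ⋀[ℂ]^n V) :
    (exteriorPower.map n f x : ExteriorAlgebra ℂ V) = ExteriorAlgebra.map f x := by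
  have : (⋀[ℂ]^n V).subtype ∘ₗ exteriorPower.map n f =
      (ExteriorAlgebra.map f).toLinearMap ∘ₗ (⋀[ℂ]^n V).subtype := by
    refine exteriorPower.linearMap_ext (AlternatingMap.ext fun v => ?_)
    change ((exteriorPower.map n f (exteriorPower.ιMulti ℂ n v) : ⋀[ℂ]^n V) : ExteriorAlgebra ℂ V) =
      ExteriorAlgebra.map f (ExteriorAlgebra.ιMulti ℂ n v)
    rw [exteriorPower.map_apply_ιMulti, ExteriorAlgebra.map_apply_ιMulti,
      exteriorPower.ιMulti_apply_coe]
  exact LinearMap.congr_fun this x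

lemma exteriorPower_map_wedge (n : ℕ) (f : V →ₗ[ℂ] V) (v : V) (x : ⋀[ℂ]^n V) :
    exteriorPower.map (n + 1) f (wedge n v x) = wedge n (f v) (exteriorPower.map n f x) := by
  apply Subtype.ext
  rw [coe_exteriorPower_map]
  refine (map_mul (ExteriorAlgebra.map f) (ExteriorAlgebra.ι ℂ v) (x : ExteriorAlgebra ℂ V)).trans ?_
  rw [ExteriorAlgebra.map_apply_ι, ← coe_exteriorPower_map]
  rfl

lemma subsingleton_exteriorPower [FiniteDimensional ℂ V] {n : ℕ} (hn : Module.finrank ℂ V < n) :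
    Subsingleton (⋀[ℂ]^n V) :=
  Module.finrank_zero_iff.1 (by rw [exteriorPower.finrank_eq, Nat.choose_eq_zero_of_lt hn])

end ExteriorOperators

/-! ### Traces on exterior powers and the characteristic determinant. -/

section ExteriorTrace

variable {K : Type} [Field K] {V : Type} [AddCommGroup V] [Module K V] [FiniteDimensional K V]

omit [FiniteDimensional K V] in
-- In the basis indexed by n-element subsets S, the diagonal entry of ⋀ⁿf at S is the principal
-- minor on S, and the coefficients of det(1 + tA) are sums of principal minors.
lemma trace_exteriorPower_map {m : ℕ} (b : Module.Basis (Fin m) K V) (f : V →ₗ[K] V) (n : ℕ) :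
    LinearMap.trace K _ (exteriorPower.map n f) =
      (Matrix.det (1 + (Polynomial.X : Polynomial K) •
        (LinearMap.toMatrix b b f).map Polynomial.C)).coeff n := by
  classical
  rw [Matrix.coeff_det_one_add_X_smul_eq_sum_minors,
    LinearMap.trace_eq_matrix_trace K (b.exteriorPower n), Matrix.trace]
  refine Finset.sum_bij (fun s _ => (s : Finset (Fin m))) (fun s _ => ?_) (fun s _ t _ h => ?_)
    (fun s hs => ?_) (fun s _ => ?_)
  · exact Finset.mem_powersetCard.2 ⟨Finset.subset_univ _, s.2⟩
  · exact Subtype.ext h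
  · exact ⟨⟨s, (Finset.mem_powersetCard.1 hs).2⟩, Finset.mem_univ _, rfl⟩
  · rw [Matrix.diag_apply, LinearMap.toMatrix_apply, exteriorPower.basis_apply,
      exteriorPower.basis_repr_apply, exteriorPower.map_apply_ιMulti_family,
      exteriorPower.ιMulti_family, exteriorPower.ιMultiDual_apply_ιMulti, ← Matrix.det_transpose,
      ← Matrix.det_submatrix_equiv_self ((s : Finset (Fin m)).orderIsoOfFin s.2).toEquiv]
    congr 1
    ext i j
    simp [LinearMap.toMatrix_apply, Set.powersetCard.ofFinEmbEquiv_symm_apply]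
    rfl

theorem sum_trace_exteriorPower (f : V →ₗ[K] V) {N : ℕ} (hN : Module.finrank K V < N) :
    ∑ n ∈ Finset.range N, (-1) ^ n * LinearMap.trace K _ (exteriorPower.map n f) =
      LinearMap.det (1 - f) := by
  let b := Module.finBasis K V
  have hdeg : (Matrix.det (1 + (Polynomial.X : Polynomial K) •
      (LinearMap.toMatrix b b f).map Polynomial.C)).natDegree < N := by
    refine lt_of_le_of_lt ?_ hN
    rw [Polynomial.natDegree_le_iff_coeff_eq_zero]
    intro k hk
    rw [Matrix.coeff_det_one_add_X_smul_eq_sum_minors, Finset.powersetCard_eq_empty.2 (by simpa),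
      Finset.sum_empty]
  have h := Polynomial.eval_eq_sum_range' hdeg (-1)
  simp only [← trace_exteriorPower_map] at h
  rw [← LinearMap.det_toMatrix b, map_sub, LinearMap.toMatrix_one]
  refine (Finset.sum_congr rfl fun n _ => mul_comm _ _).trans (h.symm.trans ?_)
  rw [← Polynomial.coe_evalRingHom, RingHom.map_det]
  congr 1
  ext i j
  simp [Matrix.one_apply, sub_eq_add_neg, apply_ite]

end ExteriorTrace

section

open scoped MonoidalCategory

section SubsingletonTensor

variable {V W : Type} [AddCommGroup V] [Module ℂ V] [AddCommGroup W] [Module ℂ W]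

lemma subsingleton_tensorProduct_of_left [Subsingleton V] : Subsingleton (TensorProduct ℂ V W) :=
  subsingleton_of_forall_eq 0 fun t => by
    induction t using TensorProduct.induction_on with
    | zero => rfl
    | tmul v w => rw [Subsingleton.elim v 0, TensorProduct.zero_tmul]
    | add s t hs ht => rw [hs, ht, add_zero]

lemma subsingleton_tensorProduct_of_right [Subsingleton W] : Subsingleton (TensorProduct ℂ V W) :=
  subsingleton_of_forall_eq 0 fun t => by
    induction t using TensorProduct.induction_on with
    | zero => rfl
    | tmul v w => rw [Subsingleton.elim w 0, TensorProduct.tmul_zero]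
    | add s t hs ht => rw [hs, ht, add_zero]

end SubsingletonTensor

/-! ### The equivariant de Rham coresolution and EP for modules with trivial lattice action. -/

section LatticeForms

variable {Γ : Type} [Group Γ] {E : Type} [AddCommGroup E] [Module ℝ E]
  {ρ : Representation ℝ Γ E} {X : Submodule ℤ E} {hX : ∀ γ, ∀ x ∈ X, ρ γ x ∈ X}
  {σ : Type} [Fintype σ] [DecidableEq σ] (b : Module.Basis σ ℤ X)

variable (ρ X hX) in
lemma latticeLin_mul (γ δ : Γ) :
    latticeLin ρ X hX (γ * δ) = latticeLin ρ X hX γ ∘ₗ latticeLin ρ X hX δ :=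
  LinearMap.ext fun x => Subtype.ext (LinearMap.congr_fun (map_mul ρ γ δ) (x : E))

variable (ρ X hX) in
lemma latticeLin_one : latticeLin ρ X hX 1 = LinearMap.id :=
  LinearMap.ext fun x => Subtype.ext (LinearMap.congr_fun (map_one ρ) (x : E))

/-- The matrix of `γ` on the lattice. -/
def latticeMatrix (hX : ∀ γ, ∀ x ∈ X, ρ γ x ∈ X) (γ : Γ) : Matrix σ σ ℂ :=
  (LinearMap.toMatrix b b (latticeLin ρ X hX γ)).map (Int.castRingHom ℂ)

lemma latticeMatrix_mul (γ δ : Γ) :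
    latticeMatrix b hX (γ * δ) = latticeMatrix b hX γ * latticeMatrix b hX δ := by
  rw [latticeMatrix, latticeLin_mul, LinearMap.toMatrix_comp b b b, Matrix.map_mul]
  rfl

lemma latticeMatrix_one : latticeMatrix b hX (1 : Γ) = 1 := by
  rw [latticeMatrix, latticeLin_one, LinearMap.toMatrix_id, Matrix.map_one _ (map_zero _) (map_one _)]

/-- The representation of `Γ` on the dual of the complexified lattice. -/
def dualLatticeRep (hX : ∀ γ, ∀ x ∈ X, ρ γ x ∈ X) : Representation ℂ Γ (σ → ℂ) where
  toFun γ := Matrix.toLin' (latticeMatrix b hX γ⁻¹).transpose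
  map_one' := by
    rw [inv_one, latticeMatrix_one, Matrix.transpose_one, Matrix.toLin'_one]
    rfl
  map_mul' γ δ := by
    rw [mul_inv_rev, latticeMatrix_mul, Matrix.transpose_mul, Matrix.toLin'_mul]
    rfl

lemma dualLatticeRep_basisFun (γ : Γ) (i : σ) :
    dualLatticeRep b hX γ (Pi.basisFun ℂ σ i) = ∑ j,
      ((b.repr (latticeLin ρ X hX γ⁻¹ (b j)) i : ℤ) : ℂ) • Pi.basisFun ℂ σ j := by
  change Matrix.toLin' (latticeMatrix b hX γ⁻¹).transpose _ = _
  ext k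
  simp [Matrix.toLin'_apply, latticeMatrix, LinearMap.toMatrix_apply, Finset.sum_apply,
    Pi.single_apply]

lemma det_one_sub_dualLatticeRep (γ : Γ) : LinearMap.det (1 - dualLatticeRep b hX γ) =
    ((LinearMap.det (1 - latticeLin ρ X hX γ⁻¹) : ℤ) : ℂ) := by
  have h1 : (1 : (σ → ℂ) →ₗ[ℂ] (σ → ℂ)) - dualLatticeRep b hX γ =
      Matrix.toLin' ((1 - latticeMatrix b hX γ⁻¹).transpose) := by
    rw [Matrix.transpose_sub, map_sub, Matrix.transpose_one, Matrix.toLin'_one]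
    rfl
  have h2 : 1 - latticeMatrix b hX γ⁻¹ =
      (LinearMap.toMatrix b b (1 - latticeLin ρ X hX γ⁻¹)).map (Int.castRingHom ℂ) := by
    rw [map_sub, LinearMap.toMatrix_one]
    ext i j
    simp [latticeMatrix, Matrix.one_apply, apply_ite]
  rw [h1, LinearMap.det_toLin', Matrix.det_transpose, h2, ← LinearMap.det_toMatrix b]
  exact (RingHom.map_det (Int.castRingHom ℂ) _).symm

/-- The exterior powers of a representation. -/
def exteriorPowerRep {V : Type} [AddCommGroup V] [Module ℂ V] (τ : Representation ℂ Γ V) (n : ℕ) :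
    Representation ℂ Γ (⋀[ℂ]^n V) where
  toFun γ := exteriorPower.map n (τ γ)
  map_one' := by
    rw [map_one]
    exact exteriorPower.map_id
  map_mul' γ δ := by
    rw [map_mul]
    exact exteriorPower.map_comp (n := n) (τ δ) (τ γ)

variable (M : Rep.{0} ℂ (LatticeGroup ρ X hX))

/-- The constant `n`-forms with values in `M`. -/
def formModule (n : ℕ) : Rep.{0} ℂ (LatticeGroup ρ X hX) :=
  Rep.of (X := TensorProduct ℂ (⋀[ℂ]^n (σ → ℂ)) M) (Representation.tprod (G := LatticeGroup ρ X hX)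
    ((exteriorPowerRep (dualLatticeRep b hX) n).comp SemidirectProduct.rightHom) M.ρ)

/-- The decomposable forms. -/
def formTmul (n : ℕ) : ⋀[ℂ]^n (σ → ℂ) →ₗ[ℂ] M →ₗ[ℂ] formModule b M n :=
  TensorProduct.mk ℂ (⋀[ℂ]^n (σ → ℂ)) M

variable {M} in
lemma formModule_ext {n : ℕ} {Y : Type} [AddCommGroup Y] [Module ℂ Y]
    {f g : formModule b M n →ₗ[ℂ] Y}
    (h : ∀ x v, f (formTmul b M n x v) = g (formTmul b M n x v)) : f = g :=
  TensorProduct.ext' h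

lemma formModule_formTmul (n : ℕ) (w : LatticeGroup ρ X hX) (x : ⋀[ℂ]^n (σ → ℂ)) (v : M) :
    (formModule b M n).ρ w (formTmul b M n x v) =
      formTmul b M n (exteriorPower.map n (dualLatticeRep b hX w.right) x) (M.ρ w v) := rfl

/-- The coordinate creation operators on forms. -/
def formWedge (n : ℕ) (i : σ) : formModule b M n →ₗ[ℂ] formModule b M (n + 1) :=
  (wedge n (Pi.basisFun ℂ σ i)).rTensor M

lemma formWedge_formTmul (n : ℕ) (i : σ) (x : ⋀[ℂ]^n (σ → ℂ)) (v : M) :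
    formWedge b M n i (formTmul b M n x v) =
      formTmul b M (n + 1) (wedge n (Pi.basisFun ℂ σ i) x) v := rfl

/-- The coordinate annihilation operators on forms. -/
def formContract (n : ℕ) (i : σ) : formModule b M (n + 1) →ₗ[ℂ] formModule b M n :=
  (contract n ((Pi.basisFun ℂ σ).coord i)).rTensor M

lemma formContract_formTmul (n : ℕ) (i : σ) (x : ⋀[ℂ]^(n + 1) (σ → ℂ)) (v : M) :
    formContract b M n i (formTmul b M (n + 1) x v) =
      formTmul b M n (contract n ((Pi.basisFun ℂ σ).coord i) x) v := rfl

lemma isExteriorData_form : IsExteriorData (W := fun n => formModule b M n)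
    (formWedge b M) (formContract b M) where
  anticomm n i j := LinearMap.congr_fun (f := formWedge b M (n + 1) i ∘ₗ formWedge b M n j)
    (g := -(formWedge b M (n + 1) j ∘ₗ formWedge b M n i)) <| formModule_ext b fun x v => by
      simp only [LinearMap.comp_apply, LinearMap.neg_apply, formWedge_formTmul]
      rw [wedge_wedge, map_neg, LinearMap.neg_apply]
  contract_zero i j := by
    have h : formContract b M 0 j ∘ₗ formWedge b M 0 i =
        if i = j then LinearMap.id else 0 := formModule_ext b fun x v => by
      rw [LinearMap.comp_apply, formWedge_formTmul, formContract_formTmul, contract_wedge_zero,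
        map_smul, LinearMap.smul_apply, Module.Basis.coord_apply, Module.Basis.repr_self,
        Finsupp.single_apply]
      split_ifs <;> simp
    intro w
    refine (LinearMap.congr_fun h w).trans ?_
    split_ifs <;> rfl
  contract_succ n i j := by
    have h : formContract b M (n + 1) j ∘ₗ formWedge b M (n + 1) i =
        (if i = j then LinearMap.id else 0) - formWedge b M n i ∘ₗ formContract b M n j :=
      formModule_ext b fun x v => by
        rw [LinearMap.comp_apply, formWedge_formTmul, formContract_formTmul, contract_wedge,
          map_sub, LinearMap.sub_apply, LinearMap.sub_apply, LinearMap.comp_apply,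
          formContract_formTmul, formWedge_formTmul, map_smul, LinearMap.smul_apply,
          Module.Basis.coord_apply, Module.Basis.repr_self, Finsupp.single_apply]
        split_ifs <;> simp
    intro w
    refine (LinearMap.congr_fun h w).trans ?_
    rw [LinearMap.sub_apply]
    split_ifs <;> rfl
  number n := by
    have h : ∑ i, formWedge b M n i ∘ₗ formContract b M n i = ((n + 1 : ℕ) : ℂ) • LinearMap.id :=
      formModule_ext b fun x v => by
        rw [LinearMap.sum_apply]
        simp only [LinearMap.comp_apply, formContract_formTmul, formWedge_formTmul]
        rw [← LinearMap.sum_apply, ← map_sum, sum_wedge_contract, map_smul, LinearMap.smul_apply,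
          LinearMap.smul_apply, LinearMap.id_apply]
    intro w
    refine Eq.trans ?_ (LinearMap.congr_fun h w)
    rw [LinearMap.sum_apply]
    rfl

lemma formModule_formWedge (n : ℕ) (i : σ) (w : LatticeGroup ρ X hX) (t : formModule b M n) :
    (formModule b M (n + 1)).ρ w (formWedge b M n i t) =
      ∑ j, ((b.repr (latticeLin ρ X hX w⁻¹.right (b j)) i : ℤ) : ℂ) •
        formWedge b M n j ((formModule b M n).ρ w t) := by
  have h : (formModule b M (n + 1)).ρ w ∘ₗ formWedge b M n i =
      ∑ j, ((b.repr (latticeLin ρ X hX w⁻¹.right (b j)) i : ℤ) : ℂ) •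
        (formWedge b M n j ∘ₗ (formModule b M n).ρ w) := formModule_ext b fun x v => by
    rw [LinearMap.sum_apply]
    simp only [LinearMap.comp_apply, LinearMap.smul_apply, formWedge_formTmul, formModule_formTmul]
    rw [exteriorPower_map_wedge, dualLatticeRep_basisFun, wedge_sum, map_sum, LinearMap.sum_apply]
    simp only [wedge_smul, map_smul, LinearMap.smul_apply, SemidirectProduct.inv_right]
  refine (LinearMap.congr_fun h t).trans ?_
  rw [LinearMap.sum_apply]
  rfl

omit [DecidableEq σ] in
lemma pderiv_polyRep (w : LatticeGroup ρ X hX) (j : σ) (p : MvPolynomial σ ℂ) :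
    MvPolynomial.pderiv j (polyRep b w p) =
      ∑ i, ((b.repr (latticeLin ρ X hX w⁻¹.right (b j)) i : ℤ) : ℂ) •
        polyRep b w (MvPolynomial.pderiv i p) :=
  pderiv_affineSubst b _ _ j p

/-- Partial derivatives transform by the Jacobian of the substitution and coordinate forms by its
transpose, so exchanging the two sums identifies both sides. -/
lemma deRham_equivariant (n : ℕ) (w : LatticeGroup ρ X hX) (t : polyModule b (formModule b M n)) :
    deRham (W := fun n => formModule b M n) (formWedge b M) n
        ((polyModule b (formModule b M n)).ρ w t) =
      (polyModule b (formModule b M (n + 1))).ρ w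
        (deRham (W := fun n => formModule b M n) (formWedge b M) n t) := by
  let D := deRham (W := fun n => formModule b M n) (formWedge b M) n
  have h : D ∘ₗ ((polyRep b).tprod (formModule b M n).ρ w) =
      ((polyRep b).tprod (formModule b M (n + 1)).ρ w) ∘ₗ D := TensorProduct.ext' fun p t => by
    have h1 := deRham_tmul (W := fun n => formModule b M n) (formWedge b M) n
      (polyRep b w p) ((formModule b M n).ρ w t)
    have h2 := deRham_tmul (W := fun n => formModule b M n) (formWedge b M) n p t
    refine Eq.trans h1 (Eq.trans ?_
      (congrArg ((polyRep b).tprod (formModule b M (n + 1)).ρ w) h2).symm)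
    rw [map_sum]
    have h3 (i : σ) : ((polyRep b).tprod (formModule b M (n + 1)).ρ w)
        (MvPolynomial.pderiv i p ⊗ₜ[ℂ] formWedge b M n i t) =
        ∑ j, polyRep b w (MvPolynomial.pderiv i p) ⊗ₜ[ℂ]
          (((b.repr (latticeLin ρ X hX w⁻¹.right (b j)) i : ℤ) : ℂ) •
            formWedge b M n j ((formModule b M n).ρ w t)) := by
      rw [← TensorProduct.tmul_sum, ← formModule_formWedge]
      rfl
    rw [Finset.sum_congr rfl fun i _ => h3 i, Finset.sum_comm]
    refine Finset.sum_congr rfl fun j _ => ?_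
    rw [pderiv_polyRep, TensorProduct.sum_tmul]
    exact Finset.sum_congr rfl fun i _ => TensorProduct.smul_tmul _ _ _
  exact LinearMap.congr_fun h t

/-- The de Rham differential, as a morphism of representations. -/
def deRhamHom (n : ℕ) : polyModule b (formModule b M n) ⟶ polyModule b (formModule b M (n + 1)) :=
  Rep.ofHom ⟨deRham (W := fun n => formModule b M n) (formWedge b M) n,
    fun w => LinearMap.ext fun t => deRham_equivariant b M n w t⟩

/-- The identification of `M` with the `M`-valued `0`-forms. -/
def zeroForms : M ≃ₗ[ℂ] formModule b M 0 :=
  (TensorProduct.lid ℂ M).symm ≪≫ₗ TensorProduct.congr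
    (exteriorPower.zeroEquiv ℂ (σ → ℂ)).symm (LinearEquiv.refl ℂ M)

lemma zeroForms_equivariant (w : LatticeGroup ρ X hX) (v : M) :
    zeroForms b M (M.ρ w v) = (formModule b M 0).ρ w (zeroForms b M v) := by
  change (exteriorPower.zeroEquiv ℂ (σ → ℂ)).symm 1 ⊗ₜ[ℂ] M.ρ w v =
    exteriorPower.map 0 (dualLatticeRep b hX w.right)
      ((exteriorPower.zeroEquiv ℂ (σ → ℂ)).symm 1) ⊗ₜ[ℂ] M.ρ w v
  congr 1
  rw [LinearEquiv.symm_apply_eq]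
  refine Eq.trans ?_ (LinearMap.congr_fun
    (exteriorPower.zeroEquiv_naturality (dualLatticeRep b hX w.right)) _).symm
  simp

/-- The inclusion of the constants. -/
def constForms : M ⟶ polyModule b (formModule b M 0) :=
  Rep.ofHom ⟨TensorProduct.mk ℂ (MvPolynomial σ ℂ) _ 1 ∘ₗ (zeroForms b M).toLinearMap,
    fun w => LinearMap.ext fun v => by
      change (1 : MvPolynomial σ ℂ) ⊗ₜ[ℂ] zeroForms b M (M.ρ w v) =
        polyRep b w 1 ⊗ₜ[ℂ] (formModule b M 0).ρ w (zeroForms b M v)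
      rw [polyRep_one, zeroForms_equivariant]⟩

instance [FiniteDimensional ℂ M] (n : ℕ) : FiniteDimensional ℂ (formModule b M n) :=
  inferInstanceAs (FiniteDimensional ℂ (TensorProduct ℂ (⋀[ℂ]^n (σ → ℂ)) M))

variable {M}

lemma isLatticeTrivial_formModule (hM : IsLatticeTrivial M) (n : ℕ) :
    IsLatticeTrivial (formModule b M n) := fun x t => by
  have h : (formModule b M n).ρ (SemidirectProduct.inl x) = LinearMap.id :=
    formModule_ext b fun y v => by
      rw [formModule_formTmul, SemidirectProduct.right_inl, map_one, hM]
      refine congrArg (formTmul b M n · v) ?_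
      exact LinearMap.congr_fun exteriorPower.map_id y
  exact LinearMap.congr_fun h t

lemma invariants_eq_of_isLatticeTrivial {N : Rep.{0} ℂ (LatticeGroup ρ X hX)}
    (hN : IsLatticeTrivial N) :
    N.ρ.invariants = Representation.invariants (G := Γ) (N.ρ.comp SemidirectProduct.inr) := by
  ext v
  refine ⟨fun h γ => h _, fun h w => ?_⟩
  rw [← SemidirectProduct.inl_left_mul_inr_right w, map_mul, Module.End.mul_apply]
  exact (congrArg (N.ρ (SemidirectProduct.inl w.left)) (h w.right)).trans (hN _ _)

variable [Finite Γ] [FiniteDimensional ℂ M]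

/-- The complex of M-valued polynomial forms coresolves M by injectives. Each contributes only its
invariants, which are those of the constant forms, and the forms vanish above the rank of the
lattice. -/
theorem extFinite_and_extChar_of_isLatticeTrivial (hM : IsLatticeTrivial M) :
    ExtFinite (𝟙_ (Rep.{0} ℂ (LatticeGroup ρ X hX))) M ∧
      extChar (𝟙_ (Rep.{0} ℂ (LatticeGroup ρ X hX))) M =
        ∑ n ∈ Finset.range (Fintype.card σ + 1), (-1) ^ n *
          (Module.finrank ℂ (formModule b M n).ρ.invariants : ℤ) := by
  have hΩ (n) := extFinite_polyModule b (isLatticeTrivial_formModule b hM n)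
  obtain ⟨h1, h2⟩ := extFinite_and_extChar_of_resolution
    (𝟙_ (Rep.{0} ℂ (LatticeGroup ρ X hX))) (Fintype.card σ + 1) M
    (fun n => polyModule b (formModule b M n)) (deRhamHom b M) (constForms b M)
    (fun v w h => (zeroForms b M).injective (one_tmul_injective _ h))
    (fun t => ⟨fun ht => by
      obtain ⟨w, hw⟩ := exists_of_deRham_eq_zero (isExteriorData_form b M) t ht
      refine ⟨(zeroForms b M).symm w, Eq.trans ?_ hw⟩
      exact congrArg (fun u => (1 : MvPolynomial σ ℂ) ⊗ₜ[ℂ] u) ((zeroForms b M).apply_symm_apply w),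
    by
      rintro ⟨v, rfl⟩
      exact deRham_one_tmul (W := fun n => formModule b M n) (zeroForms b M v)⟩)
    (fun n => exact_deRham (isExteriorData_form b M) n) (fun n => (hΩ n).1) (fun n hn => by
      have : Subsingleton (⋀[ℂ]^n (σ → ℂ)) := subsingleton_exteriorPower (by simpa using hn)
      have h3 : Subsingleton (TensorProduct ℂ (⋀[ℂ]^n (σ → ℂ)) M) :=
        subsingleton_tensorProduct_of_left
      exact subsingleton_tensorProduct_of_right (V := MvPolynomial σ ℂ)
        (W := TensorProduct ℂ (⋀[ℂ]^n (σ → ℂ)) M))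
  refine ⟨h1, h2.trans (Finset.sum_congr rfl fun n _ => ?_)⟩
  rw [(hΩ n).2]

/-- Each dimension of invariants is the average of a character. Summing over form degrees first
turns the traces on exterior powers into a determinant; γ⁻¹ enters because the forms live on the
dual. -/
theorem extChar_of_isLatticeTrivial {σ : Type} [Fintype σ] (b : Module.Basis σ ℤ X) (hM : IsLatticeTrivial M) :
    (extChar (𝟙_ (Rep.{0} ℂ (LatticeGroup ρ X hX))) M : ℂ) = (Nat.card Γ : ℂ)⁻¹ *
      ∑ᶠ γ : Γ, ((LinearMap.det (1 - latticeLin ρ X hX γ⁻¹) : ℤ) : ℂ) *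
        M.ρ.character (SemidirectProduct.inr γ) := by
  classical
  have := Fintype.ofFinite Γ
  have hcard : (Nat.card Γ : ℂ) ≠ 0 := by simp
  have : Invertible (Nat.card Γ : ℂ) := invertibleOfNonzero hcard
  have h (n) : (Module.finrank ℂ (formModule b M n).ρ.invariants : ℂ) = (Nat.card Γ : ℂ)⁻¹ *
      ∑ γ : Γ, LinearMap.trace ℂ _ (exteriorPower.map n (dualLatticeRep b hX γ)) *
        M.ρ.character (SemidirectProduct.inr γ) := by
    rw [invariants_eq_of_isLatticeTrivial (isLatticeTrivial_formModule b hM n),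
      ← Representation.card_inv_mul_sum_char_eq_finrank]
    congr 1
    refine Finset.sum_congr rfl fun γ _ => ?_
    exact LinearMap.trace_tensorProduct' _ _
  rw [(extFinite_and_extChar_of_isLatticeTrivial b hM).2]
  push_cast
  simp only [h, mul_left_comm _ (Nat.card Γ : ℂ)⁻¹]
  rw [← Finset.mul_sum, finsum_eq_sum_of_fintype]
  congr 1
  simp only [Finset.mul_sum]
  rw [Finset.sum_comm]
  refine Finset.sum_congr rfl fun γ _ => ?_
  rw [← det_one_sub_dualLatticeRep b, ← sum_trace_exteriorPower _ (N := Fintype.card σ + 1) (by simp),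
    Finset.sum_mul]
  simp only [mul_assoc]

end LatticeForms

end

/-! ### Traces of finite-order operators and additivity of the trace. -/

section Traces

open scoped ComplexOrder in
/-- The inverse of a complex matrix of finite order has the conjugate trace. -/
lemma trace_inv_of_pow_eq_one {ι : Type} [Fintype ι] [DecidableEq ι] {A B : Matrix ι ι ℂ}
    (hAB : A * B = 1) {n : ℕ} (hn : 0 < n) (hA : A ^ n = 1) : B.trace = conj A.trace := by
  -- Averaging over the powers of A gives a positive definite A-invariant Hermitian form, so A⁻¹ is
  -- conjugate by H to the conjugate transpose of A.
  let H : Matrix ι ι ℂ := ∑ k ∈ Finset.range n, (A ^ k).conjTranspose * A ^ k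
  have hinv : A.conjTranspose * H * A = H := by
    have h1 : A.conjTranspose * H * A =
        ∑ k ∈ Finset.range n, (A ^ (k + 1)).conjTranspose * A ^ (k + 1) := by
      rw [Finset.mul_sum, Finset.sum_mul]
      refine Finset.sum_congr rfl fun k _ => ?_
      rw [pow_succ, Matrix.conjTranspose_mul]
      simp only [mul_assoc]
    have h2 := Finset.sum_range_succ' (fun k => (A ^ k).conjTranspose * A ^ k) n
    rw [Finset.sum_range_succ, hA, pow_zero] at h2
    rw [h1]
    exact (add_right_cancel h2).symm
  have hpos : H.PosDef := by
    obtain ⟨m, rfl⟩ := Nat.exists_eq_succ_of_ne_zero hn.ne'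
    have h1 : H = ∑ k ∈ Finset.range m, (A ^ (k + 1)).conjTranspose * A ^ (k + 1) + 1 := by
      have h2 := Finset.sum_range_succ' (fun k => (A ^ k).conjTranspose * A ^ k) m
      rw [pow_zero, Matrix.conjTranspose_one, one_mul] at h2
      exact h2
    rw [h1]
    refine Matrix.PosDef.posSemidef_add ?_ Matrix.PosDef.one
    exact Matrix.posSemidef_sum _ fun k _ => Matrix.posSemidef_conjTranspose_mul_self _
  obtain ⟨u, hu⟩ := hpos.isUnit
  have h3 : A.conjTranspose * H = H * B := by
    calc A.conjTranspose * H = A.conjTranspose * H * A * B := by rw [mul_assoc _ A, hAB, mul_one]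
      _ = H * B := by rw [hinv]
  have h4 : B = (↑u⁻¹ : Matrix ι ι ℂ) * (A.conjTranspose * H) := by
    rw [h3, ← hu, Units.inv_mul_cancel_left]
  rw [h4, Matrix.trace_mul_comm, ← hu, mul_assoc, Units.mul_inv, mul_one,
    Matrix.trace_conjTranspose]
  rfl

lemma character_inv_of_isOfFinOrder {G : Type} [Group G] {V : Type} [AddCommGroup V] [Module ℂ V]
    [FiniteDimensional ℂ V] (τ : Representation ℂ G V) {g : G} (hg : IsOfFinOrder g) :
    τ.character g⁻¹ = conj (τ.character g) := by
  let b := Module.finBasis ℂ V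
  change LinearMap.trace ℂ V (τ g⁻¹) = conj (LinearMap.trace ℂ V (τ g))
  rw [LinearMap.trace_eq_matrix_trace ℂ b, LinearMap.trace_eq_matrix_trace ℂ b]
  refine trace_inv_of_pow_eq_one ?_ hg.orderOf_pos ?_
  · rw [← LinearMap.toMatrix_mul, ← map_mul, mul_inv_cancel, map_one, LinearMap.toMatrix_one]
  · rw [LinearMap.toMatrix_pow, ← map_pow, pow_orderOf_eq_one, map_one, LinearMap.toMatrix_one]

/-- The trace is additive in short exact sequences. -/
lemma trace_eq_add_of_exact {A B C : Type} [AddCommGroup A] [Module ℂ A] [FiniteDimensional ℂ A]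
    [AddCommGroup B] [Module ℂ B] [FiniteDimensional ℂ B] [AddCommGroup C] [Module ℂ C]
    [FiniteDimensional ℂ C] {i : A →ₗ[ℂ] B} {p : B →ₗ[ℂ] C} (hi : Function.Injective i)
    (hip : Function.Exact i p) (hp : Function.Surjective p) {f : A →ₗ[ℂ] A} {g : B →ₗ[ℂ] B}
    {h : C →ₗ[ℂ] C} (h1 : i ∘ₗ f = g ∘ₗ i) (h2 : p ∘ₗ g = h ∘ₗ p) :
    LinearMap.trace ℂ B g = LinearMap.trace ℂ A f + LinearMap.trace ℂ C h := by
  obtain ⟨s, hs⟩ := LinearMap.exists_rightInverse_of_surjective p (LinearMap.range_eq_top.2 hp)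
  obtain ⟨r, hr⟩ := LinearMap.exists_leftInverse_of_injective i (LinearMap.ker_eq_bot.2 hi)
  -- The identity of B splits into a part that factors through A and one that factors through C;
  -- cyclicity of the trace moves each to its own space.
  have hid : i ∘ₗ r ∘ₗ (LinearMap.id - s ∘ₗ p) + s ∘ₗ p = LinearMap.id := LinearMap.ext fun b => by
    have h3 : p (b - s (p b)) = 0 := by
      rw [map_sub, ← LinearMap.comp_apply p s, hs, LinearMap.id_apply, sub_self]
    obtain ⟨a, ha⟩ := (hip _).1 h3
    change i (r (b - s (p b))) + s (p b) = b
    rw [← ha, ← LinearMap.comp_apply r i, hr, LinearMap.id_apply, ha, sub_add_cancel]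
  have h3 : g = (g ∘ₗ i) ∘ₗ (r ∘ₗ (LinearMap.id - s ∘ₗ p)) + (g ∘ₗ s) ∘ₗ p := by
    conv_lhs => rw [← LinearMap.comp_id g, ← hid, LinearMap.comp_add]
    rfl
  have h4 : (r ∘ₗ (LinearMap.id - s ∘ₗ p)) ∘ₗ i = LinearMap.id := LinearMap.ext fun a => by
    change r (i a - s (p (i a))) = a
    rw [hip.apply_apply_eq_zero, map_zero, sub_zero, ← LinearMap.comp_apply r i, hr,
      LinearMap.id_apply]
  rw [h3, map_add, LinearMap.trace_comp_comm', LinearMap.trace_comp_comm' p, ← h1,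
    ← LinearMap.comp_assoc, h4, LinearMap.id_comp, ← LinearMap.comp_assoc, h2,
    LinearMap.comp_assoc, hs, LinearMap.comp_id]

end Traces

/-! ### Completeness of the characters of a finite group. -/

section ClassFunctions

lemma isNilpotent_of_eigenspace_eq_bot {V : Type} [AddCommGroup V] [Module ℂ V]
    [FiniteDimensional ℂ V] (T : Module.End ℂ V) (h : ∀ μ ≠ 0, T.eigenspace μ = ⊥) :
    IsNilpotent T := by
  have hroots : ∀ μ ∈ T.charpoly.roots, μ = 0 := fun μ hμ => by
    by_contra hne
    exact (Module.End.hasEigenvalue_iff_isRoot_charpoly T μ).2 (Polynomial.isRoot_of_mem_roots hμ)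
      (h μ hne)
  have h1 := (IsAlgClosed.splits T.charpoly).eq_prod_roots_of_monic (LinearMap.charpoly_monic T)
  rw [Multiset.eq_replicate_card.2 hroots] at h1
  simp only [Multiset.map_replicate, map_zero, sub_zero, Multiset.prod_replicate] at h1
  have h2 := congrArg (Polynomial.aeval T) h1
  rw [LinearMap.aeval_self_charpoly, map_pow, Polynomial.aeval_X] at h2
  exact ⟨_, h2.symm⟩

variable {H : Type} [Group H] [Fintype H] (φ : H → ℂ)

/-- The operator of a function in a representation. -/
def functionOp {V : Type} [AddCommGroup V] [Module ℂ V] (τ : Representation ℂ H V) :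
    Module.End ℂ V := ∑ g, φ g • τ g

variable {φ}

lemma functionOp_commute (hφ : ∀ g h, φ (h * g * h⁻¹) = φ g) {V : Type} [AddCommGroup V]
    [Module ℂ V] (τ : Representation ℂ H V) (h : H) : Commute (functionOp φ τ) (τ h) := by
  change functionOp φ τ * τ h = τ h * functionOp φ τ
  rw [functionOp, Finset.sum_mul, Finset.mul_sum]
  refine Fintype.sum_equiv (MulAut.conj h⁻¹).toEquiv _ _ fun g => ?_
  rw [smul_mul_assoc, mul_smul_comm, ← map_mul, ← map_mul]
  have h1 := hφ g h⁻¹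
  simp only [MulEquiv.toEquiv_eq_coe, EquivLike.coe_coe, MulAut.conj_apply]
  rw [h1]
  congr 2
  simp [mul_assoc]

/-- The operator is equivariant, so the eigenspace is a subrepresentation. Its trace there is μ
times the dimension, and zero by orthogonality. -/
lemma eigenspace_functionOp (hφ : ∀ g h, φ (h * g * h⁻¹) = φ g)
    (horth : ∀ (V : Type) [AddCommGroup V] [Module ℂ V] [FiniteDimensional ℂ V]
      (τ : Representation ℂ H V), ∑ g, φ g * τ.character g = 0)
    {V : Type} [AddCommGroup V] [Module ℂ V] [FiniteDimensional ℂ V] (τ : Representation ℂ H V)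
    {μ : ℂ} (hμ : μ ≠ 0) : (functionOp φ τ).eigenspace μ = ⊥ := by
  let W := (functionOp φ τ).eigenspace μ
  have hW (g : H) : W ≤ W.comap (τ g) :=
    Module.End.mapsTo_genEigenspace_of_comm (functionOp_commute hφ τ g) μ 1
  let υ := τ.subrepresentation W hW
  have h1 : functionOp φ υ = μ • LinearMap.id := LinearMap.ext fun v => Subtype.ext <| by
    refine Eq.trans ?_ (Module.End.mem_eigenspace_iff.1 v.2)
    simp only [functionOp, LinearMap.sum_apply, LinearMap.smul_apply]
    rw [AddSubmonoidClass.coe_finsetSum]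
    rfl
  have h2 : LinearMap.trace ℂ W (functionOp φ υ) = 0 := by
    rw [← horth W υ, functionOp, map_sum]
    exact Finset.sum_congr rfl fun g _ => map_smul _ _ _
  rw [h1, map_smul, LinearMap.trace_id, smul_eq_mul] at h2
  have h3 := (mul_eq_zero.1 h2).resolve_left hμ
  exact Submodule.finrank_eq_zero.1 (by exact_mod_cast h3)

variable (H) in
/-- The left regular representation on functions. -/
def functionRep : Representation ℂ H (H → ℂ) where
  toFun h := LinearMap.funLeft ℂ ℂ fun g => h⁻¹ * g
  map_one' := by
    ext
    simp
  map_mul' g h := by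
    ext
    simp [mul_assoc]

open scoped ComplexOrder in
/-- A class function that is orthogonal to all characters vanishes. -/
theorem eq_zero_of_forall_sum_mul_character (hφ : ∀ g h, φ (h * g * h⁻¹) = φ g)
    (horth : ∀ (V : Type) [AddCommGroup V] [Module ℂ V] [FiniteDimensional ℂ V]
      (τ : Representation ℂ H V), ∑ g, φ g * τ.character g = 0) : φ = 0 := by
  classical
  -- This is the operator of φ in the regular representation: nilpotent by the absence of nonzero
  -- eigenvalues, and normal since φ is a class function. A normal nilpotent matrix is zero, and its
  -- first column of entries φ(g) recovers φ.
  let T : Matrix H H ℂ := Matrix.of fun g h => φ (g * h⁻¹)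
  have hT : Matrix.toLin' T = functionOp φ (functionRep H) := LinearMap.ext fun v => by
    ext g
    rw [Matrix.toLin'_apply, Matrix.mulVec, functionOp, LinearMap.sum_apply, Finset.sum_apply]
    refine Fintype.sum_equiv ((Equiv.inv H).trans (Equiv.mulLeft g)) _ _ fun h => ?_
    simp [T, functionRep, LinearMap.funLeft_apply]
  have hnil : IsNilpotent T := by
    rw [← Matrix.isNilpotent_toLin'_iff, hT]
    exact isNilpotent_of_eigenspace_eq_bot _ fun μ hμ => eigenspace_functionOp hφ horth _ hμ
  have hcomm : Commute T.conjTranspose T := by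
    change T.conjTranspose * T = T * T.conjTranspose
    ext g h
    rw [Matrix.mul_apply, Matrix.mul_apply]
    refine Fintype.sum_equiv
      (((Equiv.inv H).trans (Equiv.mulRight h)).trans (Equiv.mulLeft g)) _ _ fun k => ?_
    simp only [T, Matrix.conjTranspose_apply, Matrix.of_apply, Equiv.trans_apply, Equiv.inv_apply,
      Equiv.coe_mulLeft, Equiv.coe_mulRight]
    have h1 : φ (h * (g * (k⁻¹ * h))⁻¹) = φ (k * g⁻¹) := by
      congr 1
      group
    have h2 : φ (g * (g * (k⁻¹ * h))⁻¹) = φ (k * h⁻¹) := by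
      rw [← hφ (k * h⁻¹) (g * h⁻¹)]
      congr 1
      group
    rw [h1, h2, mul_comm]
  have h1 := Matrix.isNilpotent_trace_of_isNilpotent (hcomm.isNilpotent_mul_left hnil)
  have h2 := Matrix.trace_conjTranspose_mul_self_eq_zero_iff.1 h1.eq_zero
  funext g
  have h3 := congrFun (congrFun h2 g) 1
  simpa [T] using h3

end ClassFunctions

/-! ### Counting the X-conjugacy classes over γ. -/

section LatticeClasses

variable {Γ : Type} [Group Γ] {E : Type} [AddCommGroup E] [Module ℝ E]
  {ρ : Representation ℝ Γ E} {X : Submodule ℤ E} {hX : ∀ γ, ∀ x ∈ X, ρ γ x ∈ X}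

lemma toAdd_conj_inl_left (x : Multiplicative X) (w : LatticeGroup ρ X hX) :
    (SemidirectProduct.inl x * w * (SemidirectProduct.inl x)⁻¹).left.toAdd =
      w.left.toAdd + (1 - latticeLin ρ X hX w.right) x.toAdd := by
  apply Subtype.ext
  rw [← map_inv]
  change (((x * latticeAction ρ X hX 1 w.left) *
    latticeAction ρ X hX (1 * w.right) x⁻¹).toAdd : E) = (w.left.toAdd : E) +
      ((x.toAdd : E) - ρ w.right (x.toAdd : E))
  rw [map_one, one_mul, toAdd_mul, toAdd_mul, map_inv, toAdd_inv, Submodule.coe_add,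
    Submodule.coe_add, Submodule.coe_neg, sub_eq_add_neg, ← add_assoc, add_comm (w.left.toAdd : E)]
  rfl

lemma conj_inl_right (x : Multiplicative X) (w : LatticeGroup ρ X hX) :
    (SemidirectProduct.inl x * w * (SemidirectProduct.inl x)⁻¹).right = w.right := by
  simp

/-- Conjugating xγ by a lattice vector y replaces x by x + (1 - γ)y. -/
lemma mem_latticeClass_iff {w z : LatticeGroup ρ X hX} : z ∈ latticeClass w ↔
    z.right = w.right ∧
      z.left.toAdd - w.left.toAdd ∈ LinearMap.range (1 - latticeLin ρ X hX w.right) := by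
  constructor
  · rintro ⟨x, rfl⟩
    refine ⟨conj_inl_right x w, x.toAdd, ?_⟩
    dsimp only
    rw [toAdd_conj_inl_left, add_sub_cancel_left]
  · rintro ⟨h1, x, hx⟩
    refine ⟨Multiplicative.ofAdd x, SemidirectProduct.ext ?_ ?_⟩
    · refine Multiplicative.toAdd.injective ((toAdd_conj_inl_left _ w).trans ?_)
      rw [toAdd_ofAdd, hx, add_sub_cancel]
    · rw [h1]
      exact conj_inl_right _ w

variable (ρ X hX) in
/-- The relation of conjugacy under the lattice. -/
def latticeSetoid : Setoid (LatticeGroup ρ X hX) where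
  r w z := z ∈ latticeClass w
  iseqv :=
    { refl := fun w => ⟨1, by simp⟩
      symm := by
        rintro w _ ⟨x, rfl⟩
        exact ⟨x⁻¹, by simp [mul_assoc]⟩
      trans := by
        rintro w _ _ ⟨x, rfl⟩ ⟨y, rfl⟩
        exact ⟨y * x, by simp [mul_assoc]⟩ }

variable (ρ X hX) in
/-- The set of conjugacy classes under the lattice. -/
abbrev LatticeClasses : Type := Quotient (latticeSetoid ρ X hX)

/-- The class of an element under lattice conjugation. -/
def classMk (w : LatticeGroup ρ X hX) : LatticeClasses ρ X hX := Quotient.mk _ w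

lemma classMk_eq_iff {w z : LatticeGroup ρ X hX} : classMk w = classMk z ↔ z ∈ latticeClass w :=
  Quotient.eq (r := latticeSetoid ρ X hX)

lemma classMk_out (q : LatticeClasses ρ X hX) : classMk q.out = q := Quotient.out_eq q

lemma mem_latticeClass_self (w : LatticeGroup ρ X hX) : w ∈ latticeClass w := ⟨1, by simp⟩

/-- The component in `Γ` of a class. -/
def classRight (q : LatticeClasses ρ X hX) : Γ :=
  Quotient.lift (s := latticeSetoid ρ X hX) (fun w => w.right)
    (fun _ _ h => (mem_latticeClass_iff.1 h).1.symm) q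

lemma classRight_classMk (w : LatticeGroup ρ X hX) : classRight (classMk w) = w.right := rfl

lemma right_out (q : LatticeClasses ρ X hX) : q.out.right = classRight q := by
  rw [← classRight_classMk, classMk_out]

/-- The class of `x γ`, for `x` modulo the image of `1 - γ`. -/
def fibreMap (γ : Γ) (c : X ⧸ LinearMap.range (1 - latticeLin ρ X hX γ)) :
    {q : LatticeClasses ρ X hX // classRight q = γ} :=
  Quotient.lift (s := Submodule.quotientRel _)
    (fun x : X => ⟨classMk (⟨Multiplicative.ofAdd x, γ⟩ : LatticeGroup ρ X hX), rfl⟩)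
      (fun x y h => Subtype.ext <| classMk_eq_iff.2 <| mem_latticeClass_iff.2 ⟨rfl, by
        rw [← Submodule.neg_mem_iff, neg_sub]
        exact (Submodule.quotientRel_def _).1 h⟩) c

lemma bijective_fibreMap (γ : Γ) : Function.Bijective (fibreMap (ρ := ρ) (hX := hX) γ) := by
  constructor
  · intro c d h
    induction c, d using Quotient.inductionOn₂ with
    | h x y =>
      have h1 := (mem_latticeClass_iff.1 (classMk_eq_iff.1 (congrArg Subtype.val h))).2
      rw [← Submodule.neg_mem_iff, neg_sub] at h1
      exact (Submodule.Quotient.eq _).2 h1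
  · rintro ⟨q, hq⟩
    refine ⟨Submodule.Quotient.mk q.out.left.toAdd, Subtype.ext ?_⟩
    refine Eq.trans ?_ (classMk_out q)
    subst hq
    exact congrArg classMk (SemidirectProduct.ext rfl (right_out q).symm)

/-- The determinant of `1 - γ` on the lattice. -/
def ellDet (hX : ∀ γ, ∀ x ∈ X, ρ γ x ∈ X) (γ : Γ) : ℤ := LinearMap.det (1 - latticeLin ρ X hX γ)

section Card

variable [Module.Free ℤ X] [Module.Finite ℤ X]

lemma injective_of_ellDet_ne_zero {γ : Γ} (h : ellDet hX γ ≠ 0) :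
    Function.Injective (1 - latticeLin ρ X hX γ : X →ₗ[ℤ] X) := by
  classical
  let b := Module.Free.chooseBasis ℤ X
  rw [injective_iff_map_eq_zero]
  intro x hx
  by_contra hne
  refine h ?_
  rw [ellDet, ← LinearMap.det_toMatrix b, ← Matrix.exists_mulVec_eq_zero_iff]
  refine ⟨b.repr x, fun h0 => hne (b.repr.map_eq_zero_iff.1 (DFunLike.coe_injective h0)), ?_⟩
  rw [LinearMap.toMatrix_mulVec_repr, hx, map_zero]
  rfl

lemma exists_of_ellDet_eq_zero {γ : Γ} (h : ellDet hX γ = 0) :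
    ∃ x : X, x ≠ 0 ∧ latticeLin ρ X hX γ x = x := by
  classical
  let b := Module.Free.chooseBasis ℤ X
  rw [ellDet, ← LinearMap.det_toMatrix b, ← Matrix.exists_mulVec_eq_zero_iff] at h
  obtain ⟨v, hv, h⟩ := h
  refine ⟨b.equivFun.symm v, fun h0 => hv (b.equivFun.symm.map_eq_zero_iff.1 h0), ?_⟩
  have h1 := LinearMap.toMatrix_mulVec_repr b b (1 - latticeLin ρ X hX γ) (b.equivFun.symm v)
  have h2 : (b.repr (b.equivFun.symm v) : _ → ℤ) = v := b.equivFun.apply_symm_apply v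
  rw [h2, h] at h1
  have h3 : (1 - latticeLin ρ X hX γ) (b.equivFun.symm v) = 0 :=
    b.repr.map_eq_zero_iff.1 (DFunLike.coe_injective h1.symm)
  exact (sub_eq_zero.1 h3).symm

/-- The index of the image of an injective endomorphism of a lattice is the absolute value of its
determinant. -/
lemma card_quotient_range {γ : Γ} (h : ellDet hX γ ≠ 0) :
    Nat.card (X ⧸ LinearMap.range (1 - latticeLin ρ X hX γ)) = (ellDet hX γ).natAbs := by
  have h1 := Submodule.natAbs_det_equiv (LinearMap.range (1 - latticeLin ρ X hX γ))
    (LinearEquiv.ofInjective _ (injective_of_ellDet_ne_zero h))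
  refine h1.symm.trans ?_
  rw [ellDet]
  congr 2

/-- The elliptic classes. -/
def ellClasses (ρ : Representation ℝ Γ E) (X : Submodule ℤ E) (hX : ∀ γ, ∀ x ∈ X, ρ γ x ∈ X) :
    Set (LatticeClasses ρ X hX) := {q | ellDet hX (classRight q) ≠ 0}

lemma card_fibre {γ : Γ} (h : ellDet hX γ ≠ 0) :
    Nat.card {q : LatticeClasses ρ X hX // classRight q = γ} = (ellDet hX γ).natAbs := by
  rw [← Nat.card_congr (Equiv.ofBijective _ (bijective_fibreMap γ)), card_quotient_range h]

lemma finite_ellClasses [Finite Γ] : (ellClasses ρ X hX).Finite := by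
  have h1 : ellClasses ρ X hX ⊆ ⋃ γ ∈ {γ | ellDet hX γ ≠ 0}, {q | classRight q = γ} := fun q hq => by
    simp only [Set.mem_iUnion]
    exact ⟨_, hq, rfl⟩
  refine Set.Finite.subset (Set.Finite.biUnion (Set.toFinite _) fun γ hγ => ?_) h1
  refine Set.finite_coe_iff.1 (Nat.finite_of_card_ne_zero ?_ : Finite {q : LatticeClasses ρ X hX // classRight q = γ})
  rw [card_fibre hγ]
  exact Int.natAbs_ne_zero.2 hγ

end Card

end LatticeClasses

/-- If `M` has finite order, then `det (1 - M)` is nonnegative. -/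
lemma det_one_sub_nonneg {σ : Type} [Fintype σ] [DecidableEq σ] (M : Matrix σ σ ℝ) {n : ℕ}
    (hn : 0 < n) (hM : M ^ n = 1) : 0 ≤ (1 - M).det := by
  by_contra! hlt
  -- The function t ↦ det(1 - tM) is 1 at t = 0. If it were negative at t = 1 it would vanish at
  -- some t in [0, 1), and tM would have a nonzero fixed vector; its n-th power tⁿ would then fix
  -- that vector, which is absurd.
  have hcont : Continuous fun t : ℝ => (1 - t • M).det :=
    Continuous.matrix_det (continuous_const.sub (continuous_id.smul continuous_const))
  have h0 : (0 : ℝ) ∈ Set.Icc ((1 - (1 : ℝ) • M).det) ((1 - (0 : ℝ) • M).det) := by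
    rw [one_smul, zero_smul, sub_zero, Matrix.det_one]
    exact ⟨hlt.le, zero_le_one⟩
  obtain ⟨t, ⟨ht0, ht1⟩, ht⟩ := intermediate_value_Icc' (zero_le_one (α := ℝ)) hcont.continuousOn h0
  have ht : (1 - t • M).det = 0 := ht
  have ht1' : t < 1 := lt_of_le_of_ne ht1 fun h => by
    rw [h, one_smul] at ht
    exact hlt.ne ht
  obtain ⟨v, hv, h⟩ := Matrix.exists_mulVec_eq_zero_iff.2 ht
  rw [Matrix.sub_mulVec, Matrix.one_mulVec, sub_eq_zero] at h
  have hpow : ∀ k : ℕ, v = ((t • M) ^ k).mulVec v := by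
    intro k
    induction k with
    | zero => simp
    | succ k ih => rw [pow_succ, ← Matrix.mulVec_mulVec, ← h, ← ih]
  have h1 := hpow n
  rw [smul_pow, hM, Matrix.smul_mulVec, Matrix.one_mulVec] at h1
  have h2 : (1 - t ^ n) • v = 0 := by rw [sub_smul, one_smul, ← h1, sub_self]
  rcases smul_eq_zero.1 h2 with h3 | h3
  · exact (pow_lt_one₀ ht0 ht1' hn.ne').ne (sub_eq_zero.1 h3).symm
  · exact hv h3

/-! ### The affine action and point stabilizers. -/

section Affine

variable {Γ : Type} [Group Γ] {E : Type} [AddCommGroup E] [Module ℝ E]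
  {ρ : Representation ℝ Γ E} {X : Submodule ℤ E} {hX : ∀ γ, ∀ x ∈ X, ρ γ x ∈ X}

lemma affineAct_mul (w z : LatticeGroup ρ X hX) (e : E) :
    affineAct (w * z) e = affineAct w (affineAct z e) := by
  change (((w.left * latticeAction ρ X hX w.right z.left).toAdd : X) : E) + ρ (w.right * z.right) e =
    (w.left.toAdd : E) + ρ w.right ((z.left.toAdd : E) + ρ z.right e)
  rw [map_add, map_mul ρ, Module.End.mul_apply, toAdd_mul, Submodule.coe_add, add_assoc]
  rfl

lemma affineAct_one (e : E) : affineAct (1 : LatticeGroup ρ X hX) e = e := by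
  change (0 : E) + ρ 1 e = e
  simp

/-- The stabilizer of a point. -/
def pointStabilizer (ρ : Representation ℝ Γ E) (X : Submodule ℤ E)
    (hX : ∀ γ, ∀ x ∈ X, ρ γ x ∈ X) (e : E) : Subgroup (LatticeGroup ρ X hX) where
  carrier := {w | affineAct w e = e}
  mul_mem' {w z} hw hz := by
    change affineAct (w * z) e = e
    rw [affineAct_mul, show affineAct z e = e from hz, show affineAct w e = e from hw]
  one_mem' := affineAct_one e
  inv_mem' {w} hw := by
    change affineAct w⁻¹ e = e
    conv_lhs => rw [← show affineAct w e = e from hw]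
    rw [← affineAct_mul, inv_mul_cancel, affineAct_one]

/-- An element xγ that fixes e has x = e - γe, so γ determines it. -/
lemma injective_right_pointStabilizer (e : E) :
    Function.Injective fun w : pointStabilizer ρ X hX e => w.1.right := by
  rintro ⟨w, hw⟩ ⟨z, hz⟩ h
  replace h : w.right = z.right := h
  have hw : (w.left.toAdd : E) + ρ w.right e = e := hw
  have hz : (z.left.toAdd : E) + ρ z.right e = e := hz
  refine Subtype.ext (SemidirectProduct.ext (Multiplicative.toAdd.injective (Subtype.ext ?_)) h)
  rw [← h] at hz
  exact add_right_cancel (hw.trans hz.symm)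

instance finite_pointStabilizer [Finite Γ] (e : E) : Finite (pointStabilizer ρ X hX e) :=
  Finite.of_injective _ (injective_right_pointStabilizer e)

end Affine

/-! ### Ellipticity as nonvanishing of det(1 - γ); the σ-algebra. -/

section Elliptic

variable {Γ : Type} [Group Γ]
    {E : Type} [NormedAddCommGroup E] [NormedSpace ℝ E] [FiniteDimensional ℝ E]
    {ρ : Representation ℝ Γ E} {X : Submodule ℤ E} [DiscreteTopology X] [IsZLattice ℝ X]
    {hX : ∀ γ, ∀ x ∈ X, ρ γ x ∈ X}

lemma toMatrix_ofZLatticeBasis {σ : Type} [Fintype σ] [DecidableEq σ] (b : Module.Basis σ ℤ X)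
    (γ : Γ) : LinearMap.toMatrix (b.ofZLatticeBasis ℝ X) (b.ofZLatticeBasis ℝ X) (ρ γ) =
      (LinearMap.toMatrix b b (latticeLin ρ X hX γ)).map (Int.castRingHom ℝ) := by
  ext i j
  rw [LinearMap.toMatrix_apply, Matrix.map_apply, LinearMap.toMatrix_apply,
    Module.Basis.ofZLatticeBasis_apply]
  exact b.ofZLatticeBasis_repr_apply ℝ X (latticeLin ρ X hX γ (b j)) i

variable (hX) in
lemma det_one_sub_eq_ellDet (γ : Γ) : LinearMap.det (1 - ρ γ) = (ellDet hX γ : ℝ) := by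
  classical
  let b := Module.finBasis ℤ X
  rw [← LinearMap.det_toMatrix (b.ofZLatticeBasis ℝ X), map_sub, LinearMap.toMatrix_one,
    toMatrix_ofZLatticeBasis (hX := hX) b γ, ellDet, ← LinearMap.det_toMatrix b, map_sub,
    LinearMap.toMatrix_one]
  refine Eq.trans ?_ (RingHom.map_det (Int.castRingHom ℝ) _).symm
  congr 1
  ext i j
  simp [Matrix.one_apply, apply_ite]

variable (hX) in
lemma ellDet_nonneg [Finite Γ] (γ : Γ) : 0 ≤ ellDet hX γ := by
  classical
  let b := Module.finBasis ℤ X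
  have h := det_one_sub_nonneg (LinearMap.toMatrix (b.ofZLatticeBasis ℝ X)
    (b.ofZLatticeBasis ℝ X) (ρ γ)) (orderOf_pos γ) (by
      rw [LinearMap.toMatrix_pow, ← map_pow, pow_orderOf_eq_one, map_one, LinearMap.toMatrix_one])
  rw [← LinearMap.toMatrix_one (b.ofZLatticeBasis ℝ X), ← map_sub, LinearMap.det_toMatrix,
    det_one_sub_eq_ellDet hX] at h
  exact_mod_cast h

variable (hX) in
-- From 1 - γ⁻¹ = -γ⁻¹(1 - γ) the two determinants agree up to sign, and neither is negative.
lemma ellDet_inv [Finite Γ] (γ : Γ) : ellDet hX γ⁻¹ = ellDet hX γ := by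
  have h1 : (1 - latticeLin ρ X hX γ⁻¹) =
      latticeLin ρ X hX γ⁻¹ ∘ₗ (-(1 - latticeLin ρ X hX γ)) := by
    have h2 : latticeLin ρ X hX γ⁻¹ ∘ₗ latticeLin ρ X hX γ = 1 := by
      rw [← latticeLin_mul, inv_mul_cancel, latticeLin_one]
      rfl
    rw [neg_sub, LinearMap.comp_sub, h2]
    rfl
  have h3 : IsUnit (LinearMap.det (latticeLin ρ X hX γ⁻¹)) := by
    refine IsUnit.of_mul_eq_one (LinearMap.det (latticeLin ρ X hX γ)) ?_
    rw [← LinearMap.det_comp, ← latticeLin_mul, inv_mul_cancel, latticeLin_one, LinearMap.det_id]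
  have h4 : (ellDet hX γ⁻¹).natAbs = (ellDet hX γ).natAbs := by
    rw [ellDet, h1, LinearMap.det_comp, Int.natAbs_mul, Int.isUnit_iff_natAbs_eq.1 h3, one_mul,
      ← neg_one_smul ℤ, LinearMap.det_smul, Int.natAbs_mul, Int.natAbs_pow]
    simp [ellDet]
  have h5 := ellDet_nonneg hX γ⁻¹
  have h6 := ellDet_nonneg hX γ
  omega

lemma fixpoint_unique {w : LatticeGroup ρ X hX} (h : ellDet hX w.right ≠ 0) {e e' : E}
    (he : affineAct w e = e) (he' : affineAct w e' = e') : e' = e := by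
  have hdet : LinearMap.det (1 - ρ w.right) ≠ 0 := by
    rw [det_one_sub_eq_ellDet hX]
    exact_mod_cast h
  have hinj := (LinearMap.equivOfDetNeZero _ hdet).injective
  refine hinj ?_
  change e' - ρ w.right e' = e - ρ w.right e
  have he : (w.left.toAdd : E) + ρ w.right e = e := he
  have he' : (w.left.toAdd : E) + ρ w.right e' = e' := he'
  exact (eq_sub_of_add_eq he').symm.trans (eq_sub_of_add_eq he)

/-- If the determinant vanishes, γ fixes a nonzero lattice vector and the whole line through e in
its direction is fixed. Otherwise 1 - γ is injective and the fixpoint is unique. -/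
lemma isIsolatedFixpoint_iff {w : LatticeGroup ρ X hX} {e : E} :
    IsIsolatedFixpoint w e ↔ affineAct w e = e ∧ ellDet hX w.right ≠ 0 := by
  refine ⟨fun ⟨h1, N, hN, h2⟩ => ⟨h1, fun h0 => ?_⟩, fun ⟨h1, h2⟩ => ⟨h1, Set.univ,
    Filter.univ_mem, fun e' _ he' => fixpoint_unique h2 h1 he'⟩⟩
  obtain ⟨x, hx, hfix⟩ := exists_of_ellDet_eq_zero h0
  have hfix : ρ w.right (x : E) = x := congrArg Subtype.val hfix
  have hx' : (x : E) ≠ 0 := fun h => hx (Subtype.ext h)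
  have hcont : Filter.Tendsto (fun t : ℝ => e + t • (x : E)) (𝓝[≠] 0) (𝓝 e) := by
    have : Continuous fun t : ℝ => e + t • (x : E) := by fun_prop
    have h3 := this.tendsto 0
    simp only [zero_smul, add_zero] at h3
    exact h3.mono_left nhdsWithin_le_nhds
  obtain ⟨t, htN, ht⟩ := ((hcont.eventually hN).and self_mem_nhdsWithin).exists
  have h4 := h2 _ htN (by
    change (w.left.toAdd : E) + ρ w.right (e + t • (x : E)) = e + t • (x : E)
    rw [map_add, map_smul, hfix, ← add_assoc]
    congr 1)
  rw [add_eq_left, smul_eq_zero] at h4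
  exact h4.elim ht hx'

lemma isElliptic_iff {w : LatticeGroup ρ X hX} : IsElliptic w ↔ ellDet hX w.right ≠ 0 := by
  refine ⟨fun ⟨e, he⟩ => (isIsolatedFixpoint_iff.1 he).2, fun h => ?_⟩
  have hdet : LinearMap.det (1 - ρ w.right) ≠ 0 := by
    rw [det_one_sub_eq_ellDet hX]
    exact_mod_cast h
  obtain ⟨e, he⟩ := (LinearMap.equivOfDetNeZero _ hdet).surjective (w.left.toAdd : E)
  refine ⟨e, isIsolatedFixpoint_iff.2 ⟨?_, h⟩⟩
  have he : e - ρ w.right e = (w.left.toAdd : E) := he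
  change (w.left.toAdd : E) + ρ w.right e = e
  rw [← he, sub_add_cancel]

/-- The element lies in the stabilizer of its fixpoint, which is finite. -/
lemma isOfFinOrder_of_isElliptic [Finite Γ] {w : LatticeGroup ρ X hX}
    (h : ellDet hX w.right ≠ 0) : IsOfFinOrder w := by
  obtain ⟨e, he⟩ := isElliptic_iff.2 h
  exact MonoidHom.isOfFinOrder (Subgroup.subtype _)
    (isOfFinOrder_of_finite (⟨w, he.1⟩ : pointStabilizer ρ X hX e))

instance [Finite Γ] : Countable (LatticeGroup ρ X hX) := by
  have : Countable X := (Module.finBasis ℤ X).equivFun.toEquiv.countable_iff.2 inferInstance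
  have : Countable (Multiplicative X) := this
  exact (SemidirectProduct.equivProd).countable_iff.2 inferInstance

/-- The sets L_w partition a countable group, so the σ-algebra consists of all unions of them. -/
lemma measurableSet_iff [Finite Γ] {A : Set (LatticeGroup ρ X hX)} :
    MeasurableSet A ↔ ∀ w ∈ A, latticeClass w ⊆ A := by
  constructor
  · intro h
    have h' : ∀ w z, z ∈ latticeClass w → (w ∈ A ↔ z ∈ A) := by
      induction A, h using MeasurableSpace.generateFrom_induction with
      | hC t ht =>
        obtain ⟨v, rfl⟩ := ht
        intro w z hz
        simp only [← classMk_eq_iff] at hz ⊢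
        rw [hz]
      | empty => simp
      | compl t _ ih => exact fun w z hz => not_congr (ih w z hz)
      | iUnion s _ ih =>
        intro w z hz
        simp only [Set.mem_iUnion]
        exact exists_congr fun n => ih n w z hz
    exact fun w hw z hz => (h' w z hz).1 hw
  · intro h
    have : A = ⋃ w ∈ A, latticeClass w :=
      Set.Subset.antisymm (fun w hw => Set.mem_biUnion hw (mem_latticeClass_self w))
        (Set.iUnion₂_subset h)
    rw [this]
    exact MeasurableSet.biUnion (Set.to_countable _) fun w _ =>
      MeasurableSpace.measurableSet_generateFrom ⟨w, rfl⟩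

lemma measurable_of_forall_latticeClass [Finite Γ] {β : Type} [MeasurableSpace β]
    {f : LatticeGroup ρ X hX → β} (h : ∀ w, ∀ z ∈ latticeClass w, f z = f w) : Measurable f :=
  fun s _ => measurableSet_iff.2 fun w hw z hz => by
    rw [Set.mem_preimage, h w z hz]
    exact hw

end Elliptic

section

open scoped MonoidalCategory

/-! ### Nakayama's lemma for the augmentation ideal. -/

section Counit

variable (X : Type) [AddCommGroup X]

/-- The augmentation of the group algebra of a lattice. -/
def counit : MonoidAlgebra ℂ (Multiplicative X) →ₐ[ℂ] ℂ :=
  MonoidAlgebra.lift ℂ ℂ (Multiplicative X) 1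

lemma counit_of (x : Multiplicative X) : counit X (MonoidAlgebra.of ℂ _ x) = 1 := by
  simp [counit]

lemma counit_single (x : Multiplicative X) (r : ℂ) : counit X (MonoidAlgebra.single x r) = r := by
  simp [counit]

lemma counit_eq_zero {a : MonoidAlgebra ℂ (Multiplicative X)} (ha : a ∈ augIdeal X) :
    counit X a = 0 := by
  have h : augIdeal X ≤ RingHom.ker (counit X) := Ideal.span_le.2 <| by
    rintro _ ⟨x, rfl⟩
    change counit X (MonoidAlgebra.of ℂ _ x - 1) = 0
    rw [map_sub, counit_of, map_one, sub_self]
  exact h ha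

variable {X}

/-- If the elements `x v - v` span, then an element of augmentation `1` acts by zero. -/
lemma exists_counit_eq_one_of_span {V : Type} [AddCommGroup V] [Module ℂ V] [FiniteDimensional ℂ V]
    (τ : Representation ℂ (Multiplicative X) V)
    (h : Submodule.span ℂ {u | ∃ x v, τ x v - v = u} = ⊤) :
    ∃ z, counit X z = 1 ∧ τ.asAlgebraHom z = 0 := by
  have hfin : Module.Finite (MonoidAlgebra ℂ (Multiplicative X)) τ.asModule :=
    Module.Finite.of_restrictScalars_finite ℂ _ _
  have hle : (⊤ : Submodule (MonoidAlgebra ℂ (Multiplicative X)) τ.asModule) ≤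
      augIdeal X • (⊤ : Submodule (MonoidAlgebra ℂ (Multiplicative X)) τ.asModule) := fun m _ => by
    have key : ∀ u ∈ Submodule.span ℂ {u | ∃ x v, τ x v - v = u}, τ.asModuleEquiv.symm u ∈
        augIdeal X • (⊤ : Submodule (MonoidAlgebra ℂ (Multiplicative X)) τ.asModule) := fun u hu => by
      induction hu using Submodule.span_induction with
      | mem u hu =>
        obtain ⟨x, v, rfl⟩ := hu
        have h1 : τ.asModuleEquiv.symm (τ x v - v) =
            (MonoidAlgebra.of ℂ _ x - 1) • τ.asModuleEquiv.symm v := by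
          apply τ.asModuleEquiv.injective
          rw [Representation.asModuleEquiv_map_smul, LinearEquiv.apply_symm_apply,
            LinearEquiv.apply_symm_apply, map_sub τ.asAlgebraHom, map_one,
            Representation.asAlgebraHom_of]
          rfl
        rw [h1]
        exact Submodule.smul_mem_smul (of_sub_one_mem_augIdeal x) trivial
      | zero =>
        rw [map_zero]
        exact Submodule.zero_mem _
      | add u v _ _ hu hv =>
        rw [map_add]
        exact Submodule.add_mem _ hu hv
      | smul r u _ hu =>
        have h1 : τ.asModuleEquiv.symm (r • u) =
            (algebraMap ℂ (MonoidAlgebra ℂ (Multiplicative X)) r) • τ.asModuleEquiv.symm u := by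
          apply τ.asModuleEquiv.injective
          rw [Representation.asModuleEquiv_map_smul, AlgHom.commutes]
          simp [Algebra.algebraMap_eq_smul_one]
        rw [h1]
        exact Submodule.smul_mem _ _ hu
    have h1 := key (τ.asModuleEquiv m) (h ▸ Submodule.mem_top)
    rwa [LinearEquiv.symm_apply_apply] at h1
  -- By `hle` the module equals its product with the augmentation ideal; Nakayama then gives z in 1
  -- plus the ideal that annihilates it.
  obtain ⟨z, hz1, hz2⟩ := Submodule.exists_sub_one_mem_and_smul_eq_zero_of_fg_of_le_smul
    (augIdeal X) ⊤ hfin.fg_top hle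
  refine ⟨z, ?_, LinearMap.ext fun v => ?_⟩
  · have h1 := counit_eq_zero X hz1
    rwa [map_sub, map_one, sub_eq_zero] at h1
  · have h1 := congrArg τ.asModuleEquiv (hz2 (τ.asModuleEquiv.symm v) trivial)
    rw [Representation.asModuleEquiv_map_smul, LinearEquiv.apply_symm_apply, map_zero] at h1
    exact h1

end Counit

/-! ### Vanishing of Ext from a central average. -/

section Central

variable {Γ : Type} [Group Γ] {E : Type} [AddCommGroup E] [Module ℝ E]
  {ρ : Representation ℝ Γ E} {X : Submodule ℤ E} {hX : ∀ γ, ∀ x ∈ X, ρ γ x ∈ X}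

variable (ρ X hX) in
/-- The inclusion of the group algebra of the lattice. -/
def inlAlgHom : MonoidAlgebra ℂ (Multiplicative X) →ₐ[ℂ] MonoidAlgebra ℂ (LatticeGroup ρ X hX) :=
  MonoidAlgebra.mapDomainAlgHom ℂ ℂ SemidirectProduct.inl

lemma inlAlgHom_single (x : Multiplicative X) (r : ℂ) :
    inlAlgHom ρ X hX (MonoidAlgebra.single x r) =
      MonoidAlgebra.single (SemidirectProduct.inl x) r := by
  simp [inlAlgHom]

lemma asAlgebraHom_inlAlgHom {V : Type} [AddCommGroup V] [Module ℂ V]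
    (τ : Representation ℂ (LatticeGroup ρ X hX) V) (z : MonoidAlgebra ℂ (Multiplicative X)) :
    τ.asAlgebraHom (inlAlgHom ρ X hX z) =
      Representation.asAlgebraHom (G := Multiplicative X) (τ.comp SemidirectProduct.inl) z := by
  induction z using MonoidAlgebra.induction_linear with
  | zero => simp
  | add a b ha hb => rw [map_add, map_add, map_add, ha, hb]
  | single x r =>
    rw [inlAlgHom_single, Representation.asAlgebraHom_single, Representation.asAlgebraHom_single]
    rfl

lemma inlAlgHom_commute (x : Multiplicative X) (z : MonoidAlgebra ℂ (Multiplicative X)) :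
    MonoidAlgebra.of ℂ (LatticeGroup ρ X hX) (SemidirectProduct.inl x) * inlAlgHom ρ X hX z =
      inlAlgHom ρ X hX z * MonoidAlgebra.of ℂ (LatticeGroup ρ X hX) (SemidirectProduct.inl x) := by
  have h : MonoidAlgebra.of ℂ (LatticeGroup ρ X hX) (SemidirectProduct.inl x) =
      inlAlgHom ρ X hX (MonoidAlgebra.of ℂ _ x) := (inlAlgHom_single x 1).symm
  rw [h, ← map_mul, mul_comm, map_mul]

variable [Fintype Γ]

/-- The average of the conjugates of an element of the group algebra of the lattice. -/
def centralAverage (z : MonoidAlgebra ℂ (Multiplicative X)) :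
    MonoidAlgebra ℂ (LatticeGroup ρ X hX) :=
  (Fintype.card Γ : ℂ)⁻¹ • ∑ γ : Γ, MonoidAlgebra.of ℂ _ (SemidirectProduct.inr γ) * inlAlgHom ρ X hX z *
    MonoidAlgebra.of ℂ _ (SemidirectProduct.inr γ⁻¹)

/-- Conjugation by Γ permutes the summands, and the group algebra of the lattice is commutative and
normalized by Γ. -/
lemma centralAverage_commute (z : MonoidAlgebra ℂ (Multiplicative X)) (g : LatticeGroup ρ X hX) :
    MonoidAlgebra.of ℂ _ g * centralAverage z = centralAverage z * MonoidAlgebra.of ℂ _ g := by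
  have hinr (δ : Γ) : MonoidAlgebra.of ℂ (LatticeGroup ρ X hX) (SemidirectProduct.inr δ) *
      centralAverage z = centralAverage z * MonoidAlgebra.of ℂ _ (SemidirectProduct.inr δ) := by
    rw [centralAverage, mul_smul_comm, smul_mul_assoc, Finset.mul_sum, Finset.sum_mul]
    congr 1
    refine Fintype.sum_equiv (Equiv.mulLeft δ) _ _ fun γ => ?_
    rw [← mul_assoc, ← mul_assoc, ← map_mul, ← map_mul, Equiv.coe_mulLeft, mul_assoc _ _
      (MonoidAlgebra.of ℂ (LatticeGroup ρ X hX) (SemidirectProduct.inr δ)), ← map_mul, ← map_mul,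
      mul_inv_rev, inv_mul_cancel_right]
  have hinl (x : Multiplicative X) : MonoidAlgebra.of ℂ (LatticeGroup ρ X hX)
      (SemidirectProduct.inl x) * centralAverage z =
        centralAverage z * MonoidAlgebra.of ℂ _ (SemidirectProduct.inl x) := by
    rw [centralAverage, mul_smul_comm, smul_mul_assoc, Finset.mul_sum, Finset.sum_mul]
    congr 1
    refine Finset.sum_congr rfl fun γ _ => ?_
    have e1 : (SemidirectProduct.inl x * SemidirectProduct.inr γ : LatticeGroup ρ X hX) =
        SemidirectProduct.inr γ * SemidirectProduct.inl (latticeAction ρ X hX γ⁻¹ x) := by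
      rw [SemidirectProduct.inl_aut]; simp [← mul_assoc]
    have e2 : (SemidirectProduct.inl (latticeAction ρ X hX γ⁻¹ x) * SemidirectProduct.inr γ⁻¹ :
        LatticeGroup ρ X hX) = SemidirectProduct.inr γ⁻¹ * SemidirectProduct.inl x := by
      rw [SemidirectProduct.inl_aut]; simp
    rw [← mul_assoc, ← mul_assoc, ← map_mul, e1, map_mul, mul_assoc _ _ (inlAlgHom ρ X hX z),
      inlAlgHom_commute, ← mul_assoc, mul_assoc, ← map_mul, e2, map_mul, ← mul_assoc]
  conv_lhs => rw [← SemidirectProduct.inl_left_mul_inr_right g, map_mul, mul_assoc, hinr,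
    ← mul_assoc, hinl, mul_assoc, ← map_mul, SemidirectProduct.inl_left_mul_inr_right]

lemma asAlgebraHom_centralAverage {V : Type} [AddCommGroup V] [Module ℂ V]
    (τ : Representation ℂ (LatticeGroup ρ X hX) V) (z : MonoidAlgebra ℂ (Multiplicative X)) {c : ℂ}
    (hz : Representation.asAlgebraHom (G := Multiplicative X) (τ.comp SemidirectProduct.inl) z =
      c • LinearMap.id) : τ.asAlgebraHom (centralAverage z) = c • LinearMap.id := by
  have hcard : (Fintype.card Γ : ℂ) ≠ 0 := by exact_mod_cast Fintype.card_ne_zero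
  have h (γ : Γ) : τ.asAlgebraHom (MonoidAlgebra.of ℂ _ (SemidirectProduct.inr γ) * inlAlgHom ρ X hX z *
      MonoidAlgebra.of ℂ _ (SemidirectProduct.inr γ⁻¹)) = c • LinearMap.id := by
    rw [map_mul, map_mul, asAlgebraHom_inlAlgHom, hz, Representation.asAlgebraHom_of,
      Representation.asAlgebraHom_of]
    change (τ _ * (c • (1 : Module.End ℂ V))) * τ _ = c • (1 : Module.End ℂ V)
    rw [mul_smul_comm, smul_mul_assoc, mul_one, ← map_mul, ← map_mul, mul_inv_cancel, map_one,
      map_one]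
  rw [centralAverage, map_smul, map_sum, Finset.sum_congr rfl fun γ _ => h γ, Finset.sum_const,
    Finset.card_univ, ← Nat.cast_smul_eq_nsmul ℂ, smul_smul, inv_mul_cancel₀ hcard, one_smul]

/-- The average of z is central, acts on the trivial module by its augmentation 1 and on M by 0. -/
theorem extFinite_and_extChar_of_counit {M : Rep.{0} ℂ (LatticeGroup ρ X hX)}
    {z : MonoidAlgebra ℂ (Multiplicative X)} (hz : counit X z = 1)
    (hM : Representation.asAlgebraHom (G := Multiplicative X) (M.ρ.comp SemidirectProduct.inl) z =
      0) : ExtFinite (𝟙_ (Rep.{0} ℂ (LatticeGroup ρ X hX))) M ∧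
        extChar (𝟙_ (Rep.{0} ℂ (LatticeGroup ρ X hX))) M = 0 := by
  let ζ := centralEndomorphism (centralAverage (ρ := ρ) (hX := hX) z) (centralAverage_commute z)
  have h1 : ζ.app (𝟙_ (Rep.{0} ℂ (LatticeGroup ρ X hX))) = 𝟙 _ := by
    refine Rep.hom_ext (Representation.IntertwiningMap.ext ?_)
    refine (asAlgebraHom_centralAverage _ z (c := 1) ?_).trans (one_smul _ _)
    rw [← hz]
    clear * -
    induction z using MonoidAlgebra.induction_linear with
    | zero => simp
    | add a b ha hb => rw [map_add, map_add, add_smul, ha, hb]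
    | single x r =>
      rw [Representation.asAlgebraHom_single, counit_single]
      rfl
  have h2 : ζ.app M = 0 := by
    refine Rep.hom_ext (Representation.IntertwiningMap.ext ?_)
    refine (asAlgebraHom_centralAverage _ z (c := 0) ?_).trans (zero_smul _ _)
    rw [hM, zero_smul]
  have h3 (n : ℕ) := subsingleton_ext_of_natural_endomorphism _ ζ h1 n M h2
  exact ⟨⟨fun n => inferInstance, 0, fun n _ => h3 n⟩,
    (eulerChar_eq_sum (N := 0) fun n _ => h3 n).trans (by simp)⟩

end Central

end

section

open scoped MonoidalCategory

/-! ### Character sums over the elliptic classes. -/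

section EllipticSum

variable {Γ : Type} [Group Γ] {E : Type} [AddCommGroup E] [Module ℝ E]
  {ρ : Representation ℝ Γ E} {X : Submodule ℤ E} {hX : ∀ γ, ∀ x ∈ X, ρ γ x ∈ X}

lemma character_eq_of_mem_latticeClass {V : Type} [AddCommGroup V] [Module ℂ V]
    (τ : Representation ℂ (LatticeGroup ρ X hX) V)
    {w z : LatticeGroup ρ X hX} (h : z ∈ latticeClass w) : τ.character z = τ.character w := by
  obtain ⟨x, rfl⟩ := h
  exact Representation.char_conj _ _ _

lemma classMk_inl_mul (x : Multiplicative X) {w z : LatticeGroup ρ X hX}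
    (h : classMk w = classMk z) :
    classMk (SemidirectProduct.inl x * w) = classMk (SemidirectProduct.inl x * z) := by
  rw [classMk_eq_iff] at h ⊢
  obtain ⟨y, rfl⟩ := h
  refine ⟨y, ?_⟩
  dsimp only
  rw [← mul_assoc, ← mul_assoc, ← mul_assoc, ← map_mul, ← map_mul, mul_comm]

/-- Translation by a lattice element, on classes. -/
def translateClass (x : Multiplicative X) (q : LatticeClasses ρ X hX) : LatticeClasses ρ X hX :=
  classMk (SemidirectProduct.inl x * q.out)

lemma classRight_translateClass (x : Multiplicative X) (q : LatticeClasses ρ X hX) :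
    classRight (translateClass x q) = classRight q := by
  rw [translateClass, classRight_classMk, ← right_out]
  simp

lemma translateClass_translateClass {x y : Multiplicative X} (h : x * y = 1)
    (q : LatticeClasses ρ X hX) : translateClass x (translateClass y q) = q := by
  rw [translateClass, classMk_inl_mul x (classMk_out (translateClass y q)), ← mul_assoc, ← map_mul,
    h, map_one, one_mul, classMk_out]

variable [Finite Γ] [Module.Free ℤ X] [Module.Finite ℤ X]

/-- The finite set of elliptic classes. -/
def ellFinset (ρ : Representation ℝ Γ E) (X : Submodule ℤ E) (hX : ∀ γ, ∀ x ∈ X, ρ γ x ∈ X)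
    [Module.Free ℤ X] [Module.Finite ℤ X] : Finset (LatticeClasses ρ X hX) :=
  (finite_ellClasses (ρ := ρ) (X := X) (hX := hX)).toFinset

lemma mem_ellFinset {q : LatticeClasses ρ X hX} :
    q ∈ ellFinset ρ X hX ↔ ellDet hX (classRight q) ≠ 0 := by
  rw [ellFinset, Set.Finite.mem_toFinset]
  rfl

/-- The sum of the values of a character at the elliptic classes. -/
def ellSum (M : Rep.{0} ℂ (LatticeGroup ρ X hX)) : ℂ :=
  ∑ q ∈ ellFinset ρ X hX, M.ρ.character q.out

/-- Multiplication by x permutes the lattice classes and preserves the component in Γ, hence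
preserves ellipticity. -/
lemma sum_character_translate (M : Rep.{0} ℂ (LatticeGroup ρ X hX)) (x : Multiplicative X) :
    ∑ q ∈ ellFinset ρ X hX, M.ρ.character (SemidirectProduct.inl x * q.out) = ellSum M := by
  refine Finset.sum_bij' (fun q _ => translateClass x q) (fun q _ => translateClass x⁻¹ q)
    (fun q hq => ?_) (fun q hq => ?_)
    (fun q _ => translateClass_translateClass (inv_mul_cancel x) q)
    (fun q _ => translateClass_translateClass (mul_inv_cancel x) q) (fun q _ => ?_)
  · rw [mem_ellFinset, classRight_translateClass]
    exact mem_ellFinset.1 hq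
  · rw [mem_ellFinset, classRight_translateClass]
    exact mem_ellFinset.1 hq
  · exact (character_eq_of_mem_latticeClass _ (classMk_eq_iff.1 (classMk_out _).symm)).symm

lemma sum_trace_translate (M : Rep.{0} ℂ (LatticeGroup ρ X hX))
    (z : MonoidAlgebra ℂ (Multiplicative X)) :
    ∑ q ∈ ellFinset ρ X hX, LinearMap.trace ℂ M (Representation.asAlgebraHom
      (G := Multiplicative X) (M.ρ.comp SemidirectProduct.inl) z * M.ρ q.out) =
        counit X z * ellSum M := by
  induction z using MonoidAlgebra.induction_linear with
  | zero => simp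
  | add a b ha hb => simp only [map_add, add_mul, Finset.sum_add_distrib, ha, hb]
  | single x r =>
    rw [counit_single, ← sum_character_translate M x, Finset.mul_sum]
    refine Finset.sum_congr rfl fun q _ => ?_
    rw [Representation.asAlgebraHom_single, smul_mul_assoc, map_smul, smul_eq_mul]
    congr 2
    exact (map_mul M.ρ _ _).symm

lemma ellSum_eq_zero_of_counit {M : Rep.{0} ℂ (LatticeGroup ρ X hX)}
    {z : MonoidAlgebra ℂ (Multiplicative X)} (hz : counit X z = 1)
    (hM : Representation.asAlgebraHom (G := Multiplicative X) (M.ρ.comp SemidirectProduct.inl) z =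
      0) : ellSum M = 0 := by
  have h := sum_trace_translate M z
  rw [hM, hz, one_mul] at h
  simpa using h.symm

/-- Additivity of traces makes the elliptic sum compatible with the same devissage as the Euler
characteristic. -/
lemma ellSum_add {S : ShortComplex (Rep.{0} ℂ (LatticeGroup ρ X hX))} (hS : S.ShortExact)
    [FiniteDimensional ℂ S.X₁] [FiniteDimensional ℂ S.X₂] [FiniteDimensional ℂ S.X₃] :
    ellSum S.X₂ = ellSum S.X₁ + ellSum S.X₃ := by
  obtain ⟨h1, h2, h3⟩ := shortExact_iff.1 hS
  rw [ellSum, ellSum, ellSum, ← Finset.sum_add_distrib]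
  refine Finset.sum_congr rfl fun q _ => ?_
  exact trace_eq_add_of_exact (i := S.f.hom.toLinearMap) (p := S.g.hom.toLinearMap) h1 h2 h3
    (S.f.hom.isIntertwining' _) (S.g.hom.isIntertwining' _)

lemma card_filter_classRight [DecidableEq Γ] (γ : Γ) :
    ((ellFinset ρ X hX).filter fun q => classRight q = γ).card = (ellDet hX γ).natAbs := by
  by_cases h : ellDet hX γ = 0
  · rw [h, Int.natAbs_zero, Finset.card_eq_zero, Finset.filter_eq_empty_iff]
    rintro q hq rfl
    exact mem_ellFinset.1 hq h
  · rw [← card_fibre h]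
    refine (Nat.subtype_card _ fun q => ?_).symm
    rw [Finset.mem_filter, mem_ellFinset]
    exact ⟨fun hq => hq.2, fun hq => ⟨hq ▸ h, hq⟩⟩

end EllipticSum

/-! ### The Euler characteristic as an elliptic character sum. -/

section Main

variable {Γ : Type} [Group Γ] [Finite Γ]
    {E : Type} [NormedAddCommGroup E] [NormedSpace ℝ E] [FiniteDimensional ℝ E]
    {ρ : Representation ℝ Γ E} {X : Submodule ℤ E} [DiscreteTopology X] [IsZLattice ℝ X]
    {hX : ∀ γ, ∀ x ∈ X, ρ γ x ∈ X}

/-- There are |det(1 - γ)| elliptic classes over γ, also when the determinant is zero, and the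
determinant equals its absolute value. -/
lemma sum_ellFinset_classRight {R : Type} [CommRing R] (f : Γ → R) :
    ∑ q ∈ ellFinset ρ X hX, f (classRight q) = ∑ᶠ γ, (ellDet hX γ : R) * f γ := by
  classical
  have := Fintype.ofFinite Γ
  rw [finsum_eq_sum_of_fintype, ← Finset.sum_fiberwise _ (fun q => classRight q)]
  refine Finset.sum_congr rfl fun γ _ => ?_
  rw [Finset.sum_congr rfl fun q hq => by rw [(Finset.mem_filter.1 hq).2], Finset.sum_const,
    card_filter_classRight γ, nsmul_eq_mul, ← Int.cast_natCast, Int.natAbs_of_nonneg (ellDet_nonneg hX γ)]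

lemma extChar_eq_ellSum_of_isLatticeTrivial {M : Rep.{0} ℂ (LatticeGroup ρ X hX)}
    [FiniteDimensional ℂ M] (hM : IsLatticeTrivial M) :
    (extChar (𝟙_ (Rep.{0} ℂ (LatticeGroup ρ X hX))) M : ℂ) = (Nat.card Γ : ℂ)⁻¹ * ellSum M := by
  rw [extChar_of_isLatticeTrivial (Module.finBasis ℤ X) hM]
  congr 1
  have h : ellSum M = ∑ q ∈ ellFinset ρ X hX,
      M.ρ.character (SemidirectProduct.inr (classRight q)) := by
    refine Finset.sum_congr rfl fun q _ => ?_
    rw [← right_out]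
    refine congrArg (LinearMap.trace ℂ M) (LinearMap.ext fun v => ?_)
    refine Eq.trans ?_ (hM q.out.left _)
    conv_lhs => rw [← SemidirectProduct.inl_left_mul_inr_right q.out, map_mul]
    rfl
  rw [h, sum_ellFinset_classRight fun γ => M.ρ.character (SemidirectProduct.inr γ)]
  exact finsum_congr fun γ => congrArg (fun n : ℤ => (n : ℂ) * _) (ellDet_inv hX γ)

/-- Induction on the dimension. The span W of the vectors xv - v is a subrepresentation on whose
quotient X acts trivially. If W is all of M, both sides vanish by the Nakayama argument; otherwise W
has smaller dimension and additivity applies. -/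
theorem extFinite_and_extChar_unit (M : Rep.{0} ℂ (LatticeGroup ρ X hX)) [FiniteDimensional ℂ M] :
    ExtFinite (𝟙_ (Rep.{0} ℂ (LatticeGroup ρ X hX))) M ∧
      (extChar (𝟙_ (Rep.{0} ℂ (LatticeGroup ρ X hX))) M : ℂ) = (Nat.card Γ : ℂ)⁻¹ * ellSum M := by
  classical
  have := Fintype.ofFinite Γ
  induction hn : Module.finrank ℂ M using Nat.strong_induction_on generalizing M with
  | _ n ih =>
  let W : Submodule ℂ M := Submodule.span ℂ {u | ∃ (x : Multiplicative X) (v : M),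
    M.ρ (SemidirectProduct.inl x) v - v = u}
  have hmem (x : Multiplicative X) (v : M) : M.ρ (SemidirectProduct.inl x) v - v ∈ W :=
    Submodule.subset_span ⟨x, v, rfl⟩
  -- The span is stable because X is normal: g(xv - v) = x'(gv) - gv with x' = gxg⁻¹ in X.
  have hW (g : LatticeGroup ρ X hX) : W ≤ W.comap (M.ρ g) := Submodule.span_le.2 <| by
    rintro _ ⟨x, v, rfl⟩
    have h1 : g * SemidirectProduct.inl x * g⁻¹ =
        SemidirectProduct.inl (g * SemidirectProduct.inl x * g⁻¹ : LatticeGroup ρ X hX).left :=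
      SemidirectProduct.ext (by simp) (by simp)
    have h2 := hmem (g * SemidirectProduct.inl x * g⁻¹ : LatticeGroup ρ X hX).left (M.ρ g v)
    rw [← h1, map_mul, map_mul, Module.End.mul_apply, Module.End.mul_apply,
      Representation.inv_self_apply, ← map_sub] at h2
    exact h2
  by_cases htop : W = ⊤
  · obtain ⟨z, hz1, hz2⟩ := exists_counit_eq_one_of_span
      (MonoidHom.comp M.ρ (SemidirectProduct.inl : Multiplicative X →* LatticeGroup ρ X hX)) htop
    obtain ⟨h1, h2⟩ := extFinite_and_extChar_of_counit hz1 hz2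
    rw [h2, ellSum_eq_zero_of_counit hz1 hz2]
    exact ⟨h1, by simp⟩
  · let S : ShortComplex (Rep.{0} ℂ (LatticeGroup ρ X hX)) :=
      ShortComplex.mk (Rep.subtype M W hW) (Rep.mkQ M W hW)
        (Rep.hom_ext (Representation.IntertwiningMap.ext (LinearMap.ext fun v =>
          (Submodule.Quotient.mk_eq_zero W).2 v.2)))
    have hS : S.ShortExact := shortExact_iff.2 ⟨W.injective_subtype,
      LinearMap.exact_subtype_mkQ W, W.mkQ_surjective⟩
    have : FiniteDimensional ℂ S.X₁ := inferInstanceAs (FiniteDimensional ℂ W)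
    have : FiniteDimensional ℂ S.X₂ := inferInstanceAs (FiniteDimensional ℂ M)
    have : FiniteDimensional ℂ S.X₃ := inferInstanceAs (FiniteDimensional ℂ (M ⧸ W))
    have hb : Module.Finite ℤ X := inferInstance
    obtain ⟨h1, h2⟩ := ih _ (hn ▸ Submodule.finrank_lt htop) S.X₁ rfl
    have h3 : IsLatticeTrivial S.X₃ := fun x v => by
      obtain ⟨v, rfl⟩ := W.mkQ_surjective v
      exact (Submodule.Quotient.eq W).2 (hmem x v)
    have h4 := (extFinite_and_extChar_of_isLatticeTrivial (Module.finBasis ℤ X) h3).1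
    have h5 := h1.middle _ hS h4
    refine ⟨h5, ?_⟩
    have h6 := extChar_add _ hS h1 h5 h4
    have h7 := ellSum_add hS
    change (extChar _ S.X₂ : ℂ) = _ * ellSum S.X₂
    rw [h6, h7, Int.cast_add, h2, extChar_eq_ellSum_of_isLatticeTrivial h3, mul_add]

end Main

end

section

open scoped MonoidalCategory

/-! ### Conjugation on the set of lattice classes. -/

section ClassAction

variable {Γ : Type} [Group Γ] {E : Type} [AddCommGroup E] [Module ℝ E]
  {ρ : Representation ℝ Γ E} {X : Submodule ℤ E} {hX : ∀ γ, ∀ x ∈ X, ρ γ x ∈ X}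

lemma conj_mem_latticeClass (g : LatticeGroup ρ X hX) {w z : LatticeGroup ρ X hX}
    (h : z ∈ latticeClass w) : g * z * g⁻¹ ∈ latticeClass (g * w * g⁻¹) := by
  obtain ⟨x, rfl⟩ := h
  have h1 : g * SemidirectProduct.inl x * g⁻¹ =
      SemidirectProduct.inl (g * SemidirectProduct.inl x * g⁻¹ : LatticeGroup ρ X hX).left :=
    SemidirectProduct.ext (by simp) (by simp)
  refine ⟨(g * SemidirectProduct.inl x * g⁻¹ : LatticeGroup ρ X hX).left, ?_⟩
  dsimp only
  rw [← h1]
  group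

/-- The group acts on lattice classes by conjugation. -/
instance classAction : MulAction (LatticeGroup ρ X hX) (LatticeClasses ρ X hX) where
  smul g q := Quotient.map (fun w => g * w * g⁻¹) (fun _ _ h => conj_mem_latticeClass g h) q
  one_smul q := by
    induction q using Quotient.inductionOn with
    | h w => exact congrArg classMk (by group)
  mul_smul g h q := by
    induction q using Quotient.inductionOn with
    | h w => exact congrArg classMk (by group)

lemma smul_classMk (g w : LatticeGroup ρ X hX) : g • classMk w = classMk (g * w * g⁻¹) := rfl

/-- The conjugation action is trivial on the lattice and thus is an action of the finite group Γ. -/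
lemma inl_smul_class (x : Multiplicative X) (q : LatticeClasses ρ X hX) :
    (SemidirectProduct.inl x : LatticeGroup ρ X hX) • q = q := by
  rw [← classMk_out q, smul_classMk, eq_comm, classMk_eq_iff]
  exact ⟨x, rfl⟩

instance classActionRight : MulAction Γ (LatticeClasses ρ X hX) :=
  MulAction.compHom _ (SemidirectProduct.inr : Γ →* LatticeGroup ρ X hX)

lemma right_smul_class (g : LatticeGroup ρ X hX) (q : LatticeClasses ρ X hX) :
    g.right • q = g • q := by
  conv_rhs => rw [← SemidirectProduct.inl_left_mul_inr_right g, mul_smul, inl_smul_class]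
  rfl

lemma ellDet_conj (γ δ : Γ) : ellDet hX (γ * δ * γ⁻¹) = ellDet hX δ := by
  have h1 : latticeLin ρ X hX γ ∘ₗ latticeLin ρ X hX γ⁻¹ = LinearMap.id := by
    rw [← latticeLin_mul, mul_inv_cancel, latticeLin_one]
  have h2 : (1 - latticeLin ρ X hX (γ * δ * γ⁻¹)) =
      latticeLin ρ X hX γ ∘ₗ (1 - latticeLin ρ X hX δ) ∘ₗ latticeLin ρ X hX γ⁻¹ := by
    rw [LinearMap.sub_comp, LinearMap.comp_sub, latticeLin_mul, latticeLin_mul,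
      LinearMap.comp_assoc]
    congr 1
    exact h1.symm
  rw [ellDet, h2, LinearMap.det_comp, LinearMap.det_comp, mul_left_comm, ← LinearMap.det_comp, h1,
    LinearMap.det_id, mul_one, ellDet]

lemma ellDet_smul (g : LatticeGroup ρ X hX) (q : LatticeClasses ρ X hX) :
    ellDet hX (classRight (g • q)) = ellDet hX (classRight q) := by
  rw [← classMk_out q, smul_classMk, classRight_classMk, classRight_classMk]
  exact ellDet_conj g.right q.out.right

end ClassAction

/-! ### Existence of the elliptic measure. -/

section Measure

variable {Γ : Type} [Group Γ] [Finite Γ]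
    {E : Type} [NormedAddCommGroup E] [NormedSpace ℝ E] [FiniteDimensional ℝ E]
    {ρ : Representation ℝ Γ E} {X : Submodule ℤ E} [DiscreteTopology X] [IsZLattice ℝ X]
    {hX : ∀ γ, ∀ x ∈ X, ρ γ x ∈ X}

theorem extFinite_extGroup (U V : Rep.{0} ℂ (LatticeGroup ρ X hX)) [FiniteDimensional ℂ U]
    [FiniteDimensional ℂ V] : IsFiniteSeq fun n => ExtGroup n U V := by
  have : FiniteDimensional ℂ ((Rep.ihom U).obj V) :=
    inferInstanceAs (FiniteDimensional ℂ (U →ₗ[ℂ] V))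
  refine (extFinite_and_extChar_unit ((Rep.ihom U).obj V)).1.congr fun n => ?_
  obtain ⟨e⟩ := nonempty_extGroup_equiv U V n
  obtain ⟨e'⟩ := nonempty_ext_equiv_ext_ihom U n V
  exact ⟨(e.trans e').symm⟩

/-- The character of Hom(U, V) at w is that of U at w⁻¹ times that of V at w. Elliptic elements have
finite order, so the first factor is a complex conjugate. -/
theorem eulerPoincare_eq_sum (U V : Rep.{0} ℂ (LatticeGroup ρ X hX)) [FiniteDimensional ℂ U]
    [FiniteDimensional ℂ V] : (eulerPoincare U V : ℂ) = (Nat.card Γ : ℂ)⁻¹ *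
      ∑ q ∈ ellFinset ρ X hX, conj (U.ρ.character q.out) * V.ρ.character q.out := by
  have : FiniteDimensional ℂ ((Rep.ihom U).obj V) :=
    inferInstanceAs (FiniteDimensional ℂ (U →ₗ[ℂ] V))
  have h1 : eulerPoincare U V =
      extChar (𝟙_ (Rep.{0} ℂ (LatticeGroup ρ X hX))) ((Rep.ihom U).obj V) :=
    eulerChar_congr fun n => by
      obtain ⟨e⟩ := nonempty_extGroup_equiv U V n
      obtain ⟨e'⟩ := nonempty_ext_equiv_ext_ihom U n V
      exact ⟨e.trans e'⟩
  rw [h1, (extFinite_and_extChar_unit _).2]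
  congr 1
  refine Finset.sum_congr rfl fun q hq => ?_
  rw [mem_ellFinset, ← right_out] at hq
  refine (Representation.char_linHom U.ρ V.ρ q.out).trans ?_
  rw [character_inv_of_isOfFinOrder _ (isOfFinOrder_of_isElliptic hq)]

variable (ρ X hX) in
/-- The measure giving mass `|Γ|⁻¹` to each elliptic class. -/
def ellMeasure : Measure (LatticeGroup ρ X hX) :=
  (Nat.card Γ : ℝ≥0∞)⁻¹ • ∑ q ∈ ellFinset ρ X hX, Measure.dirac q.out

lemma ellMeasure_apply {A : Set (LatticeGroup ρ X hX)} (hA : MeasurableSet A)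
    [DecidablePred fun q : LatticeClasses ρ X hX => q.out ∈ A] :
    ellMeasure ρ X hX A =
      (Nat.card Γ : ℝ≥0∞)⁻¹ * ((ellFinset ρ X hX).filter fun q => q.out ∈ A).card := by
  rw [ellMeasure, Measure.smul_apply, Measure.finsetSum_apply, smul_eq_mul]
  congr 1
  rw [Finset.sum_congr rfl fun q _ => Measure.dirac_apply' _ hA]
  classical
  simp [Set.indicator_apply, Finset.sum_boole]

/-- Measurable sets do not separate points of a lattice class, so the representatives carrying the
point masses are immaterial. -/
lemma mem_iff_of_classMk_eq {A : Set (LatticeGroup ρ X hX)} (hA : MeasurableSet A)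
    {w z : LatticeGroup ρ X hX} (h : classMk w = classMk z) : w ∈ A ↔ z ∈ A :=
  ⟨fun hw => measurableSet_iff.1 hA w hw (classMk_eq_iff.1 h),
    fun hz => measurableSet_iff.1 hA z hz (classMk_eq_iff.1 h.symm)⟩

lemma measurable_conj (g : LatticeGroup ρ X hX) :
    Measurable fun w : LatticeGroup ρ X hX => g * w * g⁻¹ := fun _ hA =>
  measurableSet_iff.2 fun w hw _ hz =>
    measurableSet_iff.1 hA (g * w * g⁻¹) hw (conj_mem_latticeClass g hz)

lemma measurePreserving_conj_ellMeasure (g : LatticeGroup ρ X hX) :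
    MeasurePreserving (fun w => g * w * g⁻¹) (ellMeasure ρ X hX) (ellMeasure ρ X hX) := by
  classical
  refine ⟨measurable_conj g, Measure.ext fun A hA => ?_⟩
  rw [Measure.map_apply (measurable_conj g) hA, ellMeasure_apply (measurable_conj g hA),
    ellMeasure_apply hA]
  congr 2
  have key (q : LatticeClasses ρ X hX) : g * q.out * g⁻¹ ∈ A ↔ (g • q).out ∈ A := by
    refine mem_iff_of_classMk_eq hA ?_
    rw [← smul_classMk, classMk_out, classMk_out]
  refine Finset.card_bij' (fun q _ => g • q) (fun q _ => g⁻¹ • q) (fun q hq => ?_) (fun q hq => ?_)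
    (fun q _ => inv_smul_smul g q) (fun q _ => smul_inv_smul g q)
  · rw [Finset.mem_filter, mem_ellFinset] at hq ⊢
    rw [ellDet_smul, ← key]
    exact hq
  · rw [Finset.mem_filter, mem_ellFinset] at hq ⊢
    rw [ellDet_smul, Set.mem_preimage, key, smul_inv_smul]
    exact hq

lemma measurable_conj_character_mul (U V : Rep.{0} ℂ (LatticeGroup ρ X hX)) :
    Measurable fun w => conj (U.ρ.character w) * V.ρ.character w :=
  measurable_of_forall_latticeClass fun w z hz => by
    rw [character_eq_of_mem_latticeClass _ hz, character_eq_of_mem_latticeClass _ hz]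

theorem isEllipticMeasure_ellMeasure : IsEllipticMeasure (ellMeasure ρ X hX) := by
  have hcard : (Nat.card Γ : ℝ≥0∞)⁻¹ ≠ ∞ :=
    ENNReal.inv_ne_top.2 (Nat.cast_ne_zero.2 Nat.card_pos.ne')
  have hint (U V : Rep.{0} ℂ (LatticeGroup ρ X hX)) (a : LatticeGroup ρ X hX) :
      Integrable (fun w => conj (U.ρ.character w) * V.ρ.character w) (Measure.dirac a) :=
    integrable_dirac' (measurable_conj_character_mul U V).stronglyMeasurable enorm_lt_top
  refine ⟨measurePreserving_conj_ellMeasure, fun U V _ _ => ?_, fun U V _ _ => ?_⟩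
  · exact (integrable_finsetSum_measure.2 fun q _ => hint U V q.out).smul_measure hcard
  · rw [eulerPoincare_eq_sum, ellMeasure, integral_smul_measure,
      integral_finsetSum_measure fun q _ => hint U V q.out, ENNReal.toReal_inv,
      ENNReal.toReal_natCast, Complex.real_smul, Complex.ofReal_inv, Complex.ofReal_natCast]
    congr 1
    exact Finset.sum_congr rfl fun q _ =>
      (integral_dirac' _ _ (measurable_conj_character_mul U V).stronglyMeasurable).symm

end Measure

end

/-! ### Support and total mass. -/

section Values

variable {Γ : Type} [Group Γ] [Finite Γ]
    {E : Type} [NormedAddCommGroup E] [NormedSpace ℝ E] [FiniteDimensional ℝ E]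
    {ρ : Representation ℝ Γ E} {X : Submodule ℤ E} [DiscreteTopology X] [IsZLattice ℝ X]
    {hX : ∀ γ, ∀ x ∈ X, ρ γ x ∈ X}

lemma measurableSet_latticeClass (w : LatticeGroup ρ X hX) : MeasurableSet (latticeClass w) :=
  MeasurableSpace.measurableSet_generateFrom ⟨w, rfl⟩

lemma out_mem_iff {A : Set (LatticeGroup ρ X hX)} (hA : MeasurableSet A)
    (w : LatticeGroup ρ X hX) : (classMk w).out ∈ A ↔ w ∈ A :=
  mem_iff_of_classMk_eq hA (classMk_out _)

lemma ellMeasure_latticeClass {c : LatticeGroup ρ X hX} (hc : ellDet hX c.right ≠ 0) :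
    ellMeasure ρ X hX (latticeClass c) = (Nat.card Γ : ℝ≥0∞)⁻¹ := by
  classical
  rw [ellMeasure_apply (measurableSet_latticeClass c)]
  have h : ((ellFinset ρ X hX).filter fun q => q.out ∈ latticeClass c) = {classMk c} := by
    ext q
    rw [Finset.mem_filter, Finset.mem_singleton, mem_ellFinset, ← classMk_eq_iff, classMk_out,
      eq_comm (a := classMk c)]
    refine ⟨fun h => h.2, ?_⟩
    rintro rfl
    exact ⟨hc, rfl⟩
  rw [h, Finset.card_singleton, Nat.cast_one, mul_one]

lemma ellMeasure_compl_isElliptic : ellMeasure ρ X hX {w | IsElliptic w}ᶜ = 0 ∧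
    MeasurableSet {w : LatticeGroup ρ X hX | IsElliptic w} := by
  classical
  have hm : MeasurableSet {w : LatticeGroup ρ X hX | IsElliptic w} :=
    measurableSet_iff.2 fun w hw z hz => by
      rw [Set.mem_ofPred_eq, isElliptic_iff] at hw ⊢
      rwa [(mem_latticeClass_iff.1 hz).1]
  refine ⟨?_, hm⟩
  rw [ellMeasure_apply hm.compl, Finset.filter_eq_empty_iff.2, Finset.card_empty, Nat.cast_zero,
    mul_zero]
  intro q hq h
  rw [mem_ellFinset, ← right_out, ← isElliptic_iff] at hq
  exact h hq

lemma inv_card_ne_zero : (Nat.card Γ : ℝ≥0∞)⁻¹ ≠ 0 :=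
  ENNReal.inv_ne_zero.2 (ENNReal.natCast_ne_top _)

/-- A measurable set that misses an elliptic w misses all of L_w, which has positive mass. -/
theorem isSupport_ellMeasure :
    IsSupport (ellMeasure ρ X hX) {w | IsElliptic w} := by
  refine ⟨ellMeasure_compl_isElliptic.2, ellMeasure_compl_isElliptic.1, fun A hA h0 w hw => ?_⟩
  by_contra hwA
  have h1 := measure_mono_null (measurableSet_iff.1 hA.compl w hwA) h0
  rw [ellMeasure_latticeClass (isElliptic_iff.1 hw)] at h1
  exact inv_card_ne_zero h1

theorem ellMeasure_univ : ellMeasure ρ X hX Set.univ =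
    (Nat.card Γ : ℝ≥0∞)⁻¹ * (ellFinset ρ X hX).card := by
  classical
  rw [ellMeasure_apply MeasurableSet.univ]
  congr 3
  exact Finset.filter_true_of_mem fun _ _ => Set.mem_univ _

theorem ellMeasure_univ_ne_top : ellMeasure ρ X hX Set.univ ≠ ∞ := by
  rw [ellMeasure_univ]
  exact ENNReal.mul_ne_top (ENNReal.inv_ne_top.2 (Nat.cast_ne_zero.2 Nat.card_pos.ne'))
    (ENNReal.natCast_ne_top _)

/-- Both sides are the average over Γ of det(1 - γ): one by counting classes, the other by the
alternating traces on exterior powers. -/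
theorem toReal_ellMeasure_univ : (ellMeasure ρ X hX Set.univ).toReal =
    ((∑ᶠ n : ℕ, (-1) ^ n * (Module.finrank ℝ (exteriorRep ρ n).invariants : ℤ) : ℤ) : ℝ) := by
  classical
  have := Fintype.ofFinite Γ
  have hcard : (Nat.card Γ : ℝ) ≠ 0 := by simp
  have : Invertible (Nat.card Γ : ℝ) := invertibleOfNonzero hcard
  have h1 : ((ellFinset ρ X hX).card : ℝ) = ∑ γ : Γ, (ellDet hX γ : ℝ) := by
    have h := sum_ellFinset_classRight (ρ := ρ) (hX := hX) fun _ => (1 : ℝ)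
    rw [finsum_eq_sum_of_fintype] at h
    simpa using h
  have h2 : (∑ᶠ n : ℕ, (-1) ^ n * (Module.finrank ℝ (exteriorRep ρ n).invariants : ℤ) : ℤ) =
      ∑ n ∈ Finset.range (Module.finrank ℝ E + 1),
        (-1) ^ n * (Module.finrank ℝ (exteriorRep ρ n).invariants : ℤ) := by
    refine finsum_eq_sum_of_support_subset _ fun n hn => ?_
    rw [Finset.coe_range, Set.mem_Iio]
    by_contra hlt
    have : Subsingleton (⋀[ℝ]^n E) := Module.finrank_zero_iff.1 <| by
      rw [exteriorPower.finrank_eq]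
      exact Nat.choose_eq_zero_of_lt (by omega)
    exact hn (by simp [Module.finrank_zero_of_subsingleton])
  have h3 (n) : (Module.finrank ℝ (exteriorRep ρ n).invariants : ℝ) = (Nat.card Γ : ℝ)⁻¹ *
      ∑ γ : Γ, LinearMap.trace ℝ _ (exteriorPower.map n (ρ γ)) :=
    (Representation.card_inv_mul_sum_char_eq_finrank (exteriorRep ρ n)).symm
  rw [ellMeasure_univ, h2, ENNReal.toReal_mul, ENNReal.toReal_inv, ENNReal.toReal_natCast,
    ENNReal.toReal_natCast, h1]
  push_cast
  simp only [h3, mul_left_comm _ (Nat.card Γ : ℝ)⁻¹]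
  rw [← Finset.mul_sum]
  congr 1
  simp only [Finset.mul_sum]
  rw [Finset.sum_comm]
  refine Finset.sum_congr rfl fun γ _ => ?_
  rw [← det_one_sub_eq_ellDet, ← sum_trace_exteriorPower _ (Nat.lt_succ_self _)]

end Values

/-! ### The mass of a conjugacy class. -/

section ConjugacyClass

variable {Γ : Type} [Group Γ] [Finite Γ]
    {E : Type} [NormedAddCommGroup E] [NormedSpace ℝ E] [FiniteDimensional ℝ E]
    {ρ : Representation ℝ Γ E} {X : Submodule ℤ E} [DiscreteTopology X] [IsZLattice ℝ X]
    {hX : ∀ γ, ∀ x ∈ X, ρ γ x ∈ X}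

lemma mem_conjugatesOf_iff_orbit {c w : LatticeGroup ρ X hX} :
    w ∈ conjugatesOf c ↔ classMk w ∈ MulAction.orbit Γ (classMk c) := by
  rw [show w ∈ conjugatesOf c ↔ IsConj c w from Iff.rfl, isConj_iff]
  constructor
  · rintro ⟨g, rfl⟩
    exact ⟨g.right, (right_smul_class g _).trans (smul_classMk g c)⟩
  · rintro ⟨γ, h⟩
    have h : classMk (SemidirectProduct.inr γ * c * (SemidirectProduct.inr γ)⁻¹) = classMk w := h
    obtain ⟨x, rfl⟩ := classMk_eq_iff.1 h
    exact ⟨SemidirectProduct.inl x * SemidirectProduct.inr γ, by group⟩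

lemma measurableSet_conjugatesOf (c : LatticeGroup ρ X hX) : MeasurableSet (conjugatesOf c) :=
  measurableSet_iff.2 fun w hw z hz => by
    rw [mem_conjugatesOf_iff_orbit] at hw ⊢
    rwa [← classMk_eq_iff.2 hz]

lemma ellMeasure_conjugatesOf {c : LatticeGroup ρ X hX} (hc : ellDet hX c.right ≠ 0) :
    ellMeasure ρ X hX (conjugatesOf c) =
      (Nat.card Γ : ℝ≥0∞)⁻¹ * Nat.card (MulAction.orbit Γ (classMk c)) := by
  classical
  rw [ellMeasure_apply (measurableSet_conjugatesOf c)]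
  congr 2
  refine (Nat.subtype_card _ fun q => ?_).symm
  rw [Finset.mem_filter, mem_ellFinset, mem_conjugatesOf_iff_orbit, classMk_out]
  refine ⟨fun h => h.2, fun h => ⟨?_, h⟩⟩
  obtain ⟨γ, rfl⟩ := h
  change ellDet hX (classRight ((SemidirectProduct.inr γ : LatticeGroup ρ X hX) • classMk c)) ≠ 0
  rwa [ellDet_smul]

/-- If gcg⁻¹ fixes e then c fixes g⁻¹e, and the fixpoint of c is unique. -/
lemma affineAct_eq_of_conj {c : LatticeGroup ρ X hX} (hc : ellDet hX c.right ≠ 0) {e : E}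
    (he : affineAct c e = e) {g : LatticeGroup ρ X hX} (h : affineAct (g * c * g⁻¹) e = e) :
    affineAct g e = e := by
  have h1 : affineAct c (affineAct g⁻¹ e) = affineAct g⁻¹ e := by
    conv_rhs => rw [← h, ← affineAct_mul]
    rw [← affineAct_mul]
    congr 1
    group
  have h2 := fixpoint_unique hc he h1
  conv_lhs => rw [← h2]
  rw [← affineAct_mul, mul_inv_cancel, affineAct_one]

variable {e : E} {c : pointStabilizer ρ X hX e} (hc : ellDet hX c.1.right ≠ 0)

include hc in
-- An element γ that stabilizes L_c lifts to xγ centralizing c; such a lift fixes e, hence is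
-- unique. So the stabilizer of L_c in Γ is the centralizer of c in the stabilizer of e.
lemma card_stabilizer_classMk : Nat.card (MulAction.stabilizer Γ (classMk c.1)) =
      Nat.card (MulAction.stabilizer (ConjAct (pointStabilizer ρ X hX e)) c) := by
  rw [← Subgroup.nat_card_centralizer_nat_card_stabilizer]
  have h0 (g : Subgroup.centralizer {c}) :
      g.1.1.right ∈ MulAction.stabilizer Γ (classMk c.1) := by
    have h1 : g.1.1 * c.1 = c.1 * g.1.1 :=
      congrArg Subtype.val (Subgroup.mem_centralizer_singleton_iff.1 g.2)
    rw [MulAction.mem_stabilizer_iff, right_smul_class, smul_classMk, h1, mul_inv_cancel_right]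
  refine (Nat.card_congr (Equiv.ofBijective (fun g : Subgroup.centralizer {c} =>
    (⟨g.1.1.right, h0 g⟩ : MulAction.stabilizer Γ (classMk c.1))) ⟨fun g h hgh => ?_,
    fun γ => ?_⟩)).symm
  · exact Subtype.ext (injective_right_pointStabilizer e (congrArg Subtype.val hgh))
  · have h1 : classMk (SemidirectProduct.inr γ.1 * c.1 * (SemidirectProduct.inr γ.1)⁻¹) =
      classMk c.1 := γ.2
    obtain ⟨x, hx⟩ := classMk_eq_iff.1 h1
    have h2 : (SemidirectProduct.inl x * SemidirectProduct.inr γ.1) * c.1 *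
        (SemidirectProduct.inl x * SemidirectProduct.inr γ.1 : LatticeGroup ρ X hX)⁻¹ = c.1 := by
      refine Eq.trans ?_ hx
      group
    refine ⟨⟨⟨SemidirectProduct.inl x * SemidirectProduct.inr γ.1,
      affineAct_eq_of_conj hc c.2 (by rw [h2]; exact c.2)⟩, ?_⟩, Subtype.ext (by simp)⟩
    exact Subgroup.mem_centralizer_singleton_iff.2 (Subtype.ext (mul_inv_eq_iff_eq_mul.1 h2))

include hc in
-- By uniqueness of the fixpoint, conjugates of c that fix e are already conjugate to c within the
-- stabilizer of e.
lemma card_conjugatesOf_inter :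
    {w ∈ conjugatesOf c.1 | affineAct w e = e}.ncard =
      Nat.card (MulAction.orbit (ConjAct (pointStabilizer ρ X hX e)) c) := by
  rw [← Nat.card_coe_set_eq]
  have h0 (w : MulAction.orbit (ConjAct (pointStabilizer ρ X hX e)) c) :
      w.1.1 ∈ {w ∈ conjugatesOf c.1 | affineAct w e = e} := by
    obtain ⟨g, hg⟩ := isConj_iff.1 (ConjAct.mem_orbit_conjAct.1 w.2).symm
    exact ⟨isConj_iff.2 ⟨g.1, congrArg Subtype.val hg⟩, w.1.2⟩
  refine (Nat.card_congr (Equiv.ofBijective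
    (fun w : MulAction.orbit (ConjAct (pointStabilizer ρ X hX e)) c =>
      (⟨w.1.1, h0 w⟩ : ({w ∈ conjugatesOf c.1 | affineAct w e = e} : Set _))) ⟨fun w z h => ?_,
    fun w => ?_⟩)).symm
  · have h : w.1.1 = z.1.1 := congrArg (fun u => u.1) h
    exact Subtype.ext (Subtype.ext h)
  · obtain ⟨w, hw, hwe⟩ := w
    obtain ⟨g, rfl⟩ := isConj_iff.1 hw
    refine ⟨⟨⟨g * c.1 * g⁻¹, hwe⟩, ConjAct.mem_orbit_conjAct.2 (IsConj.symm ?_)⟩, rfl⟩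
    exact isConj_iff.2 ⟨⟨g, affineAct_eq_of_conj hc c.2 hwe⟩, rfl⟩

include hc in
-- Orbit-stabilizer for Γ acting on lattice classes and for the point stabilizer acting on itself:
-- both quotients are the reciprocal of the same stabilizer order.
theorem ellMeasure_conjugatesOf_eq_div :
    ellMeasure ρ X hX (conjugatesOf c.1) =
      ({w ∈ conjugatesOf c.1 | affineAct w e = e}.ncard : ℝ≥0∞) /
        ({w : LatticeGroup ρ X hX | affineAct w e = e}.ncard : ℝ≥0∞) := by
  have h1 := Nat.card_congr (MulAction.orbitProdStabilizerEquivGroup Γ (classMk c.1))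
  have h2 := Nat.card_congr
    (MulAction.orbitProdStabilizerEquivGroup (ConjAct (pointStabilizer ρ X hX e)) c)
  have h3 : Nat.card (ConjAct (pointStabilizer ρ X hX e)) =
      {w : LatticeGroup ρ X hX | affineAct w e = e}.ncard := Nat.card_coe_set_eq _
  rw [Nat.card_prod, card_stabilizer_classMk hc] at h1
  rw [Nat.card_prod] at h2
  have h4 := left_ne_zero_of_mul (h1.trans_ne Nat.card_pos.ne')
  have h5 := left_ne_zero_of_mul (h2.trans_ne (Nat.card_pos (α := pointStabilizer ρ X hX e)).ne')
  rw [h3] at h2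
  have key {a z : ℕ} (ha : a ≠ 0) : (a : ℝ≥0∞) / (a * z) = 1 / z := by
    simpa using ENNReal.mul_div_mul_left 1 (z : ℝ≥0∞) (Nat.cast_ne_zero.2 ha)
      (ENNReal.natCast_ne_top a)
  rw [ellMeasure_conjugatesOf hc, card_conjugatesOf_inter hc, ← h1, ← h2, Nat.cast_mul,
    Nat.cast_mul, mul_comm, ← div_eq_mul_inv, key h4, key h5]

end ConjugacyClass

/-! ### Conjugacy separability of Γ ⋉ X. -/

section ResiduallyFinite

/-- A divisible element of a finitely generated abelian group vanishes. -/
lemma eq_zero_of_forall_exists_smul {A : Type} [AddCommGroup A] [Module.Finite ℤ A] {a : A}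
    (h : ∀ n : ℕ, n ≠ 0 → ∃ b : A, n • b = a) : a = 0 := by
  by_contra hne
  have hann : Ideal.torsionOf ℤ A a ≠ ⊤ := fun h0 => hne <| by
    have h1 : (1 : ℤ) ∈ Ideal.torsionOf ℤ A a := h0 ▸ Submodule.mem_top
    rwa [Ideal.mem_torsionOf_iff, one_smul] at h1
  obtain ⟨M, hM, hle⟩ := Ideal.exists_le_maximal _ hann
  obtain ⟨p, hp, hp0⟩ := Submodule.exists_mem_ne_zero_of_ne_bot
    (Ring.ne_bot_of_isMaximal_of_not_isField hM Int.not_isField)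
  have hmem : a ∈ ⨅ i, M ^ i • (⊤ : Submodule ℤ A) := by
    rw [Submodule.mem_iInf]
    intro i
    obtain ⟨b, hb⟩ := h (p.natAbs ^ i) (pow_ne_zero i (Int.natAbs_ne_zero.2 hp0))
    rw [← hb, ← natCast_zsmul]
    refine Submodule.smul_mem_smul ?_ trivial
    rw [Nat.cast_pow]
    refine Ideal.pow_mem_pow ?_ i
    rcases Int.natAbs_eq p with h1 | h1
    · rwa [← h1]
    · rwa [← neg_mem_iff, ← h1]
  -- Krull's intersection theorem gives r in M with ra = a. Then 1 - r annihilates a, so it lies in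
  -- M too, which is impossible.
  obtain ⟨r, hr⟩ := (Ideal.mem_iInf_smul_pow_eq_bot_iff M a).1 hmem
  have h1 : 1 - (r : ℤ) ∈ M := hle <| by
    rw [Ideal.mem_torsionOf_iff, sub_smul, one_smul, hr, sub_self]
  exact hM.ne_top ((Ideal.eq_top_iff_one M).2 (by simpa using add_mem h1 r.2))

variable {Γ : Type} [Group Γ] {E : Type} [AddCommGroup E] [Module ℝ E]
  {ρ : Representation ℝ Γ E} {X : Submodule ℤ E} {hX : ∀ γ, ∀ x ∈ X, ρ γ x ∈ X}

variable (ρ X hX) in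
/-- The subgroup of multiples of `n` in the lattice. -/
def congruenceSubgroup (n : ℕ) : Subgroup (LatticeGroup ρ X hX) :=
  (powMonoidHom n : Multiplicative X →* Multiplicative X).range.map SemidirectProduct.inl

lemma mem_congruenceSubgroup_iff {n : ℕ} {w : LatticeGroup ρ X hX} :
    w ∈ congruenceSubgroup ρ X hX n ↔
      ∃ y : Multiplicative X, SemidirectProduct.inl (y ^ n) = w := by
  constructor
  · rintro ⟨_, ⟨y, rfl⟩, rfl⟩
    exact ⟨y, rfl⟩
  · rintro ⟨y, rfl⟩
    exact ⟨_, ⟨y, rfl⟩, rfl⟩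

instance (n : ℕ) : (congruenceSubgroup ρ X hX n).Normal where
  conj_mem w hw g := by
    obtain ⟨y, rfl⟩ := mem_congruenceSubgroup_iff.1 hw
    have h1 : g * SemidirectProduct.inl y * g⁻¹ =
        SemidirectProduct.inl (g * SemidirectProduct.inl y * g⁻¹ : LatticeGroup ρ X hX).left :=
      SemidirectProduct.ext (by simp) (by simp)
    refine mem_congruenceSubgroup_iff.2
      ⟨(g * SemidirectProduct.inl y * g⁻¹ : LatticeGroup ρ X hX).left, ?_⟩
    rw [map_pow, ← h1, map_pow, conj_pow]

lemma mk_mem_conjugatesOf_iff {n : ℕ} {w z : LatticeGroup ρ X hX} :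
    QuotientGroup.mk' (congruenceSubgroup ρ X hX n) z ∈
        conjugatesOf (QuotientGroup.mk' (congruenceSubgroup ρ X hX n) w) ↔
      ∃ (g : LatticeGroup ρ X hX) (y : Multiplicative X),
        SemidirectProduct.inl (y ^ n) * (g * w * g⁻¹) = z := by
  refine (isConj_iff (α := LatticeGroup ρ X hX ⧸ congruenceSubgroup ρ X hX n)).trans ?_
  constructor
  · rintro ⟨c, hc⟩
    obtain ⟨g, rfl⟩ := QuotientGroup.mk'_surjective _ c
    rw [← map_mul, ← map_inv, ← map_mul, eq_comm, ← mul_inv_eq_one, ← map_inv, ← map_mul,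
      ← MonoidHom.mem_ker, QuotientGroup.ker_mk', mem_congruenceSubgroup_iff] at hc
    obtain ⟨y, hy⟩ := hc
    exact ⟨g, y, by rw [hy, inv_mul_cancel_right]⟩
  · rintro ⟨g, y, rfl⟩
    refine ⟨QuotientGroup.mk' _ g, ?_⟩
    rw [← map_mul, ← map_inv, ← map_mul, map_mul _ (SemidirectProduct.inl _)]
    have h1 : QuotientGroup.mk' (congruenceSubgroup ρ X hX n) (SemidirectProduct.inl (y ^ n)) = 1 :=
      (QuotientGroup.eq_one_iff _).2 (mem_congruenceSubgroup_iff.2 ⟨y, rfl⟩)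
    rw [h1, one_mul]

variable [Finite Γ] [Module.Finite ℤ X]

lemma finite_quotient_congruenceSubgroup {n : ℕ} (hn : n ≠ 0) :
    Finite (LatticeGroup ρ X hX ⧸ congruenceSubgroup ρ X hX n) := by
  let P : Subgroup (Multiplicative X) := (powMonoidHom n).range
  have hfg : AddGroup.FG X := Module.Finite.iff_addGroup_fg.1 inferInstance
  have hP : Finite (Multiplicative X ⧸ P) := Subgroup.finiteIndex_iff_finite_quotient.1
    (Subgroup.finiteIndex_range_powMonoidHom_of_fg (Multiplicative X) hn)
  refine Finite.of_surjective (fun a : (Multiplicative X ⧸ P) × Γ =>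
    QuotientGroup.mk' (congruenceSubgroup ρ X hX n)
      (SemidirectProduct.inl a.1.out * SemidirectProduct.inr a.2)) fun c => ?_
  obtain ⟨w, rfl⟩ := QuotientGroup.mk'_surjective _ c
  refine ⟨(QuotientGroup.mk w.left, w.right), ?_⟩
  obtain ⟨⟨_, y, rfl⟩, hp⟩ := QuotientGroup.mk_out_eq_mul P w.left
  have h1 : QuotientGroup.mk' (congruenceSubgroup ρ X hX n) (SemidirectProduct.inl (y ^ n)) = 1 :=
    (QuotientGroup.eq_one_iff _).2 (mem_congruenceSubgroup_iff.2 ⟨y, rfl⟩)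
  dsimp only
  rw [hp, mul_comm, map_mul SemidirectProduct.inl, mul_assoc,
    SemidirectProduct.inl_left_mul_inr_right, map_mul]
  exact (congrArg (· * _) h1).trans (one_mul _)

/-- By pigeonhole one γ in Γ serves for infinitely many k. After conjugation by it, the translation
parts of z and w differ modulo (1 - δ)X, with δ the Γ-component of z, by a divisible element of a
finitely generated group, hence not at all. -/
lemma mem_conjugatesOf_of_forall {w z : LatticeGroup ρ X hX}
    (h : ∀ k : ℕ, ∃ (g : LatticeGroup ρ X hX) (y : Multiplicative X),
      SemidirectProduct.inl (y ^ k.factorial) * (g * w * g⁻¹) = z) : z ∈ conjugatesOf w := by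
  choose g y hgy using h
  obtain ⟨γ, hγ⟩ := Finite.exists_infinite_fiber fun k => (g k).right
  let w' : LatticeGroup ρ X hX := SemidirectProduct.inr γ * w * (SemidirectProduct.inr γ)⁻¹
  have key (n : ℕ) : ∃ k ≥ n, ∃ u ∈ latticeClass w',
      SemidirectProduct.inl (y k ^ k.factorial) * u = z := by
    obtain ⟨k, hk, hkn⟩ := (Set.infinite_coe_iff.1 hγ).exists_gt n
    refine ⟨k, hkn.le, _, ⟨(g k).left, ?_⟩, hgy k⟩
    have hk : (g k).right = γ := hk
    have h1 : g k = SemidirectProduct.inl (g k).left * SemidirectProduct.inr γ := by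
      rw [← hk, SemidirectProduct.inl_left_mul_inr_right]
    conv_rhs => rw [h1]
    dsimp only [w']
    group
  have hz : z ∈ latticeClass w' := by
    refine mem_latticeClass_iff.2 ⟨?_, (Submodule.Quotient.mk_eq_zero _).1
      (eq_zero_of_forall_exists_smul fun n hn => ?_)⟩
    · obtain ⟨k, -, u, hu, rfl⟩ := key 0
      rw [← (mem_latticeClass_iff.1 hu).1, SemidirectProduct.mul_right,
        SemidirectProduct.right_inl, one_mul]
    · obtain ⟨k, hk, u, hu, rfl⟩ := key n
      obtain ⟨m, hm⟩ := Nat.dvd_factorial (Nat.pos_of_ne_zero hn) hk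
      have h1 := (mem_latticeClass_iff.1 hu).2
      refine ⟨Submodule.Quotient.mk (m • (y k).toAdd), ?_⟩
      rw [← Submodule.Quotient.mk_smul, Submodule.Quotient.eq, ← neg_mem_iff, smul_smul, ← hm]
      convert h1 using 1
      simp only [SemidirectProduct.mul_left, SemidirectProduct.left_inl,
        SemidirectProduct.right_inl, map_one, MulAut.one_apply, toAdd_mul, toAdd_pow]
      abel
  obtain ⟨x, rfl⟩ := hz
  exact isConj_iff.2 ⟨SemidirectProduct.inl x * SemidirectProduct.inr γ, by dsimp only [w']; group⟩

end ResiduallyFinite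

/-! ### Uniqueness of the elliptic measure. -/

section Uniqueness

variable {Γ : Type} [Group Γ] [Finite Γ]
    {E : Type} [NormedAddCommGroup E] [NormedSpace ℝ E] [FiniteDimensional ℝ E]
    {ρ : Representation ℝ Γ E} {X : Submodule ℤ E} [DiscreteTopology X] [IsZLattice ℝ X]
    {hX : ∀ γ, ∀ x ∈ X, ρ γ x ∈ X}

lemma measurableSet_of_conj_mem {A : Set (LatticeGroup ρ X hX)}
    (h : ∀ g, ∀ w ∈ A, g * w * g⁻¹ ∈ A) : MeasurableSet A :=
  measurableSet_iff.2 fun w hw z hz => by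
    obtain ⟨x, rfl⟩ := hz
    exact h _ w hw

lemma measure_eq_tsum (μ : Measure (LatticeGroup ρ X hX)) {A : Set (LatticeGroup ρ X hX)}
    (hA : MeasurableSet A) :
    μ A = ∑' q : {q : LatticeClasses ρ X hX // q.out ∈ A}, μ (latticeClass q.1.out) := by
  have h1 : A = ⋃ q : {q : LatticeClasses ρ X hX // q.out ∈ A}, latticeClass q.1.out := by
    ext w
    rw [Set.mem_iUnion]
    constructor
    · intro hw
      exact ⟨⟨classMk w, (out_mem_iff hA w).2 hw⟩, classMk_eq_iff.1 (classMk_out _)⟩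
    · rintro ⟨q, hq⟩
      exact measurableSet_iff.1 hA _ q.2 hq
  conv_lhs => rw [h1]
  refine measure_iUnion (fun q q' hne => Set.disjoint_left.2 fun w hw hw' => hne ?_) fun q =>
    measurableSet_latticeClass _
  rw [← classMk_eq_iff, classMk_out] at hw hw'
  exact Subtype.ext (hw.trans hw'.symm)

section

variable {μ : Measure (LatticeGroup ρ X hX)} (hμ : IsEllipticMeasure μ)
include hμ

/-- Integrability for the trivial representation is integrability of the constant 1. -/
lemma IsEllipticMeasure.isFiniteMeasure : IsFiniteMeasure μ := by
  have h := hμ.integrable (Rep.trivial ℂ _ ℂ) (Rep.trivial ℂ _ ℂ)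
    (inferInstanceAs (FiniteDimensional ℂ ℂ)) (inferInstanceAs (FiniteDimensional ℂ ℂ))
  have h1 (w : LatticeGroup ρ X hX) :
      (Rep.trivial ℂ (LatticeGroup ρ X hX) ℂ).ρ.character w = 1 :=
    (LinearMap.trace_id ℂ ℂ).trans (by simp)
  simp only [h1, map_one, mul_one] at h
  exact (integrable_const_iff.1 h).resolve_left one_ne_zero

lemma IsEllipticMeasure.eulerPoincare_trivial (V : Rep.{0} ℂ (LatticeGroup ρ X hX))
    [hV : FiniteDimensional ℂ V] :
    (eulerPoincare (Rep.trivial ℂ (LatticeGroup ρ X hX) ℂ) V : ℂ) =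
      ∫ w, V.ρ.character w ∂μ := by
  rw [hμ.integral_eq (Rep.trivial ℂ _ ℂ) V (inferInstanceAs (FiniteDimensional ℂ ℂ)) hV]
  have h1 (w : LatticeGroup ρ X hX) :
      (Rep.trivial ℂ (LatticeGroup ρ X hX) ℂ).ρ.character w = 1 :=
    (LinearMap.trace_id ℂ ℂ).trans (by simp)
  simp only [h1, map_one, one_mul]

lemma IsEllipticMeasure.measure_latticeClass_conj (g w : LatticeGroup ρ X hX) :
    μ (latticeClass (g * w * g⁻¹)) = μ (latticeClass w) := by
  rw [← (hμ.conj_invariant g).measure_preimage (measurableSet_latticeClass _).nullMeasurableSet]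
  congr 1
  ext z
  refine ⟨fun hz => ?_, fun hz => conj_mem_latticeClass g hz⟩
  have h := conj_mem_latticeClass g⁻¹ hz
  convert h using 1
  · group
  · group

/-- A conjugacy class consists of the lattice classes in one finite Γ-orbit, all of the same measure
by conjugation invariance. -/
lemma IsEllipticMeasure.measure_conjugatesOf (w : LatticeGroup ρ X hX) :
    μ (conjugatesOf w) = Nat.card (MulAction.orbit Γ (classMk w)) * μ (latticeClass w) := by
  rw [measure_eq_tsum μ (measurableSet_conjugatesOf w)]
  have h1 (q : {q : LatticeClasses ρ X hX // q.out ∈ conjugatesOf w}) :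
      μ (latticeClass q.1.out) = μ (latticeClass w) := by
    obtain ⟨g, hg⟩ := isConj_iff.1 q.2
    rw [← hg, hμ.measure_latticeClass_conj]
  have h2 : {q : LatticeClasses ρ X hX | q.out ∈ conjugatesOf w} =
      MulAction.orbit Γ (classMk w) := by
    ext q
    rw [Set.mem_ofPred_eq, mem_conjugatesOf_iff_orbit, classMk_out]
  have h3 : Finite (MulAction.orbit Γ (classMk w)) := Set.finite_range _
  have h4 : Finite {q : LatticeClasses ρ X hX // q.out ∈ conjugatesOf w} :=
    (h2.symm ▸ Set.finite_coe_iff.1 h3 :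
      {q : LatticeClasses ρ X hX | q.out ∈ conjugatesOf w}.Finite).to_subtype
  have := Fintype.ofFinite {q : LatticeClasses ρ X hX // q.out ∈ conjugatesOf w}
  rw [tsum_congr h1, tsum_fintype, Finset.sum_const, Finset.card_univ, nsmul_eq_mul,
    ← Nat.card_eq_fintype_card, ← h2]
  rfl

end

/-- The integral of a class function on a finite quotient. -/
lemma integral_comp_of_classFunction (μ : Measure (LatticeGroup ρ X hX)) [IsFiniteMeasure μ]
    {H : Type} [Group H] [Fintype H] (p : LatticeGroup ρ X hX →* H) {f : H → ℂ}
    (hf : ∀ g h, f (h * g * h⁻¹) = f g) :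
    ∫ w, f (p w) ∂μ =
      ∑ h, (μ.real (p ⁻¹' conjugatesOf h) / Nat.card (conjugatesOf h) : ℂ) * f h := by
  classical
  have hm (h : H) : MeasurableSet (p ⁻¹' conjugatesOf h) := measurableSet_of_conj_mem fun g w hw => by
    refine IsConj.trans hw (isConj_iff.2 ⟨p g, ?_⟩)
    rw [map_mul, map_mul, map_inv]
  -- Division by the class size compensates for summing over all elements h instead of over classes.
  have hpt (w : LatticeGroup ρ X hX) : f (p w) =
      ∑ h, (p ⁻¹' conjugatesOf h).indicator
        (fun _ => f h / Nat.card (conjugatesOf h)) w := by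
    have h1 (h : H) : (p ⁻¹' conjugatesOf h).indicator
        (fun _ => f h / Nat.card (conjugatesOf h)) w =
          if h ∈ conjugatesOf (p w) then f (p w) / Nat.card (conjugatesOf (p w)) else 0 := by
      rw [Set.indicator_apply]
      have h2 : w ∈ p ⁻¹' conjugatesOf h ↔ h ∈ conjugatesOf (p w) := isConj_comm
      rw [if_congr h2 rfl rfl]
      refine if_ctx_congr Iff.rfl (fun h3 => ?_) fun _ => rfl
      rw [IsConj.conjugatesOf_eq h3]
      obtain ⟨g, rfl⟩ := isConj_iff.1 h3
      rw [hf]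
    rw [Finset.sum_congr rfl fun h _ => h1 h, Finset.sum_ite, Finset.sum_const_zero, add_zero,
      Finset.sum_const, nsmul_eq_mul]
    have h3 : (Finset.univ.filter fun h => h ∈ conjugatesOf (p w)).card =
        Nat.card (conjugatesOf (p w)) := (Nat.subtype_card _ (by simp)).symm
    have h4 : Nat.card (conjugatesOf (p w)) ≠ 0 :=
      have : Nonempty (conjugatesOf (p w)) := ⟨p w, mem_conjugatesOf_self⟩
      Nat.card_pos.ne'
    rw [h3, mul_div_cancel₀ _ (Nat.cast_ne_zero.2 h4)]
  rw [integral_congr_ae (Filter.Eventually.of_forall hpt), integral_finsetSum _ fun h _ =>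
    (integrable_const _).indicator (hm h)]
  refine Finset.sum_congr rfl fun h _ => ?_
  rw [integral_indicator_const _ (hm h), Complex.real_smul]
  ring

variable {μ ν : Measure (LatticeGroup ρ X hX)} (hμ : IsEllipticMeasure μ)
  (hν : IsEllipticMeasure ν)
include hμ hν

/-- Both measures integrate every character inflated from H to the same Euler characteristic, so the
difference of the normalized masses is a class function orthogonal to all characters. -/
lemma IsEllipticMeasure.measure_preimage_eq {H : Type} [Group H] [Finite H]
    (p : LatticeGroup ρ X hX →* H) (h : H) :
    μ (p ⁻¹' conjugatesOf h) = ν (p ⁻¹' conjugatesOf h) := by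
  have := Fintype.ofFinite H
  have := hμ.isFiniteMeasure
  have := hν.isFiniteMeasure
  have hconj (g h : H) : conjugatesOf (h * g * h⁻¹) = conjugatesOf g :=
    (IsConj.conjugatesOf_eq (isConj_iff.2 ⟨h, rfl⟩)).symm
  let φ (h : H) : ℂ := (μ.real (p ⁻¹' conjugatesOf h) / Nat.card (conjugatesOf h) : ℂ) -
    (ν.real (p ⁻¹' conjugatesOf h) / Nat.card (conjugatesOf h) : ℂ)
  have hφ : φ = 0 := by
    refine eq_zero_of_forall_sum_mul_character (fun g h => ?_) fun V _ _ _ τ => ?_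
    · simp only [φ, hconj]
    · have hV : FiniteDimensional ℂ (Rep.of (X := V) (τ.comp p)) :=
        inferInstanceAs (FiniteDimensional ℂ V)
      have h1 := (hμ.eulerPoincare_trivial (Rep.of (X := V) (τ.comp p))).symm.trans
        (hν.eulerPoincare_trivial (Rep.of (X := V) (τ.comp p)))
      have hc (g h : H) : τ.character (h * g * h⁻¹) = τ.character g := τ.char_conj g h
      have h2 := (integral_comp_of_classFunction μ p hc).symm.trans
        (Eq.trans h1 (integral_comp_of_classFunction ν p hc))
      simp only [φ, sub_mul, Finset.sum_sub_distrib, h2, sub_self]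
  have h1 := congrFun hφ h
  have h4 : (Nat.card (conjugatesOf h) : ℂ) ≠ 0 :=
    have : Nonempty (conjugatesOf h) := ⟨h, mem_conjugatesOf_self⟩
    Nat.cast_ne_zero.2 Nat.card_pos.ne'
  rw [← measureReal_eq_measureReal_iff]
  have h5 := sub_eq_zero.1 h1
  rw [div_left_inj' h4] at h5
  exact_mod_cast h5

/-- The class of w is the intersection of the preimages of its classes in the quotients by k!X.
Factorials make these preimages decreasing, and finiteness of the measures gives continuity from
above. -/
lemma IsEllipticMeasure.measure_conjugatesOf_eq (w : LatticeGroup ρ X hX) :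
    μ (conjugatesOf w) = ν (conjugatesOf w) := by
  have := hμ.isFiniteMeasure
  have := hν.isFiniteMeasure
  let S (k : ℕ) : Set (LatticeGroup ρ X hX) :=
    QuotientGroup.mk' (congruenceSubgroup ρ X hX k.factorial) ⁻¹'
      conjugatesOf (QuotientGroup.mk' (congruenceSubgroup ρ X hX k.factorial) w)
  have hS : conjugatesOf w = ⋂ k, S k := by
    refine Set.Subset.antisymm (Set.subset_iInter fun k z hz => ?_) fun z hz => ?_
    · exact MonoidHom.map_isConj _ hz
    · exact mem_conjugatesOf_of_forall fun k => mk_mem_conjugatesOf_iff.1 (Set.mem_iInter.1 hz k)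
  have hanti : Antitone S := fun k l hkl z hz => by
    obtain ⟨g, y, rfl⟩ := mk_mem_conjugatesOf_iff.1 hz
    obtain ⟨m, hm⟩ := Nat.factorial_dvd_factorial hkl
    exact mk_mem_conjugatesOf_iff.2 ⟨g, y ^ m, by rw [← pow_mul, mul_comm m, hm]⟩
  have hmeas (k : ℕ) : MeasurableSet (S k) := measurableSet_of_conj_mem fun g w hw => by
    refine IsConj.trans hw (isConj_iff.2 ⟨QuotientGroup.mk' _ g, ?_⟩)
    rw [map_mul, map_mul, map_inv]
  rw [hS, hanti.measure_iInter (fun k => (hmeas k).nullMeasurableSet) ⟨0, measure_ne_top _ _⟩,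
    hanti.measure_iInter (fun k => (hmeas k).nullMeasurableSet) ⟨0, measure_ne_top _ _⟩]
  refine iInf_congr fun k => ?_
  have := finite_quotient_congruenceSubgroup (ρ := ρ) (X := X) (hX := hX) k.factorial_ne_zero
  exact hμ.measure_preimage_eq hν _ _

theorem IsEllipticMeasure.unique : μ = ν := by
  refine Measure.ext fun A hA => ?_
  rw [measure_eq_tsum μ hA, measure_eq_tsum ν hA]
  refine tsum_congr fun q => ?_
  have h := hμ.measure_conjugatesOf_eq hν q.1.out
  have h3 : Finite (MulAction.orbit Γ (classMk q.1.out)) := Set.finite_range _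
  have h4 : Nat.card (MulAction.orbit Γ (classMk q.1.out)) ≠ 0 :=
    have : Nonempty (MulAction.orbit Γ (classMk q.1.out)) := ⟨⟨_, MulAction.mem_orbit_self _⟩⟩
    Nat.card_pos.ne'
  rw [hμ.measure_conjugatesOf, hν.measure_conjugatesOf] at h
  exact (ENNReal.mul_right_inj (Nat.cast_ne_zero.2 h4) (ENNReal.natCast_ne_top _)).1 h

end Uniqueness

end EllipticMeasure

end

theorem mainTheorem11 {Γ : Type} [Group Γ] [Finite Γ]
    {E : Type} [NormedAddCommGroup E] [NormedSpace ℝ E] [FiniteDimensional ℝ E]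
    (ρ : Representation ℝ Γ E)
    (X : Submodule ℤ E) [DiscreteTopology X] [IsZLattice ℝ X]
    (hX : ∀ γ, ∀ x ∈ X, ρ γ x ∈ X) :
    -- the alternating sum that defines the Euler-Poincaré characteristic is meaningful
    (∀ U V : Rep.{0} ℂ (EllipticMeasure.LatticeGroup ρ X hX),
      FiniteDimensional ℂ U → FiniteDimensional ℂ V →
        (∀ n, FiniteDimensional ℂ (EllipticMeasure.ExtGroup n U V)) ∧
        ∃ N, ∀ n, N ≤ n → Subsingleton (EllipticMeasure.ExtGroup n U V)) ∧
    -- existence and uniqueness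
    (∃! μ : Measure (EllipticMeasure.LatticeGroup ρ X hX),
      EllipticMeasure.IsEllipticMeasure μ) ∧
    ∀ μ : Measure (EllipticMeasure.LatticeGroup ρ X hX), EllipticMeasure.IsEllipticMeasure μ →
      -- the support
      EllipticMeasure.IsSupport μ {w | EllipticMeasure.IsElliptic w} ∧
      -- the masses of `L_c` and of the conjugacy class of `c`
      (∀ (c : EllipticMeasure.LatticeGroup ρ X hX) (e : E),
        EllipticMeasure.IsIsolatedFixpoint c e →
          μ (EllipticMeasure.latticeClass c) = (Nat.card Γ : ℝ≥0∞)⁻¹ ∧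
          {w : EllipticMeasure.LatticeGroup ρ X hX |
            EllipticMeasure.affineAct w e = e}.Finite ∧
          μ (conjugatesOf c) =
            ({w ∈ conjugatesOf c | EllipticMeasure.affineAct w e = e}.ncard : ℝ≥0∞) /
              ({w : EllipticMeasure.LatticeGroup ρ X hX |
                EllipticMeasure.affineAct w e = e}.ncard : ℝ≥0∞)) ∧
      -- the total mass
      μ Set.univ ≠ ∞ ∧
      (μ Set.univ).toReal =
        ((∑ᶠ n : ℕ, (-1) ^ n *
          (Module.finrank ℝ (EllipticMeasure.exteriorRep ρ n).invariants : ℤ) : ℤ) : ℝ) := by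
  refine ⟨fun U V _ _ => EllipticMeasure.extFinite_extGroup U V,
    ⟨EllipticMeasure.ellMeasure ρ X hX, EllipticMeasure.isEllipticMeasure_ellMeasure,
      fun ν hν => hν.unique EllipticMeasure.isEllipticMeasure_ellMeasure⟩, fun μ hμ => ?_⟩
  obtain rfl := hμ.unique EllipticMeasure.isEllipticMeasure_ellMeasure
  refine ⟨EllipticMeasure.isSupport_ellMeasure, fun c e he => ?_,
    EllipticMeasure.ellMeasure_univ_ne_top, EllipticMeasure.toReal_ellMeasure_univ⟩
  obtain ⟨hfix, hdet⟩ := EllipticMeasure.isIsolatedFixpoint_iff.1 he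
  exact ⟨EllipticMeasure.ellMeasure_latticeClass hdet,
    Set.finite_coe_iff.1 (EllipticMeasure.finite_pointStabilizer e),
    EllipticMeasure.ellMeasure_conjugatesOf_eq_div
      (c := (⟨c, hfix⟩ : EllipticMeasure.pointStabilizer ρ X hX e)) hdet⟩
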